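/- Let $(M,g)$ be a smooth finite-dimensional Riemannian manifold with Levi-Civita connection $\nabla$, and let $\Psi\in\Omega^{2k}(M)$ be a smooth differential form of even degree which is parallel, $\nabla\Psi=0$. Let $\hat\Psi=\partial_g\Psi$ be its metric contraction, $\hat\Psi=\sum_i(\iota_{e_i}\Psi)\otimes(e^i)^\#$, where $(e_i)$ is any basis of the tangent space with dual basis $(e^i)$ and $\#:T^*M\to TM$ is the isomorphism given by $g$; thus $\hat\Psi\in\Omega^{2k-1}(M,TM)$ (and $\hat\Psi=0$ if $k=0$). For $K\in\Omega^p(M,TM)$ let $\iota_K$ be the insertion, $\iota_{\kappa\otimes X}\alpha=\kappa\wedge\iota_X\alpha$ (zero on functions), let $\mathcal L_K\alpha=\iota_K(d\alpha)+(-1)^p\,d(\iota_K\alpha)$ be the Nijenhuis-Lie derivative, and let $[\cdot,\cdot]^{FN}:\Omega^p(M,TM)\times\Omega^q(M,TM)\to\Omega^{p+q}(M,TM)$ be the Frölicher-Nijenhuis bracket, that is, the $\mathbb R$-bilinear local operator with $$[\alpha\otimes X,\beta\otimes Y]^{FN}=\alpha\wedge\beta\otimes[X,Y]+\alpha\wedge\mathcal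 L_X\beta\otimes Y-\mathcal L_Y\alpha\wedge\beta\otimes X+(-1)^p\big(d\alpha\wedge\iota_X\beta\otimes Y+\iota_Y\alpha\wedge d\beta\otimes X\big)$$ for $\alpha\in\Omega^p(M)$, $\beta\in\Omega^q(M)$ and vector fields $X,Y$. Then $$[\hat\Psi,\hat\Psi]^{FN}=0.$$ Hence $\mathcal L_\Psi:=\mathcal L_{\hat\Psi}$ on $\Omega^*(M)$ and $ad_\Psi:=[\hat\Psi,\cdot]^{FN}$ on $\Omega^*(M,TM)$ are differentials: they are $\mathbb R$-linear maps $\Omega^l(M)\to\Omega^{l+2k-1}(M)$ and $\Omega^l(M,TM)\to\Omega^{l+2k-1}(M,TM)$ for every $l\ge 0$, with $\mathcal L_\Psi\circ\mathcal L_\Psi=0$ and $ad_\Psi\circ ad_\Psi=0$. -/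

import Mathlib

open Bundle Manifold
open scoped ContDiff

noncomputable section

namespace FN

/-! ### Exterior algebra of a finite-dimensional real vector space -/

section Fiber

variable {V : Type*} [AddCommGroup V] [Module ℝ V] [TopologicalSpace V]

/-- The multilinear map `(v₁, …, v_m) ↦ α (v₁, …, v_k) * β (v_{k+1}, …, v_m)`, where `m = k + l`. -/
def tensorMul {k l m : ℕ} (h : k + l = m) (α : V [⋀^Fin k]→L[ℝ] ℝ) (β : V [⋀^Fin l]→L[ℝ] ℝ) :
    ContinuousMultilinearMap ℝ (fun _ : Fin m => V) ℝ where
  toMultilinearMap :=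
    (LinearMap.mul' ℝ ℝ).compMultilinearMap
      ((α.toMultilinearMap.domCoprod β.toMultilinearMap).domDomCongr
        (finSumFinEquiv.trans (finCongr h)))
  cont := by
    have : Continuous fun v : Fin m → V =>
        α (fun i => v (Fin.cast h (Fin.castAdd l i))) *
          β (fun j => v (Fin.cast h (Fin.natAdd k j))) :=
      (α.cont.comp (continuous_pi fun _ => continuous_apply _)).mul
        (β.cont.comp (continuous_pi fun _ => continuous_apply _))
    exact this

theorem tensorMul_apply {k l m : ℕ} (h : k + l = m) (α : V [⋀^Fin k]→L[ℝ] ℝ)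
    (β : V [⋀^Fin l]→L[ℝ] ℝ) (v : Fin m → V) :
    tensorMul h α β v = α (fun i => v (Fin.cast h (Fin.castAdd l i))) *
      β (fun j => v (Fin.cast h (Fin.natAdd k j))) := rfl

/-- The wedge product `α ∧ β = 1 / (k! l!) ∑_σ sign σ (α ⊗ β) ∘ σ` of a `k`-form and an `l`-form
(so that `(dx ∧ dy) (∂x, ∂y) = 1`). The target degree `m` is any number equal to `k + l`. -/
def wedge {k l m : ℕ} (h : k + l = m) (α : V [⋀^Fin k]→L[ℝ] ℝ) (β : V [⋀^Fin l]→L[ℝ] ℝ) :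
    V [⋀^Fin m]→L[ℝ] ℝ :=
  ((k.factorial : ℝ) * (l.factorial : ℝ))⁻¹ •
    ContinuousMultilinearMap.alternatization (tensorMul h α β)

/-- The insertion `ι_v α = α (v, ·, …, ·)` of a vector into a form of positive degree. -/
def interior {l : ℕ} (v : V) (α : V [⋀^Fin (l + 1)]→L[ℝ] ℝ) : V [⋀^Fin l]→L[ℝ] ℝ where
  toMultilinearMap := (α.toAlternatingMap.curryLeft v).toMultilinearMap
  cont := by
    have : Continuous fun w : Fin l → V => α (Matrix.vecCons v w) :=
      α.cont.comp (continuous_const.matrixVecCons continuous_id)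
    exact this
  map_eq_zero_of_eq' := (α.toAlternatingMap.curryLeft v).map_eq_zero_of_eq'

theorem interior_apply {l : ℕ} (v : V) (α : V [⋀^Fin (l + 1)]→L[ℝ] ℝ) (w : Fin l → V) :
    interior v α w = α (Matrix.vecCons v w) := rfl

end Fiber

/-! ### Differential forms on a manifold

`M` is a manifold without boundary modelled on the finite-dimensional space `E`. Forms are
sections without any regularity; smoothness is the predicate defined below. -/

section Forms

variable {E : Type*} [NormedAddCommGroup E] [NormedSpace ℝ E]
  {M : Type*} [TopologicalSpace M] [ChartedSpace E M]

/-- Vector fields on `M`. -/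
abbrev VField (E : Type*) [NormedAddCommGroup E] [NormedSpace ℝ E]
    (M : Type*) [TopologicalSpace M] [ChartedSpace E M] :=
  ∀ x : M, TangentSpace 𝓘(ℝ, E) x

/-- Real-valued `k`-forms on `M`. -/
abbrev Form (E : Type*) [NormedAddCommGroup E] [NormedSpace ℝ E]
    (M : Type*) [TopologicalSpace M] [ChartedSpace E M] (k : ℕ) :=
  ∀ x : M, TangentSpace 𝓘(ℝ, E) x [⋀^Fin k]→L[ℝ] ℝ

/-- `TM`-valued `k`-forms on `M`. -/
abbrev VForm (E : Type*) [NormedAddCommGroup E] [NormedSpace ℝ E]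
    (M : Type*) [TopologicalSpace M] [ChartedSpace E M] (k : ℕ) :=
  ∀ x : M, TangentSpace 𝓘(ℝ, E) x [⋀^Fin k]→L[ℝ] TangentSpace 𝓘(ℝ, E) x

/-- The differential at `y` of the preferred chart around `x`. -/
def chartD (x y : M) : TangentSpace 𝓘(ℝ, E) y →L[ℝ] E :=
  mvfderiv 𝓘(ℝ, E) (extChartAt 𝓘(ℝ, E) x) y

/-- The form `α` read in the chart around `x`: its pullback under the inverse of the chart. -/
def Form.inChart {k : ℕ} (α : Form E M k) (x : M) (u : E) : E [⋀^Fin k]→L[ℝ] ℝ :=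
  (α ((extChartAt 𝓘(ℝ, E) x).symm u)).compContinuousLinearMap
    (chartD x ((extChartAt 𝓘(ℝ, E) x).symm u)).inverse

/-- The `TM`-valued form `K` read in the chart around `x`. -/
def VForm.inChart {k : ℕ} (K : VForm E M k) (x : M) (u : E) : E [⋀^Fin k]→L[ℝ] E :=
  (chartD x ((extChartAt 𝓘(ℝ, E) x).symm u)).compContinuousAlternatingMap
    ((K ((extChartAt 𝓘(ℝ, E) x).symm u)).compContinuousLinearMap
      (chartD x ((extChartAt 𝓘(ℝ, E) x).symm u)).inverse)

/-- `Ω^k(M)`: the smooth `k`-forms, that is, those which are smooth in the charts. -/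
def Ω (E : Type*) [NormedAddCommGroup E] [NormedSpace ℝ E]
    (M : Type*) [TopologicalSpace M] [ChartedSpace E M] (k : ℕ) : Submodule ℝ (Form E M k) where
  carrier := {α | ∀ x : M, ContDiffOn ℝ ∞ (Form.inChart α x) (extChartAt 𝓘(ℝ, E) x).target}
  add_mem' ha hb x := (ha x).add (hb x)
  zero_mem' _ := contDiffOn_const (c := (0 : E [⋀^Fin k]→L[ℝ] ℝ))
  smul_mem' c _ ha x := (ha x).const_smul c

/-- `Ω^k(M, TM)`: the smooth `TM`-valued `k`-forms. -/
def ΩT (E : Type*) [NormedAddCommGroup E] [NormedSpace ℝ E]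
    (M : Type*) [TopologicalSpace M] [ChartedSpace E M] (k : ℕ) : Submodule ℝ (VForm E M k) where
  carrier := {K | ∀ x : M, ContDiffOn ℝ ∞ (VForm.inChart K x) (extChartAt 𝓘(ℝ, E) x).target}
  add_mem' {a b} ha hb x := by
    refine ((ha x).add (hb x)).congr fun u _ => ?_
    ext v
    exact map_add (chartD x ((extChartAt 𝓘(ℝ, E) x).symm u)) _ _
  zero_mem' x := by
    refine (contDiffOn_const (c := (0 : E [⋀^Fin k]→L[ℝ] E))).congr fun u _ => ?_
    ext v
    exact map_zero (chartD x ((extChartAt 𝓘(ℝ, E) x).symm u))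
  smul_mem' c a ha x := by
    refine ((ha x).const_smul c).congr fun u _ => ?_
    ext v
    exact map_smul (chartD x ((extChartAt 𝓘(ℝ, E) x).symm u)) c _

/-- The exterior derivative, computed at `x` in the chart around `x`. -/
def extD {k : ℕ} (α : Form E M k) : Form E M (k + 1) := fun x =>
  (extDeriv (Form.inChart α x) (extChartAt 𝓘(ℝ, E) x x)).compContinuousLinearMap (chartD x x)

/-- The Lie derivative of a form along a vector field, `L_X = d ι_X + ι_X d`, where `ι_X` is `0`
on functions. -/
def lieD (X : VField E M) : {l : ℕ} → Form E M l → Form E M l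
  | 0, α => fun x => interior (X x) (extD α x)
  | _ + 1, α => fun x => extD (fun y => interior (X y) (α y)) x + interior (X x) (extD α x)

variable [FiniteDimensional ℝ E]

/-- The coordinate vector field `∂_i` of the chart around `x`, with respect to a fixed basis
of `E`. -/
def coordField (x : M) (i : Fin (Module.finrank ℝ E)) : VField E M := fun y =>
  (chartD x y).inverse (Module.finBasis ℝ E i)

/-- The `i`-th component `K^i = dx^i ∘ K` of a `TM`-valued form in the chart around `x`, so that
`K = ∑ i, K^i ⊗ ∂_i` there. -/
def component {k : ℕ} (x : M) (i : Fin (Module.finrank ℝ E)) (K : VForm E M k) : Form E M k :=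
  fun y => ((LinearMap.toContinuousLinearMap ((Module.finBasis ℝ E).coord i)).comp
    (chartD x y)).compContinuousAlternatingMap (K y)

/-- The insertion `ι_K α = ∑ i, K^i ∧ ι_{∂_i} α` of `K = ∑ i, K^i ⊗ ∂_i` into a form of positive
degree; the result has degree `k + l - 1`. -/
def insertion {k l : ℕ} (K : VForm E M k) (α : Form E M (l + 1)) : Form E M (k + l) := fun x =>
  ∑ i, wedge rfl (component x i K x) (interior (coordField x i x) (α x))

/-- The Nijenhuis-Lie derivative `L_K α = ι_K (dα) + (-1)^k d (ι_K α)`, where `ι_K α = 0` for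
`α` of degree `0`. -/
def nijLie {k : ℕ} (K : VForm E M k) : {l : ℕ} → Form E M l → Form E M (k + l)
  | 0, α => insertion K (extD α)
  | _ + 1, α => insertion K (extD α) + (-1 : ℝ) ^ k • extD (insertion K α)

/-- `dα ∧ ι_X β`, of degree `k + l`. -/
def extDWedgeInterior {k : ℕ} (α : Form E M k) (X : VField E M) :
    {l : ℕ} → Form E M l → Form E M (k + l)
  | 0, _ => 0
  | l + 1, β => fun x => wedge (Nat.succ_add_eq_add_succ k l) (extD α x) (interior (X x) (β x))

/-- `ι_Y α ∧ dβ`, of degree `k + l`. -/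
def interiorWedgeExtD (Y : VField E M) {l : ℕ} (β : Form E M l) :
    {k : ℕ} → Form E M k → Form E M (k + l)
  | 0, _ => 0
  | k + 1, α => fun x =>
    wedge (Nat.succ_add_eq_add_succ k l).symm (interior (Y x) (α x)) (extD β x)

/-- The Frölicher-Nijenhuis bracket of decomposable forms:
`[α ⊗ X, β ⊗ Y] = α ∧ β ⊗ [X, Y] + α ∧ L_X β ⊗ Y - L_Y α ∧ β ⊗ X`
`+ (-1)^k (dα ∧ ι_X β ⊗ Y + ι_Y α ∧ dβ ⊗ X)`. -/
def fnDecomposable {k l : ℕ} (α : Form E M k) (X : VField E M) (β : Form E M l) (Y : VField E M) :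
    VForm E M (k + l) := fun x =>
  (wedge rfl (α x) (β x)).smulRight (VectorField.mlieBracket 𝓘(ℝ, E) X Y x)
    + (wedge rfl (α x) (lieD X β x)).smulRight (Y x)
    - (wedge rfl (lieD Y α x) (β x)).smulRight (X x)
    + (-1 : ℝ) ^ k • ((extDWedgeInterior α X β x).smulRight (Y x)
      + (interiorWedgeExtD Y β α x).smulRight (X x))

/-- The Frölicher-Nijenhuis bracket of `TM`-valued forms. At `x` the forms are written as
`K = ∑ i, K^i ⊗ ∂_i` and `L = ∑ j, L^j ⊗ ∂_j` in the chart around `x`, and the bracket is the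
sum of the brackets of the decomposable summands. -/
def fnBracket {k l : ℕ} (K : VForm E M k) (L : VForm E M l) : VForm E M (k + l) := fun x =>
  ∑ i, ∑ j, fnDecomposable (component x i K) (coordField x i) (component x j L) (coordField x j) x

end Forms

/-- `D` restricts to a differential of degree `r` on the graded real vector space `⨁ l, S l`:
a linear map of degree `r` with `D ∘ D = 0`. -/
structure IsDifferential {A : ℕ → Type*} [∀ l, AddCommGroup (A l)] [∀ l, Module ℝ (A l)]
    (S : ∀ l, Submodule ℝ (A l)) (r : ℕ) (D : ∀ l, A l → A (r + l)) : Prop where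
  map_mem : ∀ l, ∀ a ∈ S l, D l a ∈ S (r + l)
  map_add : ∀ l, ∀ a ∈ S l, ∀ b ∈ S l, D l (a + b) = D l a + D l b
  map_smul : ∀ l (c : ℝ), ∀ a ∈ S l, D l (c • a) = c • D l a
  comp_self : ∀ l, ∀ a ∈ S l, D (r + l) (D l a) = 0

/-! ### Riemannian geometry -/

section Riemannian

variable {E : Type*} [NormedAddCommGroup E] [NormedSpace ℝ E] [FiniteDimensional ℝ E]
  {M : Type*} [TopologicalSpace M] [ChartedSpace E M]

instance (x : M) : FiniteDimensional ℝ (TangentSpace 𝓘(ℝ, E) x) :=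
  inferInstanceAs (FiniteDimensional ℝ E)

/-- The form `Ψ` is parallel for the connection `cov` on `TM`: for all `X`, `Y₁, …, Y_m`,
`(∇_X Ψ)(Y₁, …, Y_m) = X (Ψ (Y₁, …, Y_m)) - ∑ i, Ψ (Y₁, …, ∇_X Y_i, …, Y_m) = 0`.
(In Mathlib `∇_X Y` at `x` is `cov Y x (X x)`.) -/
def IsParallel [IsManifold 𝓘(ℝ, E) ∞ M]
    (cov : CovariantDerivative 𝓘(ℝ, E) E (fun x : M => TangentSpace 𝓘(ℝ, E) x))
    {m : ℕ} (Ψ : Form E M m) : Prop :=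
  ∀ (x : M) (X : TangentSpace 𝓘(ℝ, E) x) (Y : Fin m → VField E M),
    (∀ i, ContMDiffAt 𝓘(ℝ, E) 𝓘(ℝ, E).tangent ∞
      (fun y => (⟨y, Y i y⟩ : TangentBundle 𝓘(ℝ, E) M)) x) →
    mvfderiv 𝓘(ℝ, E) (fun y => Ψ y (fun i => Y i y)) x X
      - ∑ i, Ψ x (Function.update (fun j => Y j x) i (cov (Y i) x X)) = 0

variable [RiemannianBundle (fun x : M => TangentSpace 𝓘(ℝ, E) x)]

/-- `cov` is the Levi-Civita connection: it is torsion-free and compatible with the metric,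
`X ⟨Y, Z⟩ = ⟨∇_X Y, Z⟩ + ⟨Y, ∇_X Z⟩`. -/
structure IsLeviCivita [IsManifold 𝓘(ℝ, E) ∞ M]
    (cov : CovariantDerivative 𝓘(ℝ, E) E (fun x : M => TangentSpace 𝓘(ℝ, E) x)) : Prop where
  torsion_free : CovariantDerivative.torsion cov = 0
  metric : ∀ (x : M) (X : TangentSpace 𝓘(ℝ, E) x) (Y Z : VField E M),
    ContMDiffAt 𝓘(ℝ, E) 𝓘(ℝ, E).tangent ∞
      (fun y => (⟨y, Y y⟩ : TangentBundle 𝓘(ℝ, E) M)) x →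
    ContMDiffAt 𝓘(ℝ, E) 𝓘(ℝ, E).tangent ∞
      (fun y => (⟨y, Z y⟩ : TangentBundle 𝓘(ℝ, E) M)) x →
    mvfderiv 𝓘(ℝ, E) (fun y => inner ℝ (Y y) (Z y)) x X
      = inner ℝ (cov Y x X) (Z x) + inner ℝ (Y x) (cov Z x X)

/-- The metric contraction `∂_g Ψ = ∑ i, ι_{e_i} Ψ ⊗ (e^i)^♯`, where `e_i` is a basis of the
tangent space with dual basis `e^i`. An orthonormal basis is used, for which `(e^i)^♯ = e_i`.
It vanishes on functions. -/
def metricContraction : {m : ℕ} → Form E M m → VForm E M (m - 1)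
  | 0, _ => 0
  | _ + 1, Ψ => fun x =>
    ∑ i, (interior (stdOrthonormalBasis ℝ (TangentSpace 𝓘(ℝ, E) x) i) (Ψ x)).smulRight
      (stdOrthonormalBasis ℝ (TangentSpace 𝓘(ℝ, E) x) i)

end Riemannian

end FN

end

/-! Write `K` for the metric contraction of `Ψ` and `K = ∑ K^i ⊗ ∂_i` in a chart. The
Frölicher-Nijenhuis bracket has the components `[K, L]^i = L_K L^i - (-1)^(kl) L_L K^i`
(`compChart_fnBracket`), so in odd degree `[K, K]^j` is twice `L_K K^j = ∑ (K^i ∂_i K^j - dK^i ∧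
ι_{∂_i} K^j)`. The metric and `Ψ` are parallel, hence so is `K` (`fderiv_of_metric`): the
derivatives `∂_t K^j` are given by the Christoffel symbols acting on the values of `K`. After
substitution every term cancels, because the Christoffel symbols are symmetric while the odd
elements `K^i` and `dx^i` anticommute (`sum_connection_eq_zero`). Only first derivatives at a point
enter, so each point may be treated at the centre of its own chart.

The two differentials come from `L_[K,L] = [L_K, L_L]` (`SuperCalculus.lie_bracket`). Both sides are
superderivations, and such an operator is determined by its values on functions and on the
coordinate one-forms. For `[K, K] = 0` in odd degree this reads `2 L_K L_K = 0`. Expanding `[K, [K,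
L]]^i` with the same identity leaves only `L_K L_K L^i` and a multiple of `L_L L_K K^i`, which both
vanish; the graded Jacobi identity is not needed.

To make sign rules into ring identities, a form in a chart is turned by `toExt` into a function with
values in the exterior algebra of the dual space. The identities are proved in an abstract
`SuperCalculus`, instantiated by globally smooth functions, and carried to germs by multiplication
with a bump function. `fnBracket` is computed at each point in that point's own chart, so its
independence of the chart has to be proved. It follows by applying `[L_K, L_L]`, which does not
depend on a chart, to coordinate functions. -/

noncomputable section

namespace FN

/-! ### Superderivations and an abstract calculus of differential forms -/

section Super

variable {A : Type*} [Ring A] [Algebra ℝ A] {γ : A →ₐ[ℝ] A}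

/-- `b` has parity `p` with respect to the grading involution `γ` and supercommutes with
everything. -/
structure IsHom (γ : A →ₐ[ℝ] A) (p : ℕ) (b : A) : Prop where
  grade : γ b = (-1 : ℝ) ^ p • b
  comm : ∀ a, b * a = (γ ^ p) a * b

/-- `D` is a superderivation of parity `p` with respect to the grading involution `γ`. -/
structure IsSuperDer (γ : A →ₐ[ℝ] A) (p : ℕ) (D : A →ₗ[ℝ] A) : Prop where
  leibniz : ∀ a b, D (a * b) = D a * b + (γ ^ p) a * D b
  grade : ∀ a, D (γ a) = (-1 : ℝ) ^ p • γ (D a)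

theorem neg_one_pow_smul_smul {V : Type*} [AddCommGroup V] [Module ℝ V] (p : ℕ) (a : V) :
    (-1 : ℝ) ^ p • (-1 : ℝ) ^ p • a = a := by
  rw [smul_smul, ← mul_pow]; simp

theorem IsHom.grade_pow {p : ℕ} {b : A} (h : IsHom γ p b) (q : ℕ) :
    (γ ^ q) b = (-1 : ℝ) ^ (p * q) • b := by
  induction q with
  | zero => simp
  | succ q ih => rw [pow_succ, AlgHom.mul_apply, h.grade, map_smul, ih, smul_smul, mul_add_one,
      pow_add, mul_comm]

theorem IsHom.zero (p : ℕ) : IsHom γ p 0 := ⟨by simp, by simp⟩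

theorem IsHom.add {p : ℕ} {b c : A} (hb : IsHom γ p b) (hc : IsHom γ p c) : IsHom γ p (b + c) :=
  ⟨by rw [map_add, hb.grade, hc.grade, smul_add], fun a => by
    rw [add_mul, mul_add, hb.comm, hc.comm]⟩

theorem IsHom.smul {p : ℕ} {b : A} (hb : IsHom γ p b) (r : ℝ) : IsHom γ p (r • b) :=
  ⟨by rw [map_smul, hb.grade, smul_comm], fun a => by
    rw [smul_mul_assoc, mul_smul_comm, hb.comm]⟩

theorem IsHom.sub {p : ℕ} {b c : A} (hb : IsHom γ p b) (hc : IsHom γ p c) : IsHom γ p (b - c) := by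
  simpa [sub_eq_add_neg] using hb.add (hc.smul (-1))

theorem IsHom.sum {p : ℕ} {I : Type*} {s : Finset I} {b : I → A} (hb : ∀ i ∈ s, IsHom γ p (b i)) :
    IsHom γ p (∑ i ∈ s, b i) := by
  classical
  induction s using Finset.induction_on with
  | empty => simpa using IsHom.zero p
  | insert i s hi ih =>
    rw [Finset.sum_insert hi]
    exact (hb i (by simp)).add (ih fun j hj => hb j (by simp [hj]))

theorem IsHom.mul {p q : ℕ} {b c : A} (hb : IsHom γ p b) (hc : IsHom γ q c) :
    IsHom γ (p + q) (b * c) :=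
  ⟨by rw [map_mul, hb.grade, hc.grade, smul_mul_smul_comm, pow_add], fun a => by
    rw [mul_assoc, hc.comm, ← mul_assoc, hb.comm, mul_assoc, pow_add, AlgHom.mul_apply]⟩

/-- Two supercommuting elements. -/
theorem IsHom.comm_hom {p q : ℕ} {b c : A} (hb : IsHom γ p b) (hc : IsHom γ q c) :
    b * c = (-1 : ℝ) ^ (p * q) • (c * b) := by
  rw [hb.comm, hc.grade_pow, smul_mul_assoc, mul_comm]

/-- Parities are natural numbers, but only their class mod 2 matters. This is needed for `L_K`,
which arises as a supercommutator of parity `(k + 1) + 1`. -/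
theorem IsSuperDer.of_add_two {p : ℕ} {D : A →ₗ[ℝ] A} (hγ : γ ^ 2 = 1)
    (h : IsSuperDer γ (p + 2) D) : IsSuperDer γ p D :=
  ⟨fun a b => by simpa [pow_add, hγ] using h.leibniz a b, fun a => by
    simpa [pow_add] using h.grade a⟩

theorem IsSuperDer.grade_pow {p : ℕ} {D : A →ₗ[ℝ] A} (h : IsSuperDer γ p D) (q : ℕ) (a : A) :
    D ((γ ^ q) a) = (-1 : ℝ) ^ (p * q) • (γ ^ q) (D a) := by
  induction q generalizing a with
  | zero => simp
  | succ q ih =>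
    rw [pow_succ', AlgHom.mul_apply, h.grade, ih, map_smul, smul_smul, AlgHom.mul_apply, mul_add_one,
      pow_add, mul_comm]

theorem IsSuperDer.zero (p : ℕ) : IsSuperDer γ p 0 := ⟨by simp, by simp⟩

theorem IsSuperDer.add {p : ℕ} {D D' : A →ₗ[ℝ] A} (h : IsSuperDer γ p D)
    (h' : IsSuperDer γ p D') : IsSuperDer γ p (D + D') :=
  ⟨fun a b => by
    simp only [LinearMap.add_apply, h.leibniz, h'.leibniz, add_mul, mul_add]; abel, fun a => by
    simp only [LinearMap.add_apply, h.grade, h'.grade, map_add, smul_add]⟩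

theorem IsSuperDer.smul {p : ℕ} {D : A →ₗ[ℝ] A} (h : IsSuperDer γ p D) (r : ℝ) :
    IsSuperDer γ p (r • D) :=
  ⟨fun a b => by
    simp only [LinearMap.smul_apply, h.leibniz, smul_add, smul_mul_assoc, mul_smul_comm], fun a => by
    simp only [LinearMap.smul_apply, h.grade, map_smul, smul_comm r]⟩

theorem IsSuperDer.sub {p : ℕ} {D D' : A →ₗ[ℝ] A} (h : IsSuperDer γ p D)
    (h' : IsSuperDer γ p D') : IsSuperDer γ p (D - D') := by
  rw [sub_eq_add_neg, ← neg_one_smul ℝ D']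
  exact h.add (h'.smul (-1))

theorem IsSuperDer.sum {p : ℕ} {I : Type*} {s : Finset I} {D : I → A →ₗ[ℝ] A}
    (hD : ∀ i ∈ s, IsSuperDer γ p (D i)) : IsSuperDer γ p (∑ i ∈ s, D i) := by
  classical
  induction s using Finset.induction_on with
  | empty => simpa using IsSuperDer.zero p
  | insert i s hi ih =>
    rw [Finset.sum_insert hi]
    exact (hD i (by simp)).add (ih fun j hj => hD j (by simp [hj]))

/-- The Leibniz rule survives because `b` can be moved past `γ^q x` at the cost of a further `γ^p`.
This is why components of forms are required to supercommute with everything. -/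
theorem IsSuperDer.mulLeft {p q : ℕ} {b : A} {D : A →ₗ[ℝ] A} (hb : IsHom γ p b)
    (h : IsSuperDer γ q D) : IsSuperDer γ (p + q) (LinearMap.mulLeft ℝ b ∘ₗ D) :=
  ⟨fun x y => by
    simp only [LinearMap.comp_apply, LinearMap.mulLeft_apply, h.leibniz, mul_add]
    rw [← mul_assoc b ((γ ^ q) x), hb.comm ((γ ^ q) x), pow_add, AlgHom.mul_apply]
    simp only [mul_assoc], fun a => by
    simp only [LinearMap.comp_apply, LinearMap.mulLeft_apply, h.grade, map_mul, hb.grade,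
      mul_smul_comm, smul_mul_assoc, smul_smul, pow_add]
    rw [mul_right_comm, ← mul_pow]; simp⟩

/-- The supercommutator of operators of parities `p` and `q`. -/
def superComm (p q : ℕ) (D D' : A →ₗ[ℝ] A) : A →ₗ[ℝ] A :=
  D ∘ₗ D' - (-1 : ℝ) ^ (p * q) • D' ∘ₗ D

theorem superComm_apply (p q : ℕ) (D D' : A →ₗ[ℝ] A) (a : A) :
    superComm p q D D' a = D (D' a) - (-1 : ℝ) ^ (p * q) • D' (D a) := rfl

/-- The mixed terms, with one operator on each factor, occur in both compositions and cancel through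
the sign `(-1)^(pq)` picked up when an operator passes the involution. -/
theorem IsSuperDer.superComm {p q : ℕ} {D D' : A →ₗ[ℝ] A} (h : IsSuperDer γ p D)
    (h' : IsSuperDer γ q D') : IsSuperDer γ (p + q) (superComm p q D D') :=
  ⟨fun a b => by
    simp only [superComm_apply, h.leibniz, h'.leibniz, map_add, h.grade_pow, h'.grade_pow,
      smul_add, sub_mul, mul_sub, smul_mul_assoc, mul_smul_comm, mul_comm q p,
      neg_one_pow_smul_smul]
    rw [show (γ ^ p) ((γ ^ q) a) = (γ ^ (p + q)) a by rw [pow_add]; rfl,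
      show (γ ^ q) ((γ ^ p) a) = (γ ^ (p + q)) a by rw [add_comm, pow_add]; rfl]
    abel, fun a => by
    simp only [superComm_apply, h.grade, h'.grade, map_smul, map_sub, smul_sub, smul_smul, pow_add]
    congr 2 <;> ring⟩

/-- A superderivation maps supercommuting elements to supercommuting elements. -/
theorem IsSuperDer.isHom {p q : ℕ} {b : A} {D : A →ₗ[ℝ] A} (h : IsSuperDer γ p D)
    (hb : IsHom γ q b) : IsHom γ (p + q) (D b) := by
  have hg : γ (D b) = (-1 : ℝ) ^ (p + q) • D b := by
    have := h.grade b
    rw [hb.grade, map_smul] at this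
    rw [pow_add, mul_smul, this, neg_one_pow_smul_smul]
  refine ⟨hg, fun a => ?_⟩
  -- Apply `D` to the commutation rule of `b` and expand both sides: the terms containing `D a`
  -- agree since `b` supercommutes with `D a`, and what remains is the rule for `D b`.
  have := congrArg D (hb.comm a)
  rw [h.leibniz, h.leibniz, h.grade_pow, hb.grade_pow, smul_mul_assoc, hb.comm (D a),
    smul_mul_assoc, mul_comm q p, add_comm] at this
  rw [pow_add]
  exact add_left_cancel this

/-- An algebra with the operations of the algebra of differential forms in coordinates. -/
structure SuperCalculus (ι A : Type*) [DecidableEq ι] [Ring A] [Algebra ℝ A] where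
  /-- the grading involution -/
  γ : A →ₐ[ℝ] A
  /-- the coordinate derivatives -/
  pd : ι → A →ₗ[ℝ] A
  /-- the insertions of the coordinate vector fields -/
  ic : ι → A →ₗ[ℝ] A
  /-- the coordinate one-forms -/
  e : ι → A
  /-- the functions -/
  S : Set A
  γ_sq : γ ^ 2 = 1
  pd_der : ∀ i, IsSuperDer γ 0 (pd i)
  ic_der : ∀ i, IsSuperDer γ 1 (ic i)
  e_hom : ∀ i, IsHom γ 1 (e i)
  pd_S : ∀ i, ∀ f ∈ S, pd i f ∈ S
  ic_S : ∀ i, ∀ f ∈ S, ic i f = 0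
  pd_comm : ∀ i j a, pd i (pd j a) = pd j (pd i a)
  pd_ic : ∀ i j a, pd i (ic j a) = ic j (pd i a)
  pd_e : ∀ i j, pd i (e j) = 0
  ic_e : ∀ i j, ic i (e j) = if i = j then 1 else 0
  der_ext : ∀ p D, IsSuperDer γ p D → (∀ f ∈ S, D f = 0) → (∀ i, D (e i) = 0) → D = 0

namespace SuperCalculus

variable {ι A : Type*} [DecidableEq ι] [Ring A] [Algebra ℝ A] (C : SuperCalculus ι A)

theorem e_mul_e (i j : ι) : C.e i * C.e j = -(C.e j * C.e i) := by
  simpa using (C.e_hom i).comm_hom (C.e_hom j)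

theorem ic_mul_S (i : ι) (a : A) {f : A} (hf : f ∈ C.S) : C.ic i (a * f) = C.ic i a * f := by
  rw [(C.ic_der i).leibniz, C.ic_S i f hf]; simp

variable [Fintype ι]

/-- The exterior derivative. -/
def d : A →ₗ[ℝ] A := ∑ i, LinearMap.mulLeft ℝ (C.e i) ∘ₗ C.pd i

/-- The insertion of a vector-valued form, given by its components. -/
def ins (K : ι → A) : A →ₗ[ℝ] A := ∑ i, LinearMap.mulLeft ℝ (K i) ∘ₗ C.ic i

/-- The Nijenhuis-Lie derivative. -/
def lie (k : ℕ) (K : ι → A) : A →ₗ[ℝ] A := C.ins K ∘ₗ C.d + (-1 : ℝ) ^ k • C.d ∘ₗ C.ins K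

/-- The Frölicher-Nijenhuis bracket of vector-valued forms, given by their components. -/
def bracket (k l : ℕ) (K L : ι → A) (i : ι) : A :=
  C.lie k K (L i) - (-1 : ℝ) ^ (k * l) • C.lie l L (K i)

theorem d_apply (a : A) : C.d a = ∑ i, C.e i * C.pd i a := by
  simp [d, LinearMap.sum_apply]

theorem ins_apply (K : ι → A) (a : A) : C.ins K a = ∑ i, K i * C.ic i a := by
  simp [ins, LinearMap.sum_apply]

theorem lie_apply (k : ℕ) (K : ι → A) (a : A) :
    C.lie k K a = C.ins K (C.d a) + (-1 : ℝ) ^ k • C.d (C.ins K a) := rfl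

theorem d_der : IsSuperDer C.γ 1 C.d :=
  .sum fun i _ => (C.pd_der i).mulLeft (C.e_hom i)

theorem ins_der {k : ℕ} {K : ι → A} (hK : ∀ i, IsHom C.γ k (K i)) :
    IsSuperDer C.γ (k + 1) (C.ins K) :=
  .sum fun i _ => (C.ic_der i).mulLeft (hK i)

/-- Insertion of a `k`-form has parity `k + 1`, and `-(-1)^(k + 1) = (-1)^k` is the sign in the
definition of `L_K`. -/
theorem lie_eq_superComm (k : ℕ) (K : ι → A) :
    C.lie k K = superComm (k + 1) 1 (C.ins K) C.d := by
  ext a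
  simp [lie_apply, superComm_apply, pow_succ]

theorem lie_der {k : ℕ} {K : ι → A} (hK : ∀ i, IsHom C.γ k (K i)) :
    IsSuperDer C.γ k (C.lie k K) := by
  rw [lie_eq_superComm]
  exact ((C.ins_der hK).superComm C.d_der).of_add_two C.γ_sq

theorem d_e (i : ι) : C.d (C.e i) = 0 := by
  simp [d_apply, C.pd_e]

/-- Swapping the two summation indices gives a sign from `e i * e j` and none from the second
derivatives, so `d d a` equals its own negative. -/
theorem d_d (a : A) : C.d (C.d a) = 0 := by
  have h : ∀ i j, C.pd i (C.e j * C.pd j a) = C.e j * C.pd i (C.pd j a) := fun i j => by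
    rw [(C.pd_der i).leibniz, C.pd_e]; simp
  have key : C.d (C.d a) = -C.d (C.d a) := by
    conv_lhs => rw [d_apply]
    simp only [d_apply, map_sum, h, Finset.mul_sum, ← mul_assoc]
    rw [← Finset.sum_neg_distrib]
    refine Finset.sum_congr rfl fun i _ => ?_
    rw [← Finset.sum_neg_distrib]
    refine Finset.sum_congr rfl fun j _ => ?_
    rw [C.e_mul_e, C.pd_comm, neg_mul]
  have h2 : (2 : ℝ) • C.d (C.d a) = 0 := by
    rw [two_smul]; nth_rewrite 1 [key]; simp
  simpa using h2

theorem ins_e (K : ι → A) (i : ι) : C.ins K (C.e i) = K i := by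
  simp [ins_apply, C.ic_e]

theorem ins_S (K : ι → A) {f : A} (hf : f ∈ C.S) : C.ins K f = 0 := by
  simp [ins_apply, C.ic_S _ f hf]

theorem lie_e (k : ℕ) (K : ι → A) (i : ι) : C.lie k K (C.e i) = (-1 : ℝ) ^ k • C.d (K i) := by
  rw [lie_apply, d_e, ins_e, map_zero, zero_add]

/-- On coordinate functions this returns the components of `K`, which is how a vector-valued form is
recovered from its Lie derivative. -/
theorem lie_S (k : ℕ) (K : ι → A) {f : A} (hf : f ∈ C.S) :
    C.lie k K f = ∑ i, K i * C.pd i f := by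
  rw [lie_apply, C.ins_S K hf, map_zero, smul_zero, add_zero, ins_apply]
  refine Finset.sum_congr rfl fun i _ => ?_
  simp [d_apply, C.ic_mul_S i _ (C.pd_S _ f hf), C.ic_e]

/-- Cartan's formula for the coordinate vector fields. -/
theorem ic_d (i : ι) (a : A) : C.ic i (C.d a) = C.pd i a - C.d (C.ic i a) := by
  simp only [d_apply, map_sum, (C.ic_der i).leibniz, C.ic_e, pow_one, (C.e_hom _).grade, C.pd_ic,
    Finset.sum_add_distrib]
  simp [sub_eq_add_neg]

theorem lie_d (k : ℕ) (K : ι → A) (a : A) :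
    C.lie k K (C.d a) = (-1 : ℝ) ^ k • C.d (C.lie k K a) := by
  simp [lie_apply, d_d, map_smul]

/-- The Nijenhuis-Lie derivative in coordinates. -/
theorem lie_apply' {k : ℕ} {K : ι → A} (hK : ∀ i, IsHom C.γ k (K i)) (a : A) :
    C.lie k K a = ∑ i, (K i * C.pd i a + (-1 : ℝ) ^ k • (C.d (K i) * C.ic i a)) := by
  rw [lie_apply, ins_apply, ins_apply, map_sum, Finset.smul_sum, ← Finset.sum_add_distrib]
  refine Finset.sum_congr rfl fun i _ => ?_
  rw [C.d_der.leibniz, C.ic_d, pow_one, (hK i).grade, smul_add, smul_mul_assoc,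
    neg_one_pow_smul_smul, mul_sub]
  abel

theorem bracket_hom {k l : ℕ} {K L : ι → A} (hK : ∀ i, IsHom C.γ k (K i))
    (hL : ∀ i, IsHom C.γ l (L i)) (i : ι) : IsHom C.γ (k + l) (C.bracket k l K L i) :=
  ((C.lie_der hK).isHom (hL i)).sub ((add_comm l k ▸ (C.lie_der hL).isHom (hK i)).smul _)

/-- The Nijenhuis-Lie derivative along the Frölicher-Nijenhuis bracket is the supercommutator of
the Nijenhuis-Lie derivatives. -/
theorem lie_bracket {k l : ℕ} {K L : ι → A} (hK : ∀ i, IsHom C.γ k (K i))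
    (hL : ∀ i, IsHom C.γ l (L i)) (a : A) :
    C.lie (k + l) (C.bracket k l K L) a =
      C.lie k K (C.lie l L a) - (-1 : ℝ) ^ (k * l) • C.lie l L (C.lie k K a) := by
  suffices h : C.lie (k + l) (C.bracket k l K L) - superComm k l (C.lie k K) (C.lie l L) = 0 by
    rw [← superComm_apply, ← sub_eq_zero, ← LinearMap.sub_apply, h, LinearMap.zero_apply]
  -- The difference is a superderivation of parity `k + l`, so it suffices to test it on functions
  -- and on the coordinate one-forms.
  refine C.der_ext (k + l) _ ((C.lie_der (C.bracket_hom hK hL)).sub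
    ((C.lie_der hK).superComm (C.lie_der hL))) (fun f hf => ?_) fun i => ?_
  · rw [LinearMap.sub_apply, superComm_apply, C.lie_S _ _ hf, C.lie_S _ _ hf, C.lie_S _ _ hf,
      sub_eq_zero, map_sum, map_sum]
    simp only [(C.lie_der hK).leibniz, (C.lie_der hL).leibniz, (hK _).grade_pow, (hL _).grade_pow,
      C.lie_S _ _ (C.pd_S _ f hf), bracket, sub_mul, Finset.sum_sub_distrib,
      Finset.sum_add_distrib, smul_mul_assoc, smul_add, Finset.smul_sum, Finset.mul_sum,
      neg_one_pow_smul_smul, mul_comm l k]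
    -- The first-order terms are the bracket. The second-order terms cancel, since exchanging the
    -- components costs `(-1)^(kl)` and partial derivatives commute.
    have : ∑ i, ∑ j, (-1 : ℝ) ^ (k * l) • (L i * (K j * C.pd j (C.pd i f))) =
        ∑ i, ∑ j, K i * (L j * C.pd j (C.pd i f)) := by
      rw [Finset.sum_comm]
      refine Finset.sum_congr rfl fun i _ => Finset.sum_congr rfl fun j _ => ?_
      rw [← mul_assoc, ← mul_assoc, (hK i).comm_hom (hL j), C.pd_comm, smul_mul_assoc]
    rw [this]
    abel
  -- On `e i` every Lie derivative is, up to sign, `d` of a component, and Lie derivatives pass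
  -- through `d` with a sign; both sides become `d` of the bracket component.
  · rw [LinearMap.sub_apply, superComm_apply, lie_e, lie_e, lie_e, map_smul, map_smul, lie_d, lie_d,
      bracket, map_sub, map_smul, smul_sub, smul_smul, smul_smul, smul_smul, smul_smul,
      pow_add, mul_comm ((-1 : ℝ) ^ l), sub_eq_zero]
    congr 2
    ring

end SuperCalculus

end Super

/-! ### Alternating forms inside the exterior algebra of the dual space -/

section ToExt

variable (E : Type*) [NormedAddCommGroup E] [NormedSpace ℝ E]

/-- The exterior algebra of the dual space. -/
abbrev Ext := ExteriorAlgebra ℝ (Module.Dual ℝ E)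

variable {E}

/-- The grading involution of the exterior algebra. -/
abbrev extInv : Ext E →ₐ[ℝ] Ext E := CliffordAlgebra.involute

theorem extInv_sq : (extInv : Ext E →ₐ[ℝ] Ext E) ^ 2 = 1 := by
  rw [pow_two]
  exact CliffordAlgebra.involute_comp_involute

/-- The insertion of a vector in the exterior algebra of the dual space. -/
def contr (v : E) : Ext E →ₗ[ℝ] Ext E :=
  CliffordAlgebra.contractLeft (Q := (0 : QuadraticForm ℝ (Module.Dual ℝ E)))
    (Module.Dual.eval ℝ E v)

theorem contr_ι_mul (v : E) (φ : Module.Dual ℝ E) (a : Ext E) :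
    contr v (ExteriorAlgebra.ι ℝ φ * a) = φ v • a - ExteriorAlgebra.ι ℝ φ * contr v a :=
  CliffordAlgebra.contractLeft_ι_mul ..

theorem contr_ι (v : E) (φ : Module.Dual ℝ E) :
    contr v (ExteriorAlgebra.ι ℝ φ) = algebraMap ℝ (Ext E) (φ v) :=
  CliffordAlgebra.contractLeft_ι ..

theorem contr_algebraMap (v : E) (r : ℝ) : contr v (algebraMap ℝ (Ext E) r) = 0 :=
  CliffordAlgebra.contractLeft_algebraMap ..

theorem ext_induction {P : Ext E → Prop} (h0 : ∀ r : ℝ, P (algebraMap ℝ _ r))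
    (hadd : ∀ a b, P a → P b → P (a + b))
    (hmul : ∀ φ a, P a → P (ExteriorAlgebra.ι ℝ φ * a)) (a : Ext E) : P a :=
  CliffordAlgebra.left_induction (P := P) (Q := 0) h0 hadd (fun x m h => hmul m x h) a

theorem contr_mul (v : E) (a b : Ext E) :
    contr v (a * b) = contr v a * b + extInv a * contr v b := by
  induction a using ext_induction with
  | h0 r => rw [contr_algebraMap, AlgHom.commutes, ← Algebra.smul_def, ← Algebra.smul_def]; simp
  | hadd a a' h h' => simp only [add_mul, map_add, h, h']; abel
  | hmul φ a h =>
    rw [mul_assoc, contr_ι_mul, contr_ι_mul, h, map_mul, CliffordAlgebra.involute_ι, sub_mul,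
      smul_mul_assoc, mul_add]
    simp only [neg_mul, mul_assoc]
    abel

theorem contr_extInv (v : E) (a : Ext E) : contr v (extInv a) = -extInv (contr v a) := by
  induction a using ext_induction with
  | h0 r => rw [AlgHom.commutes, contr_algebraMap]; simp
  | hadd a a' h h' => simp only [map_add, h, h']; abel
  | hmul φ a h =>
    rw [map_mul, CliffordAlgebra.involute_ι, neg_mul, map_neg, contr_ι_mul, contr_ι_mul, h, map_sub,
      map_smul, map_mul, CliffordAlgebra.involute_ι]
    simp

theorem contr_isSuperDer (v : E) : IsSuperDer extInv 1 (contr v) :=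
  ⟨fun a b => by rw [contr_mul, pow_one], fun a => by rw [contr_extInv]; simp⟩

theorem ι_isHom (φ : Module.Dual ℝ E) : IsHom extInv 1 (ExteriorAlgebra.ι ℝ φ : Ext E) := by
  refine ⟨by rw [CliffordAlgebra.involute_ι]; simp, fun a => ?_⟩
  rw [pow_one]
  induction a using ext_induction with
  | h0 r => rw [AlgHom.commutes, Algebra.commutes]
  | hadd a a' h h' => rw [mul_add, h, h', map_add, add_mul]
  | hmul ψ a h =>
    have h2 : ExteriorAlgebra.ι ℝ φ * ExteriorAlgebra.ι ℝ ψ =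
        -(ExteriorAlgebra.ι ℝ ψ * ExteriorAlgebra.ι ℝ φ) :=
      eq_neg_of_add_eq_zero_left (ExteriorAlgebra.ι_add_mul_swap φ ψ)
    rw [map_mul, CliffordAlgebra.involute_ι, ← mul_assoc, h2, neg_mul, mul_assoc, h, neg_mul,
      neg_mul, mul_assoc]

theorem algebraMap_isHom (r : ℝ) : IsHom extInv 0 (algebraMap ℝ (Ext E) r) :=
  ⟨by rw [AlgHom.commutes]; simp, fun a => by rw [Algebra.commutes]; simp⟩

variable [FiniteDimensional ℝ E]

variable (E) in
/-- The indices of the coordinates of `E`. -/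
abbrev Idx := Fin (Module.finrank ℝ E)

variable (E) in
/-- The basis vectors of `E`. -/
abbrev vec (i : Idx E) : E := Module.finBasis ℝ E i

/-- The dual basis, as elements of the exterior algebra. -/
def cov (i : Idx E) : Ext E := ExteriorAlgebra.ι ℝ ((Module.finBasis ℝ E).coord i)

theorem cov_isHom (i : Idx E) : IsHom extInv 1 (cov i : Ext E) := ι_isHom _

theorem contr_cov (v : E) (i : Idx E) :
    contr v (cov i) = algebraMap ℝ (Ext E) ((Module.finBasis ℝ E).repr v i) :=
  contr_ι _ _

theorem contr_cov_mul (v : E) (i : Idx E) (a : Ext E) :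
    contr v (cov i * a) = (Module.finBasis ℝ E).repr v i • a - cov i * contr v a :=
  contr_ι_mul _ _ _

/-- The product of the dual basis elements with given indices. -/
def covProd {k : ℕ} (I : Fin k → Idx E) : Ext E :=
  ExteriorAlgebra.ιMulti ℝ k fun j => (Module.finBasis ℝ E).coord (I j)

/-- An alternating form as an element of the exterior algebra of the dual space. -/
def toExt (k : ℕ) : E [⋀^Fin k]→L[ℝ] ℝ →ₗ[ℝ] Ext E where
  -- All multi-indices are summed, so each increasing one is counted `k!` times; the factor
  -- compensates.
  toFun α := (k.factorial : ℝ)⁻¹ • ∑ I : Fin k → Idx E, α (fun j => vec E (I j)) • covProd I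
  map_add' α β := by
    rw [← smul_add, ← Finset.sum_add_distrib]
    simp [add_smul]
  map_smul' c α := by
    simp only [RingHom.id_apply, smul_comm c, Finset.smul_sum, ContinuousAlternatingMap.smul_apply,
      smul_assoc]

theorem toExt_apply {k : ℕ} (α : E [⋀^Fin k]→L[ℝ] ℝ) : toExt k α =
    (k.factorial : ℝ)⁻¹ • ∑ I : Fin k → Idx E, α (fun j => vec E (I j)) • covProd I := rfl

theorem toExt_zero (α : E [⋀^Fin 0]→L[ℝ] ℝ) : toExt 0 α = algebraMap ℝ _ (α ![]) := by
  rw [toExt_apply, Fintype.sum_unique]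
  simp only [Nat.factorial_zero, Nat.cast_one, inv_one, one_smul, covProd,
    ExteriorAlgebra.ιMulti_zero_apply, Algebra.algebraMap_eq_smul_one]
  congr 2
  exact Subsingleton.elim _ _

/-- Splitting off the first index gives the recursion on which the inductions on the degree rest. -/
theorem toExt_succ {k : ℕ} (α : E [⋀^Fin (k + 1)]→L[ℝ] ℝ) : toExt (k + 1) α =
    ((k + 1 : ℕ) : ℝ)⁻¹ • ∑ i, cov i * toExt k (interior (vec E i) α) := by
  simp only [toExt_apply, mul_smul_comm, ← Finset.smul_sum, smul_smul]
  rw [← mul_inv, ← Nat.cast_mul, ← Nat.factorial_succ,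
    ← (Fin.consEquiv (fun _ : Fin (k + 1) => Idx E)).sum_comp, Fintype.sum_prod_type]
  congr 1
  refine Finset.sum_congr rfl fun i _ => ?_
  rw [Finset.mul_sum]
  refine Finset.sum_congr rfl fun I _ => ?_
  rw [mul_smul_comm, interior_apply]
  congr 1
  · congr 1
    funext j
    refine Fin.cases ?_ (fun j => ?_) j <;> simp
  · rw [covProd, ExteriorAlgebra.ιMulti_succ_apply]
    rfl

theorem sum_vec {F : Type*} [AddCommGroup F] [Module ℝ F] (f : E →ₗ[ℝ] F) (v : E) :
    ∑ i, (Module.finBasis ℝ E).repr v i • f (vec E i) = f v := by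
  conv_rhs => rw [← (Module.finBasis ℝ E).sum_repr v]
  simp only [map_sum, map_smul]

/-- The insertion as a linear map in the vector. -/
def interiorₗ {k : ℕ} (α : E [⋀^Fin (k + 1)]→L[ℝ] ℝ) : E →ₗ[ℝ] E [⋀^Fin k]→L[ℝ] ℝ where
  toFun v := interior v α
  map_add' v w := by
    ext u
    exact α.toAlternatingMap.map_vecCons_add u v w
  map_smul' c v := by
    ext u
    exact α.toAlternatingMap.map_vecCons_smul u c v

theorem interior_interior {k : ℕ} (α : E [⋀^Fin (k + 2)]→L[ℝ] ℝ) (v w : E) :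
    interior v (interior w α) = -interior w (interior v α) := by
  ext u
  simp only [interior_apply, ContinuousAlternatingMap.neg_apply]
  refine Eq.trans ?_ (α.toAlternatingMap.map_swap (i := 0) (j := 1) _ (by simp))
  refine congrArg α ?_
  funext j
  refine Fin.cases ?_ (fun j => Fin.cases ?_ (fun j => ?_) j) j
  · simp
  · simp
  · simp [Equiv.swap_apply_of_ne_of_ne (a := (0 : Fin (k + 2))) (b := 1) (x := j.succ.succ)
      (by simp) (by simp [Fin.ext_iff])]

/-- Contracting `cov i * toExt (ι_i α)` yields one copy of `ι_v α` from `cov i`. In the inductive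
step the other factor yields `k + 1` more, since insertions anticommute, and the total `k + 2`
cancels the factor in `toExt_succ`. -/
theorem contr_toExt {k : ℕ} (v : E) (α : E [⋀^Fin (k + 1)]→L[ℝ] ℝ) :
    contr v (toExt (k + 1) α) = toExt k (interior v α) := by
  have key : ∀ {k : ℕ} (v : E) (α : E [⋀^Fin (k + 1)]→L[ℝ] ℝ),
      ∑ i, (Module.finBasis ℝ E).repr v i • toExt k (interior (vec E i) α) =
        toExt k (interior v α) := fun v α => sum_vec (toExt _ ∘ₗ interiorₗ α) v
  induction k with
  | zero =>
    rw [toExt_succ]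
    simp only [map_smul, map_sum, contr_cov_mul, Finset.sum_sub_distrib, key]
    simp [toExt_zero, contr_algebraMap]
  | succ k ih =>
    rw [toExt_succ]
    simp only [map_smul, map_sum, contr_cov_mul, Finset.sum_sub_distrib, key, ih]
    have : ∑ i, cov i * toExt k (interior v (interior (vec E i) α)) =
        -(((k + 1 : ℕ) : ℝ) • toExt (k + 1) (interior v α)) := by
      rw [toExt_succ, smul_inv_smul₀ (by positivity), ← Finset.sum_neg_distrib]
      refine Finset.sum_congr rfl fun i _ => ?_
      rw [interior_interior, map_neg, mul_neg]
    rw [this, sub_neg_eq_add]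
    nth_rewrite 1 [← one_smul ℝ (toExt (k + 1) (interior v α))]
    rw [← add_smul, smul_smul]
    push_cast
    rw [add_comm (1 : ℝ), inv_mul_cancel₀ (by positivity), one_smul]

/-- A form of positive degree vanishes if all its insertions do, and insertions are visible in the
exterior algebra. Finite-dimensionality of the spaces of forms follows. -/
theorem toExt_injective (k : ℕ) : Function.Injective (toExt k (E := E)) := by
  rw [injective_iff_map_eq_zero]
  induction k with
  | zero =>
    intro α h
    rw [toExt_zero, map_eq_zero_iff _ (algebraMap ℝ (Ext E)).injective] at h
    ext v
    rw [Subsingleton.elim v ![], h]; rfl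
  | succ k ih =>
    intro α h
    ext v
    have := ih (interior (v 0) α) (by rw [← contr_toExt, h, map_zero])
    rw [← Matrix.cons_head_tail v]
    exact congrArg (fun β => β (Matrix.vecTail v)) this

instance : FiniteDimensional ℝ (Ext E) :=
  .of_basis (Module.finBasis ℝ (Module.Dual ℝ E)).ExteriorAlgebra

instance (k : ℕ) : FiniteDimensional ℝ (E [⋀^Fin k]→L[ℝ] ℝ) :=
  .of_injective (toExt k) (toExt_injective k)

theorem covProd_comp_perm {k : ℕ} (I : Fin k → Idx E) (σ : Equiv.Perm (Fin k)) :
    covProd (I ∘ σ) = Equiv.Perm.sign σ • covProd I :=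
  (ExteriorAlgebra.ιMulti ℝ k).map_perm (fun j => (Module.finBasis ℝ E).coord (I j)) σ

/-- After reindexing, the sign of a permutation is absorbed by `covProd`, so all `k!` permutations
contribute equally. -/
theorem toExt_alternatization {k : ℕ} (f : ContinuousMultilinearMap ℝ (fun _ : Fin k => E) ℝ) :
    toExt k (ContinuousMultilinearMap.alternatization f) =
      ∑ I : Fin k → Idx E, f (fun j => vec E (I j)) • covProd I := by
  have h : ∀ σ : Equiv.Perm (Fin k), ∑ I : Fin k → Idx E,
      (Equiv.Perm.sign σ • f ((fun j => vec E (I j)) ∘ σ)) • covProd I =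
      ∑ I : Fin k → Idx E, f (fun j => vec E (I j)) • covProd I := fun σ => by
    rw [← (Equiv.arrowCongr σ (Equiv.refl (Idx E))).sum_comp]
    refine Finset.sum_congr rfl fun I _ => ?_
    have : (Equiv.arrowCongr σ (Equiv.refl (Idx E))) I = I ∘ σ.symm := rfl
    rw [this, covProd_comp_perm, Equiv.Perm.sign_symm]
    have h1 : ((fun j => vec E ((I ∘ σ.symm) j)) ∘ σ) = fun j => vec E (I j) := by
      funext j; simp
    rw [h1, Units.smul_def, Units.smul_def, smul_comm, ← smul_assoc, smul_smul]
    simp [← Units.val_mul, Int.units_mul_self]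
  rw [toExt_apply]
  simp only [ContinuousMultilinearMap.alternatization_apply_apply, Finset.sum_smul]
  rw [Finset.sum_comm]
  simp only [h, Finset.sum_const, Finset.card_univ, Fintype.card_perm, Fintype.card_fin]
  rw [← Nat.cast_smul_eq_nsmul ℝ, inv_smul_smul₀ (by positivity)]

/-- The factor `1 / (k! l!)` of `wedge` is the product of the two normalisations of `toExt`;
multi-indices of length `k + l` are concatenations. -/
theorem toExt_wedge {k l m : ℕ} (h : k + l = m) (α : E [⋀^Fin k]→L[ℝ] ℝ)
    (β : E [⋀^Fin l]→L[ℝ] ℝ) : toExt m (wedge h α β) = toExt k α * toExt l β := by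
  subst h
  rw [wedge, map_smul, toExt_alternatization, toExt_apply, toExt_apply, smul_mul_smul_comm,
    ← mul_inv, ← (Fin.appendEquiv k l).sum_comp, Fintype.sum_prod_type, Finset.sum_mul_sum]
  congr 1
  refine Finset.sum_congr rfl fun I _ => Finset.sum_congr rfl fun J _ => ?_
  rw [smul_mul_smul_comm, tensorMul_apply]
  congr 1
  · simp [Fin.appendEquiv]
  · rw [covProd, covProd, covProd, ExteriorAlgebra.ιMulti_mul_ιMulti]
    congr 1
    funext j
    refine Fin.addCases (fun j => ?_) (fun j => ?_) j <;> simp [Fin.appendEquiv]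

theorem toExt_isHom {k : ℕ} (α : E [⋀^Fin k]→L[ℝ] ℝ) : IsHom extInv k (toExt k α) := by
  induction k with
  | zero => rw [toExt_zero]; exact algebraMap_isHom _
  | succ k ih =>
    rw [toExt_succ]
    exact (IsHom.sum fun i _ => add_comm k 1 ▸ (cov_isHom i).mul (ih _)).smul _

/-- A pointwise Cartan formula: among the terms of the antisymmetrisation, one has `v` in the slot
of `B`, and in the others `v` stays the first argument of the form. -/
theorem interior_alternatizeUncurryFin {k : ℕ} (B : E →L[ℝ] E [⋀^Fin (k + 1)]→L[ℝ] ℝ)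
    (B' : E → E →L[ℝ] E [⋀^Fin k]→L[ℝ] ℝ) (hB' : ∀ v w, B' v w = interior v (B w)) (v : E) :
    interior v (ContinuousAlternatingMap.alternatizeUncurryFin B) =
      B v - ContinuousAlternatingMap.alternatizeUncurryFin (B' v) := by
  ext u
  rw [interior_apply, ContinuousAlternatingMap.alternatizeUncurryFin_apply, Fin.sum_univ_succ]
  simp only [ContinuousAlternatingMap.sub_apply,
    ContinuousAlternatingMap.alternatizeUncurryFin_apply, hB', interior_apply]
  rw [sub_eq_add_neg, ← Finset.sum_neg_distrib]
  congr 1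
  · simp
  · refine Finset.sum_congr rfl fun i _ => ?_
    have : (Fin.removeNth i.succ (Matrix.vecCons v u)) = Matrix.vecCons v (Fin.removeNth i u) := by
      funext j
      refine Fin.cases ?_ (fun j => ?_) j <;> simp [Fin.removeNth]
    rw [this]
    simp [pow_succ]

/-- Insertion as a continuous linear map. -/
def interiorL {k : ℕ} (v : E) : E [⋀^Fin (k + 1)]→L[ℝ] ℝ →L[ℝ] E [⋀^Fin k]→L[ℝ] ℝ :=
  LinearMap.toContinuousLinearMap
    { toFun := fun α => interior v α
      map_add' := fun _ _ => rfl
      map_smul' := fun _ _ => rfl }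

/-- Applied to a derivative this is `d = ∑ dx^i ∧ ∂_i`. The counting is that of `contr_toExt`, with
the Cartan formula above in place of the contraction rule. -/
theorem toExt_alternatizeUncurryFin {k : ℕ} (B : E →L[ℝ] E [⋀^Fin k]→L[ℝ] ℝ) :
    toExt (k + 1) (ContinuousAlternatingMap.alternatizeUncurryFin B) =
      ∑ i, cov i * toExt k (B (vec E i)) := by
  induction k with
  | zero =>
    rw [toExt_succ]
    simp only [Nat.zero_add, Nat.cast_one, inv_one, one_smul, toExt_zero, interior_apply,
      ContinuousAlternatingMap.alternatizeUncurryFin_apply]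
    refine Finset.sum_congr rfl fun i _ => ?_
    congr 2
    simp
  | succ k ih =>
    rw [toExt_succ]
    have h : ∀ i, toExt (k + 1) (interior (vec E i)
        (ContinuousAlternatingMap.alternatizeUncurryFin B)) = toExt (k + 1) (B (vec E i)) -
        ∑ j, cov j * toExt k (interior (vec E i) (B (vec E j))) := fun i => by
      rw [interior_alternatizeUncurryFin B (fun v => (interiorL v).comp B) (fun _ _ => rfl),
        map_sub, ih]
      rfl
    simp only [h, mul_sub, Finset.mul_sum, Finset.sum_sub_distrib]
    have h2 : ∑ i, ∑ j, cov i * (cov j * toExt k (interior (vec E i) (B (vec E j)))) =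
        -(((k + 1 : ℕ) : ℝ) • ∑ j, cov j * toExt (k + 1) (B (vec E j))) := by
      rw [Finset.sum_comm, Finset.smul_sum, ← Finset.sum_neg_distrib]
      refine Finset.sum_congr rfl fun j _ => ?_
      rw [toExt_succ, mul_smul_comm, smul_inv_smul₀ (by positivity), Finset.mul_sum,
        ← Finset.sum_neg_distrib]
      refine Finset.sum_congr rfl fun i _ => ?_
      rw [← mul_assoc, ← mul_assoc, (cov_isHom i).comm_hom (cov_isHom j)]
      simp
    rw [h2, sub_neg_eq_add]
    nth_rewrite 1 [← one_smul ℝ (∑ j, cov j * toExt (k + 1) (B (vec E j)))]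
    rw [← add_smul, smul_smul]
    push_cast
    rw [add_comm (1 : ℝ), inv_mul_cancel₀ (by positivity), one_smul]

attribute [irreducible] toExt

end ToExt

/-! ### Smooth functions with values in the exterior algebra, and their germs -/

section Smooth

open Filter Topology

variable {E : Type*} [NormedAddCommGroup E] [NormedSpace ℝ E] [FiniteDimensional ℝ E]

/-- The norm is that of the coordinates in a basis; in finite dimension the choice does not affect
smoothness. -/
instance : NormedAddCommGroup (Ext E) :=
  NormedAddCommGroup.induced (Ext E) (Fin (Module.finrank ℝ (Ext E)) → ℝ)
    (Module.finBasis ℝ (Ext E)).equivFun (Module.finBasis ℝ (Ext E)).equivFun.injective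

instance : NormedSpace ℝ (Ext E) :=
  NormedSpace.induced ℝ (Ext E) (Fin (Module.finrank ℝ (Ext E)) → ℝ)
    (Module.finBasis ℝ (Ext E)).equivFun

/-- The multiplication of the exterior algebra as a continuous bilinear map. -/
def extMul : Ext E →L[ℝ] Ext E →L[ℝ] Ext E :=
  LinearMap.toContinuousLinearMap
    ((LinearMap.toContinuousLinearMap : (Ext E →ₗ[ℝ] Ext E) ≃ₗ[ℝ] Ext E →L[ℝ] Ext E).toLinearMap ∘ₗ
      LinearMap.mul ℝ (Ext E))

theorem extMul_apply (a b : Ext E) : extMul a b = a * b := rfl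

theorem contDiff_linear {n : WithTop ℕ∞} {V W : Type*} [NormedAddCommGroup V] [NormedSpace ℝ V]
    [FiniteDimensional ℝ V] [NormedAddCommGroup W] [NormedSpace ℝ W] (φ : V →ₗ[ℝ] W) :
    ContDiff ℝ n φ :=
  (LinearMap.toContinuousLinearMap φ).contDiff

theorem fderiv_linear_comp {V W : Type*} [NormedAddCommGroup V] [NormedSpace ℝ V]
    [FiniteDimensional ℝ V] [NormedAddCommGroup W] [NormedSpace ℝ W] (φ : V →ₗ[ℝ] W) {f : E → V}
    {u : E} (hf : DifferentiableAt ℝ f u) (v : E) :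
    fderiv ℝ (fun w => φ (f w)) u v = φ (fderiv ℝ f u v) := by
  have := ((LinearMap.toContinuousLinearMap φ).hasFDerivAt.comp u hf.hasFDerivAt).fderiv
  exact congrArg (fun L => L v) this

theorem fderiv_ext_mul {f g : E → Ext E} {u : E} (hf : DifferentiableAt ℝ f u)
    (hg : DifferentiableAt ℝ g u) (v : E) : fderiv ℝ (fun w => f w * g w) u v =
      fderiv ℝ f u v * g u + f u * fderiv ℝ g u v := by
  have := (extMul.hasFDerivAt_of_bilinear hf.hasFDerivAt hg.hasFDerivAt).fderiv
  have h2 := congrArg (fun L => L v) this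
  refine Eq.trans h2 ?_
  simp [extMul_apply, add_comm]

theorem contDiff_ext_mul {n : WithTop ℕ∞} {f g : E → Ext E} (hf : ContDiff ℝ n f)
    (hg : ContDiff ℝ n g) : ContDiff ℝ n fun u => f u * g u :=
  (extMul.contDiff.comp hf).clm_apply hg

variable (E) in
/-- The algebra of smooth functions with values in the exterior algebra. -/
def SmoothAlg : Subalgebra ℝ (E → Ext E) where
  carrier := {f | ContDiff ℝ ∞ f}
  mul_mem' {f g} (hf : ContDiff ℝ ∞ f) (hg : ContDiff ℝ ∞ g) :=
    show ContDiff ℝ ∞ (fun u => f u * g u) from contDiff_ext_mul hf hg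
  add_mem' {f g} (hf : ContDiff ℝ ∞ f) (hg : ContDiff ℝ ∞ g) :=
    show ContDiff ℝ ∞ (fun u => f u + g u) from hf.add hg
  algebraMap_mem' r := show ContDiff ℝ ∞ (fun _ => algebraMap ℝ (Ext E) r) from contDiff_const

theorem SmoothAlg.contDiff (f : SmoothAlg E) : ContDiff ℝ ∞ f.1 := f.2

/-- A smooth function as an element of the algebra of smooth functions. -/
def SmoothAlg.mk (f : E → Ext E) (hf : ContDiff ℝ ∞ f) : SmoothAlg E := ⟨f, hf⟩

/-- Postcomposition with a linear map. -/
def SmoothAlg.map (φ : Ext E →ₗ[ℝ] Ext E) : SmoothAlg E →ₗ[ℝ] SmoothAlg E where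
  toFun f := SmoothAlg.mk (fun u => φ (f.1 u)) ((contDiff_linear φ).comp (SmoothAlg.contDiff f))
  map_add' f g := by ext u; exact map_add φ _ _
  map_smul' c f := by ext u; exact map_smul φ _ _

/-- The grading involution. -/
def SmoothAlg.inv : SmoothAlg E →ₐ[ℝ] SmoothAlg E where
  toFun f := SmoothAlg.mk (fun u => extInv (f.1 u))
    ((contDiff_linear (extInv : Ext E →ₐ[ℝ] Ext E).toLinearMap).comp (SmoothAlg.contDiff f))
  map_one' := by ext u; exact map_one extInv
  map_mul' f g := by ext u; exact map_mul extInv _ _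
  map_zero' := by ext u; exact map_zero extInv
  map_add' f g := by ext u; exact map_add extInv _ _
  commutes' r := by ext u; exact extInv.commutes r

theorem SmoothAlg.inv_pow_apply (p : ℕ) (f : SmoothAlg E) (u : E) :
    ((SmoothAlg.inv ^ p) f).1 u = (extInv ^ p) (f.1 u) := by
  induction p generalizing f with
  | zero => rfl
  | succ p ih => rw [pow_succ, pow_succ, AlgHom.mul_apply, AlgHom.mul_apply, ih]; rfl

theorem SmoothAlg.differentiable (f : SmoothAlg E) (u : E) : DifferentiableAt ℝ f.1 u :=
  ((SmoothAlg.contDiff f).differentiable (by simp)).differentiableAt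

theorem contDiff_fderiv_apply {V : Type*} [NormedAddCommGroup V] [NormedSpace ℝ V] {f : E → V}
    (hf : ContDiff ℝ ∞ f) (v : E) : ContDiff ℝ ∞ fun u => fderiv ℝ f u v :=
  (hf.fderiv_right (m := ∞) (by simp)).clm_apply contDiff_const

/-- The derivative in a fixed direction. -/
def SmoothAlg.deriv (v : E) : SmoothAlg E →ₗ[ℝ] SmoothAlg E where
  toFun f := SmoothAlg.mk (fun u => fderiv ℝ f.1 u v) (contDiff_fderiv_apply (SmoothAlg.contDiff f) v)
  map_add' f g := by
    ext u
    exact congrArg (fun L => L v) (fderiv_add (SmoothAlg.differentiable f u) (SmoothAlg.differentiable g u))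
  map_smul' c f := by
    ext u
    exact congrArg (fun L => L v) (fderiv_const_smul (SmoothAlg.differentiable f u) c)

/-- Constant functions. -/
def SmoothAlg.const (a : Ext E) : SmoothAlg E := SmoothAlg.mk (fun _ => a) contDiff_const

theorem SmoothAlg.isHom_iff {p : ℕ} {f : SmoothAlg E} :
    IsHom SmoothAlg.inv p f ↔ ∀ u, IsHom extInv p (f.1 u) := by
  constructor
  · intro h u
    refine ⟨congrFun (congrArg Subtype.val h.grade) u, fun a => ?_⟩
    -- Constant functions already test the commutation rule against every element of the fibre.
    have := congrFun (congrArg Subtype.val (h.comm (SmoothAlg.const a))) u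
    refine this.trans ?_
    change ((SmoothAlg.inv ^ p) _).1 u * _ = _
    rw [SmoothAlg.inv_pow_apply]
    rfl
  · intro h
    refine ⟨Subtype.ext (funext fun u => (h u).grade), fun a => Subtype.ext (funext fun u => ?_)⟩
    refine ((h u).comm (a.1 u)).trans ?_
    change _ = ((SmoothAlg.inv ^ p) _).1 u * _
    rw [SmoothAlg.inv_pow_apply]

/-- Scalar functions. -/
def SmoothAlg.scalar (f : E → ℝ) (hf : ContDiff ℝ ∞ f) : SmoothAlg E :=
  SmoothAlg.mk (fun u => algebraMap ℝ (Ext E) (f u))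
    ((contDiff_linear (Algebra.linearMap ℝ (Ext E))).comp hf)

/-- The one-forms `cov i` and the scalars generate the constants, so `D` kills constants. Every
smooth function is a finite sum of a scalar function times a constant basis element, so `D` kills
everything. -/
theorem SmoothAlg.der_ext (p : ℕ) (D : SmoothAlg E →ₗ[ℝ] SmoothAlg E)
    (hD : IsSuperDer SmoothAlg.inv p D) (hS : ∀ f hf, D (SmoothAlg.scalar f hf) = 0)
    (he : ∀ i : Idx E, D (SmoothAlg.const (cov i)) = 0) : D = 0 := by
  have hι : ∀ φ : Module.Dual ℝ E, D (SmoothAlg.const (ExteriorAlgebra.ι ℝ φ)) = 0 := by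
    intro φ
    have : SmoothAlg.const (ExteriorAlgebra.ι ℝ φ) =
        ∑ i, φ (vec E i) • SmoothAlg.const (cov i : Ext E) := by
      ext u
      rw [AddSubmonoidClass.coe_finsetSum, Finset.sum_apply]
      change ExteriorAlgebra.ι ℝ φ = ∑ i, φ (vec E i) • cov i
      have h : φ = ∑ i, φ (vec E i) • (Module.finBasis ℝ E).coord i := by
        refine (Module.finBasis ℝ E).ext fun j => ?_
        simp
      conv_lhs => rw [h]
      simp only [map_sum, map_smul, cov]
    rw [this, map_sum]
    exact Finset.sum_eq_zero fun i _ => by rw [map_smul, he, smul_zero]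
  have hc : ∀ a : Ext E, D (SmoothAlg.const a) = 0 := by
    intro a
    induction a using ext_induction with
    | h0 r => exact hS (fun _ => r) contDiff_const
    | hadd a b ha hb =>
      have : SmoothAlg.const (a + b) = SmoothAlg.const a + SmoothAlg.const b := rfl
      rw [this, map_add, ha, hb, add_zero]
    | hmul φ a ha =>
      have : SmoothAlg.const (ExteriorAlgebra.ι ℝ φ * a) =
        SmoothAlg.const (ExteriorAlgebra.ι ℝ φ) * SmoothAlg.const a := rfl
      rw [this, hD.leibniz, hι, ha, zero_mul, mul_zero, add_zero]
  ext1 f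
  let b := Module.finBasis ℝ (Ext E)
  have hf : f = ∑ i, SmoothAlg.scalar (fun u => b.coord i (f.1 u))
      ((contDiff_linear (b.coord i)).comp (SmoothAlg.contDiff f)) * SmoothAlg.const (b i) := by
    ext u
    rw [AddSubmonoidClass.coe_finsetSum, Finset.sum_apply]
    change _ = ∑ i, algebraMap ℝ (Ext E) (b.coord i (f.1 u)) * b i
    simp only [← Algebra.smul_def]
    exact (b.sum_repr _).symm
  rw [hf, map_sum]
  exact Finset.sum_eq_zero fun i _ => by rw [hD.leibniz, hS, hc, zero_mul, mul_zero, add_zero]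

variable (E) in
/-- The calculus of differential forms on a finite-dimensional vector space. -/
def calculus : SuperCalculus (Idx E) (SmoothAlg E) where
  γ := SmoothAlg.inv
  pd i := SmoothAlg.deriv (vec E i)
  ic i := SmoothAlg.map (contr (vec E i))
  e i := SmoothAlg.const (cov i)
  S := {f | ∃ g hg, f = SmoothAlg.scalar g hg}
  γ_sq := by
    ext f u
    rw [SmoothAlg.inv_pow_apply, extInv_sq]
    rfl
  pd_der i := ⟨fun a b => by
    ext u
    exact fderiv_ext_mul (SmoothAlg.differentiable a u) (SmoothAlg.differentiable b u) _, fun a => by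
    ext u
    refine (fderiv_linear_comp (extInv : Ext E →ₐ[ℝ] Ext E).toLinearMap (SmoothAlg.differentiable a u) _).trans ?_
    rw [pow_zero, one_smul]
    rfl⟩
  ic_der i := ⟨fun a b => by
    ext u
    rw [pow_one]
    exact contr_mul _ _ _, fun a => by
    ext u
    refine (contr_extInv _ _).trans ?_
    rw [pow_one, neg_one_smul]
    rfl⟩
  e_hom i := SmoothAlg.isHom_iff.2 fun _ => cov_isHom i
  pd_S i f hf := by
    obtain ⟨g, hg, rfl⟩ := hf
    refine ⟨fun u => fderiv ℝ g u (vec E i), contDiff_fderiv_apply hg _, ?_⟩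
    ext u
    exact fderiv_linear_comp (Algebra.linearMap ℝ (Ext E))
      (hg.differentiable (by simp)).differentiableAt _
  ic_S i f hf := by
    obtain ⟨g, hg, rfl⟩ := hf
    ext u
    exact contr_algebraMap _ _
  pd_comm i j f := by
    ext u
    have h : DifferentiableAt ℝ (fderiv ℝ f.1) u :=
      (((SmoothAlg.contDiff f).fderiv_right (m := ∞) (by simp)).differentiable (by simp)).differentiableAt
    have h2 : ∀ v w : E, fderiv ℝ (fun w' => fderiv ℝ f.1 w' v) u w =
        fderiv ℝ (fderiv ℝ f.1) u w v := fun v w => by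
      rw [fderiv_clm_apply h (differentiableAt_const v)]
      simp
    change fderiv ℝ (fun w' => fderiv ℝ f.1 w' (vec E j)) u (vec E i) =
      fderiv ℝ (fun w' => fderiv ℝ f.1 w' (vec E i)) u (vec E j)
    rw [h2, h2]
    exact ((SmoothAlg.contDiff f).contDiffAt.isSymmSndFDerivAt (n := ∞) (by simpa using ENat.LEInfty.out)) _ _
  pd_ic i j f := by
    ext u
    exact fderiv_linear_comp (contr (vec E j)) (SmoothAlg.differentiable f u) _
  pd_e i j := by
    ext u
    change fderiv ℝ (fun _ => (cov j : Ext E)) u _ = 0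
    simp
  ic_e i j := by
    ext u
    change contr (vec E i) (cov j) = _
    rw [contr_cov]
    by_cases h : i = j <;> simp [h]
  der_ext p D hD hS he := SmoothAlg.der_ext p D hD (fun f hf => hS _ ⟨f, hf, rfl⟩) he

/-! ### Local operators -/

/-- The exterior derivative of functions with values in the exterior algebra. -/
def dE (f : E → Ext E) (u : E) : Ext E := ∑ i, cov i * fderiv ℝ f u (vec E i)

/-- The insertion of a vector-valued form. -/
def insE (K : Idx E → E → Ext E) (f : E → Ext E) (u : E) : Ext E :=
  ∑ i, K i u * contr (vec E i) (f u)

/-- The Nijenhuis-Lie derivative. -/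
def lieE (k : ℕ) (K : Idx E → E → Ext E) (f : E → Ext E) (u : E) : Ext E :=
  insE K (dE f) u + (-1 : ℝ) ^ k • dE (insE K f) u

/-- The Frölicher-Nijenhuis bracket. -/
def bracketE (k l : ℕ) (K L : Idx E → E → Ext E) (i : Idx E) (u : E) : Ext E :=
  lieE k K (L i) u - (-1 : ℝ) ^ (k * l) • lieE l L (K i) u

/-- The local operators accept arbitrary functions, so that they apply to chart expressions which
are smooth only near a point; on globally smooth functions they agree with the calculus. -/
theorem calculus_d (f : SmoothAlg E) : ((calculus E).d f).1 = dE f.1 := by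
  ext u
  rw [SuperCalculus.d_apply, AddSubmonoidClass.coe_finsetSum, Finset.sum_apply]
  rfl

theorem calculus_ins (K : Idx E → SmoothAlg E) (f : SmoothAlg E) :
    ((calculus E).ins K f).1 = insE (fun i => (K i).1) f.1 := by
  ext u
  rw [SuperCalculus.ins_apply, AddSubmonoidClass.coe_finsetSum, Finset.sum_apply]
  rfl

theorem calculus_lie (k : ℕ) (K : Idx E → SmoothAlg E) (f : SmoothAlg E) :
    ((calculus E).lie k K f).1 = lieE k (fun i => (K i).1) f.1 := by
  ext u
  rw [SuperCalculus.lie_apply]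
  change ((calculus E).ins K ((calculus E).d f)).1 u +
    (-1 : ℝ) ^ k • ((calculus E).d ((calculus E).ins K f)).1 u = _
  rw [calculus_ins, calculus_d, calculus_d, calculus_ins]
  rfl

theorem calculus_bracket (k l : ℕ) (K L : Idx E → SmoothAlg E) (i : Idx E) :
    ((calculus E).bracket k l K L i).1 =
      bracketE k l (fun i => (K i).1) (fun i => (L i).1) i := by
  ext u
  change ((calculus E).lie k K (L i)).1 u -
    (-1 : ℝ) ^ (k * l) • ((calculus E).lie l L (K i)).1 u = _
  rw [calculus_lie, calculus_lie]
  rfl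

/-- The conclusion is again an equality of germs, so that locality can be iterated for composed
operators. -/
theorem dE_congr {f g : E → Ext E} {u : E} (h : f =ᶠ[𝓝 u] g) : dE f =ᶠ[𝓝 u] dE g := by
  filter_upwards [h.fderiv (𝕜 := ℝ)] with v hv
  rw [dE, dE, hv]

theorem insE_congr {K L : Idx E → E → Ext E} {f g : E → Ext E} {u : E}
    (hK : ∀ i, K i =ᶠ[𝓝 u] L i) (h : f =ᶠ[𝓝 u] g) : insE K f =ᶠ[𝓝 u] insE L g := by
  filter_upwards [h, eventually_all.2 hK] with v hv hKv
  simp only [insE, hv, hKv]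

theorem lieE_congr {k : ℕ} {K L : Idx E → E → Ext E} {f g : E → Ext E} {u : E}
    (hK : ∀ i, K i =ᶠ[𝓝 u] L i) (h : f =ᶠ[𝓝 u] g) : lieE k K f =ᶠ[𝓝 u] lieE k L g := by
  filter_upwards [insE_congr hK (dE_congr h), dE_congr (insE_congr hK h)] with v h1 h2
  simp only [lieE, h1, h2]

theorem bracketE_congr {k l : ℕ} {K L K' L' : Idx E → E → Ext E} {u : E}
    (hK : ∀ i, K i =ᶠ[𝓝 u] K' i) (hL : ∀ i, L i =ᶠ[𝓝 u] L' i) (i : Idx E) :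
    bracketE k l K L i =ᶠ[𝓝 u] bracketE k l K' L' i := by
  filter_upwards [lieE_congr (k := k) hK (hL i), lieE_congr (k := l) hL (hK i)] with v h1 h2
  simp only [bracketE, h1, h2]

/-- The function is smooth in a neighbourhood of the point. -/
def SmoothNear {V : Type*} [NormedAddCommGroup V] [NormedSpace ℝ V] (f : E → V) (u : E) : Prop :=
  ∀ᶠ v in 𝓝 u, ContDiffAt ℝ ∞ f v

theorem SmoothNear.congr {V : Type*} [NormedAddCommGroup V] [NormedSpace ℝ V] {f g : E → V} {u : E}
    (hf : SmoothNear f u) (h : g =ᶠ[𝓝 u] f) : SmoothNear g u := by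
  filter_upwards [hf, h.eventuallyEq_nhds] with v hv hv'
  exact hv.congr_of_eventuallyEq hv'

theorem _root_.ContDiffOn.smoothNear {V : Type*} [NormedAddCommGroup V] [NormedSpace ℝ V]
    {f : E → V} {s : Set E} (hf : ContDiffOn ℝ ∞ f s) (hs : IsOpen s) {u : E} (hu : u ∈ s) :
    SmoothNear f u := by
  filter_upwards [hs.mem_nhds hu] with v hv
  exact hf.contDiffAt (hs.mem_nhds hv)

theorem SmoothNear.linear_comp {V W : Type*} [NormedAddCommGroup V] [NormedSpace ℝ V]
    [FiniteDimensional ℝ V] [NormedAddCommGroup W] [NormedSpace ℝ W] (φ : V →ₗ[ℝ] W) {f : E → V}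
    {u : E} (hf : SmoothNear f u) : SmoothNear (fun v => φ (f v)) u :=
  hf.mono fun v hv => (contDiff_linear φ).contDiffAt.comp v hv

theorem SmoothNear.differentiableAt {V : Type*} [NormedAddCommGroup V] [NormedSpace ℝ V]
    {f : E → V} {u : E} (hf : SmoothNear f u) : DifferentiableAt ℝ f u :=
  (hf.self_of_nhds).differentiableAt (by simp)

/-- A germ of a smooth function extends to a smooth function, by multiplication with a bump
function. -/
theorem SmoothNear.exists_contDiff {V : Type*} [NormedAddCommGroup V] [NormedSpace ℝ V]
    {f : E → V} {u : E} (hf : SmoothNear f u) :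
    ∃ χ : E → ℝ, (∀ᶠ v in 𝓝 u, χ v = 1) ∧ ContDiff ℝ ∞ fun v => χ v • f v := by
  obtain ⟨ε, hε, h⟩ := Metric.eventually_nhds_iff_ball.1 hf
  -- The outer radius is below `ε`, so the closed support lies in the ball where `f` is smooth.
  let χ : ContDiffBump u := ⟨ε / 4, ε / 2, by positivity, by linarith⟩
  refine ⟨χ, χ.eventuallyEq_one, contDiff_iff_contDiffAt.2 fun v => ?_⟩
  by_cases hv : v ∈ Metric.ball u ε
  · exact χ.contDiff.contDiffAt.smul (h v hv)
  · have hv' : v ∉ tsupport χ := by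
      rw [χ.tsupport_eq]
      intro h'
      exact hv (Metric.closedBall_subset_ball (by change ε / 2 < ε; linarith) h')
    refine (contDiffAt_const (c := (0 : V))).congr_of_eventuallyEq ?_
    filter_upwards [notMem_tsupport_iff_eventuallyEq.1 hv'] with w hw
    simp [hw]

/-- The extension is a scalar multiple of `f` at each point, hence it keeps the parity. -/
theorem SmoothNear.exists_smoothAlg {f : E → Ext E} {u : E} (hf : SmoothNear f u) :
    ∃ F : SmoothAlg E, f =ᶠ[𝓝 u] F.1 ∧
      ∀ p, (∀ v, IsHom extInv p (f v)) → IsHom (calculus E).γ p F := by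
  obtain ⟨χ, h1, h2⟩ := hf.exists_contDiff
  refine ⟨SmoothAlg.mk _ h2, ?_, fun p hp => SmoothAlg.isHom_iff.2 fun v => (hp v).smul _⟩
  filter_upwards [h1] with v hv
  change f v = χ v • f v
  rw [hv, one_smul]

theorem SmoothAlg.smoothNear (F : SmoothAlg E) (u : E) : SmoothNear F.1 u :=
  Eventually.of_forall fun _ => (SmoothAlg.contDiff F).contDiffAt

theorem exists_smoothAlg_family {k : ℕ} {K : Idx E → E → Ext E} {u : E}
    (hK : ∀ i, SmoothNear (K i) u) (hK' : ∀ i v, IsHom extInv k (K i v)) :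
    ∃ F : Idx E → SmoothAlg E, (∀ i, K i =ᶠ[𝓝 u] (F i).1) ∧
      ∀ i, IsHom (calculus E).γ k (F i) := by
  choose F hF hF' using fun i => (hK i).exists_smoothAlg
  exact ⟨F, hF, fun i => hF' i k (hK' i)⟩

theorem SmoothNear.insE {K : Idx E → E → Ext E} {f : E → Ext E} {u : E}
    (hK : ∀ i, SmoothNear (K i) u) (hf : SmoothNear f u) : SmoothNear (insE K f) u := by
  obtain ⟨F, hF, -⟩ := hf.exists_smoothAlg
  choose G hG hG' using fun i => (hK i).exists_smoothAlg
  refine SmoothNear.congr ?_ (insE_congr hG hF)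
  rw [← calculus_ins]
  exact SmoothAlg.smoothNear _ u

theorem SmoothNear.lieE {k : ℕ} {K : Idx E → E → Ext E} {f : E → Ext E} {u : E}
    (hK : ∀ i, SmoothNear (K i) u) (hf : SmoothNear f u) : SmoothNear (lieE k K f) u := by
  obtain ⟨F, hF, -⟩ := hf.exists_smoothAlg
  choose G hG hG' using fun i => (hK i).exists_smoothAlg
  refine SmoothNear.congr ?_ (lieE_congr hG hF)
  rw [← calculus_lie]
  exact SmoothAlg.smoothNear _ u

theorem SmoothNear.bracketE {k l : ℕ} {K L : Idx E → E → Ext E} {u : E}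
    (hK : ∀ i, SmoothNear (K i) u) (hL : ∀ i, SmoothNear (L i) u) (i : Idx E) :
    SmoothNear (bracketE k l K L i) u := by
  choose F hF hF' using fun i => (hK i).exists_smoothAlg
  choose G hG hG' using fun i => (hL i).exists_smoothAlg
  refine SmoothNear.congr ?_ (bracketE_congr hF hG i)
  rw [← calculus_bracket]
  exact SmoothAlg.smoothNear _ u

/-- All operators involved depend only on germs, so the identity `SuperCalculus.lie_bracket` for
global extensions gives the local one. -/
theorem lieE_bracketE {k l : ℕ} {K L : Idx E → E → Ext E} {f : E → Ext E} {u : E}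
    (hK : ∀ i, SmoothNear (K i) u) (hK' : ∀ i v, IsHom extInv k (K i v))
    (hL : ∀ i, SmoothNear (L i) u) (hL' : ∀ i v, IsHom extInv l (L i v)) (hf : SmoothNear f u) :
    lieE (k + l) (bracketE k l K L) f u =
      lieE k K (lieE l L f) u - (-1 : ℝ) ^ (k * l) • lieE l L (lieE k K f) u := by
  obtain ⟨F, hF, hF'⟩ := exists_smoothAlg_family hK hK'
  obtain ⟨G, hG, hG'⟩ := exists_smoothAlg_family hL hL'
  obtain ⟨f', hf', -⟩ := hf.exists_smoothAlg
  rw [(lieE_congr (bracketE_congr hF hG) hf').self_of_nhds,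
    (lieE_congr hF (lieE_congr hG hf')).self_of_nhds,
    (lieE_congr hG (lieE_congr hF hf')).self_of_nhds]
  have := congrArg (fun f => f.1 u) ((calculus E).lie_bracket hF' hG' f')
  rw [calculus_lie] at this
  simp only [calculus_bracket] at this
  rw [this]
  change ((calculus E).lie k F ((calculus E).lie l G f')).1 u -
    (-1 : ℝ) ^ (k * l) • ((calculus E).lie l G ((calculus E).lie k F f')).1 u = _
  simp only [calculus_lie]

end Smooth

/-! ### Pullbacks, exterior derivative and Lie derivative in the exterior algebra -/

section FormsExt

open Filter Topology

theorem wedge_compContinuousLinearMap {V W : Type*} [AddCommGroup V] [Module ℝ V]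
    [TopologicalSpace V] [AddCommGroup W] [Module ℝ W] [TopologicalSpace W] {k l m : ℕ}
    (h : k + l = m) (α : V [⋀^Fin k]→L[ℝ] ℝ) (β : V [⋀^Fin l]→L[ℝ] ℝ) (f : W →L[ℝ] V) :
    (wedge h α β).compContinuousLinearMap f =
      wedge h (α.compContinuousLinearMap f) (β.compContinuousLinearMap f) := by
  ext v
  simp only [wedge, ContinuousAlternatingMap.compContinuousLinearMap_apply,
    ContinuousAlternatingMap.smul_apply, ContinuousMultilinearMap.alternatization_apply_apply,
    tensorMul_apply]
  rfl

theorem interior_compContinuousLinearMap {V W : Type*} [AddCommGroup V] [Module ℝ V]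
    [TopologicalSpace V] [AddCommGroup W] [Module ℝ W] [TopologicalSpace W] {k : ℕ}
    (α : V [⋀^Fin (k + 1)]→L[ℝ] ℝ) (f : W →L[ℝ] V) (v : V) (w : W) (h : f w = v) :
    (interior v α).compContinuousLinearMap f = interior w (α.compContinuousLinearMap f) := by
  ext u
  simp only [ContinuousAlternatingMap.compContinuousLinearMap_apply, interior_apply, ← h]
  congr 1
  funext j
  refine Fin.cases ?_ (fun j => ?_) j <;> simp

/-- A form, viewed in a numerically equal degree. -/
def castForm {V : Type*} [AddCommGroup V] [Module ℝ V] [TopologicalSpace V] {k l : ℕ} (h : k = l)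
    (α : V [⋀^Fin k]→L[ℝ] ℝ) : V [⋀^Fin l]→L[ℝ] ℝ := h ▸ α

variable {E : Type*} [NormedAddCommGroup E] [NormedSpace ℝ E] [FiniteDimensional ℝ E]

theorem toExt_extDeriv {k : ℕ} {η : E → E [⋀^Fin k]→L[ℝ] ℝ} {u : E}
    (hη : DifferentiableAt ℝ η u) :
    toExt (k + 1) (extDeriv η u) = dE (fun v => toExt k (η v)) u := by
  rw [extDeriv, toExt_alternatizeUncurryFin, dE]
  simp only [fderiv_linear_comp _ hη]

/-- The insertion of vectors as a linear map in the vector. -/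
def contrₗ (a : Ext E) : E →ₗ[ℝ] Ext E where
  toFun v := contr v a
  map_add' v w := by simp [contr]
  map_smul' c v := by simp [contr]

theorem sum_smul_contr (v : E) (a : Ext E) :
    ∑ i, (Module.finBasis ℝ E).repr v i • contr (vec E i) a = contr v a :=
  sum_vec (contrₗ a) v

/-- The `i`-th coordinate as a continuous linear map. -/
abbrev coordL (i : Idx E) : E →L[ℝ] ℝ :=
  LinearMap.toContinuousLinearMap ((Module.finBasis ℝ E).coord i)

theorem toExt_clm_comp {k : ℕ} (φ : E →L[ℝ] ℝ) (K : E [⋀^Fin k]→L[ℝ] E) :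
    toExt k (φ.compContinuousAlternatingMap K) =
      ∑ s, φ (vec E s) • toExt k ((coordL s).compContinuousAlternatingMap K) := by
  simp only [← map_smul, ← map_sum]
  congr 1
  ext v
  simp only [ContinuousAlternatingMap.sum_apply, ContinuousAlternatingMap.smul_apply,
    ContinuousLinearMap.compContinuousAlternatingMap_coe, Function.comp_apply]
  have := sum_vec φ.toLinearMap (K v)
  simp only [ContinuousLinearMap.coe_coe] at this
  rw [← this]
  refine Finset.sum_congr rfl fun s _ => ?_
  rw [smul_eq_mul, smul_eq_mul, mul_comm]
  rfl

theorem contr_toExt_zero (v : E) (α : E [⋀^Fin 0]→L[ℝ] ℝ) : contr v (toExt 0 α) = 0 := by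
  rw [toExt_zero, contr_algebraMap]

theorem dE_add {f g : E → Ext E} {u : E} (hf : DifferentiableAt ℝ f u)
    (hg : DifferentiableAt ℝ g u) : dE (fun v => f v + g v) u = dE f u + dE g u := by
  simp only [dE, ← Finset.sum_add_distrib]
  refine Finset.sum_congr rfl fun i _ => ?_
  rw [fderiv_fun_add hf hg, add_apply, mul_add]

theorem dE_smul {f : E → Ext E} {u : E} (hf : DifferentiableAt ℝ f u) (c : ℝ) :
    dE (fun v => c • f v) u = c • dE f u := by
  simp only [dE, Finset.smul_sum]
  refine Finset.sum_congr rfl fun i _ => ?_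
  rw [fderiv_fun_const_smul hf, smul_apply, mul_smul_comm]

theorem dE_sum {I : Type*} {s : Finset I} {f : I → E → Ext E} {u : E}
    (hf : ∀ i ∈ s, DifferentiableAt ℝ (f i) u) :
    dE (fun v => ∑ i ∈ s, f i v) u = ∑ i ∈ s, dE (f i) u := by
  simp only [dE]
  rw [Finset.sum_comm]
  refine Finset.sum_congr rfl fun i _ => ?_
  rw [fderiv_fun_sum hf, sum_apply, Finset.mul_sum]

theorem dE_zero (u : E) : dE (fun _ => (0 : Ext E)) u = 0 := by simp [dE]

theorem dE_mul {k : ℕ} {f g : E → Ext E} {u : E} (hf : DifferentiableAt ℝ f u)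
    (hg : DifferentiableAt ℝ g u) (hf' : IsHom extInv k (f u)) :
    dE (fun v => f v * g v) u = dE f u * g u + (-1 : ℝ) ^ k • (f u * dE g u) := by
  simp only [dE, Finset.sum_mul, Finset.mul_sum, Finset.smul_sum, ← Finset.sum_add_distrib]
  refine Finset.sum_congr rfl fun i _ => ?_
  rw [fderiv_ext_mul hf hg, mul_add, mul_assoc]
  congr 1
  rw [← mul_assoc, ← mul_assoc, (cov_isHom i).comm_hom hf', one_mul, smul_mul_assoc]

/-- The Nijenhuis-Lie derivative as a sum over the components of the vector-valued form. -/
theorem lieE_eq_sum {k : ℕ} {K : Idx E → E → Ext E} {f : E → Ext E} {u : E}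
    (hK : ∀ i, DifferentiableAt ℝ (K i) u) (hK' : ∀ i, IsHom extInv k (K i u))
    (hf : DifferentiableAt ℝ f u) :
    lieE k K f u = ∑ i, (K i u * (contr (vec E i) (dE f u) + dE (fun v => contr (vec E i) (f v)) u) +
      (-1 : ℝ) ^ k • (dE (K i) u * contr (vec E i) (f u))) := by
  have hc : ∀ i, DifferentiableAt ℝ (fun v => contr (vec E i) (f v)) u := fun i =>
    ((contDiff_linear (n := 1) (contr (vec E i))).differentiable (by simp)).differentiableAt.comp u hf
  have hm : ∀ i, DifferentiableAt ℝ (fun v => K i v * contr (vec E i) (f v)) u := fun i =>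
    (extMul.hasFDerivAt_of_bilinear (hK i).hasFDerivAt (hc i).hasFDerivAt).differentiableAt
  have h : dE (insE K f) u = ∑ i, (dE (K i) u * contr (vec E i) (f u) +
      (-1 : ℝ) ^ k • (K i u * dE (fun v => contr (vec E i) (f v)) u)) :=
    (dE_sum fun i _ => hm i).trans
      (Finset.sum_congr rfl fun i _ => dE_mul (hK i) (hc i) (hK' i))
  rw [lieE, h, insE, Finset.smul_sum, ← Finset.sum_add_distrib]
  refine Finset.sum_congr rfl fun i _ => ?_
  rw [smul_add, neg_one_pow_smul_smul, mul_add]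
  abel

/-- The Nijenhuis-Lie derivative of a function. -/
theorem lieE_scalar {k : ℕ} {K : Idx E → E → Ext E} {f : E → ℝ} {u : E}
    (hf : DifferentiableAt ℝ f u) :
    lieE k K (fun v => algebraMap ℝ (Ext E) (f v)) u = ∑ i, fderiv ℝ f u (vec E i) • K i u := by
  have h1 : insE K (fun v => algebraMap ℝ (Ext E) (f v)) = fun _ => 0 := by
    funext v
    simp [insE, contr_algebraMap]
  rw [lieE, h1, dE_zero, smul_zero, add_zero, insE]
  refine Finset.sum_congr rfl fun i _ => ?_
  have h2 : ∀ j, fderiv ℝ (fun v => algebraMap ℝ (Ext E) (f v)) u (vec E j) =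
      algebraMap ℝ (Ext E) (fderiv ℝ f u (vec E j)) := fun j =>
    fderiv_linear_comp (Algebra.linearMap ℝ (Ext E)) hf _
  simp only [dE, h2, map_sum, contr_cov_mul, contr_algebraMap, mul_zero, sub_zero]
  rw [Algebra.smul_def, Algebra.commutes, Finset.sum_eq_single i]
  · simp
  · intro j _ hj
    simp [hj.symm]
  · simp

end FormsExt

/-! ### Chart changes and coordinate vector fields -/

section Charts

open Filter Topology

variable {E : Type*} [NormedAddCommGroup E] [NormedSpace ℝ E]
  {M : Type*} [TopologicalSpace M] [ChartedSpace E M]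

theorem chartD_isInvertible [IsManifold 𝓘(ℝ, E) ∞ M] {x y : M}
    (hy : y ∈ (extChartAt 𝓘(ℝ, E) x).source) : (chartD (E := E) x y).IsInvertible :=
  (ContinuousLinearMap.isInvertible_equiv
    (f := NormedSpace.fromTangentSpace (extChartAt 𝓘(ℝ, E) x y))).comp
    (isInvertible_mfderiv_extChartAt (I := 𝓘(ℝ, E)) hy)

theorem mvfderiv_eq_fderiv_comp_chartD [IsManifold 𝓘(ℝ, E) ∞ M] {F : Type*}
    [NormedAddCommGroup F] [NormedSpace ℝ F] {x y : M} (hy : y ∈ (extChartAt 𝓘(ℝ, E) x).source)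
    {f : M → F} {g : E → F} (hfg : f =ᶠ[𝓝 y] g ∘ extChartAt 𝓘(ℝ, E) x)
    (hg : DifferentiableAt ℝ g (extChartAt 𝓘(ℝ, E) x y)) :
    mvfderiv 𝓘(ℝ, E) f y = (fderiv ℝ g (extChartAt 𝓘(ℝ, E) x y)).comp (chartD x y) := by
  have h1 : MDifferentiableAt 𝓘(ℝ, E) 𝓘(ℝ, E) (extChartAt 𝓘(ℝ, E) x) y :=
    mdifferentiableAt_extChartAt (by simpa using hy)
  have h2 := hg.hasFDerivAt.hasMFDerivAt.comp y h1.hasMFDerivAt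
  have h3 := h2.congr_of_eventuallyEq hfg
  rw [mvfderiv, h3.mfderiv]
  rfl

theorem contDiffAt_coordChange [IsManifold 𝓘(ℝ, E) ∞ M] {x x' y : M}
    (hy : y ∈ (extChartAt 𝓘(ℝ, E) x).source) (hy' : y ∈ (extChartAt 𝓘(ℝ, E) x').source) :
    ContDiffAt ℝ ∞ (extChartAt 𝓘(ℝ, E) x' ∘ (extChartAt 𝓘(ℝ, E) x).symm)
      (extChartAt 𝓘(ℝ, E) x y) := by
  have := contDiffWithinAt_ext_coord_change (n := ∞) (I := 𝓘(ℝ, E)) x' x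
    (y := extChartAt 𝓘(ℝ, E) x y) (by
      rw [PartialEquiv.trans_source]
      refine ⟨(extChartAt 𝓘(ℝ, E) x).map_source hy, ?_⟩
      rw [Set.mem_preimage, (extChartAt 𝓘(ℝ, E) x).left_inv hy]
      exact hy')
  rw [ModelWithCorners.range_eq_univ, contDiffWithinAt_univ] at this
  exact this

theorem eventually_mem_source {x y : M} (hy : y ∈ (extChartAt 𝓘(ℝ, E) x).source) :
    ∀ᶠ z in 𝓝 y, z ∈ (extChartAt 𝓘(ℝ, E) x).source :=
  (isOpen_extChartAt_source x).mem_nhds hy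

theorem eventually_mem_target {x y : M} (hy : y ∈ (extChartAt 𝓘(ℝ, E) x).source) :
    ∀ᶠ v in 𝓝 (extChartAt 𝓘(ℝ, E) x y), v ∈ (extChartAt 𝓘(ℝ, E) x).target :=
  (isOpen_extChartAt_target x).mem_nhds ((extChartAt 𝓘(ℝ, E) x).map_source hy)

theorem tendsto_symm {x y : M} (hy : y ∈ (extChartAt 𝓘(ℝ, E) x).source) :
    Tendsto (extChartAt 𝓘(ℝ, E) x).symm (𝓝 (extChartAt 𝓘(ℝ, E) x y)) (𝓝 y) := by
  have := continuousAt_extChartAt_symm' (I := 𝓘(ℝ, E)) hy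
  rwa [ContinuousAt, (extChartAt 𝓘(ℝ, E) x).left_inv hy] at this

theorem fderiv_coordChange [IsManifold 𝓘(ℝ, E) ∞ M] {x x' y : M}
    (hy : y ∈ (extChartAt 𝓘(ℝ, E) x).source) (hy' : y ∈ (extChartAt 𝓘(ℝ, E) x').source) :
    fderiv ℝ (extChartAt 𝓘(ℝ, E) x' ∘ (extChartAt 𝓘(ℝ, E) x).symm) (extChartAt 𝓘(ℝ, E) x y) =
      (chartD x' y).comp (chartD x y).inverse := by
  have h := mvfderiv_eq_fderiv_comp_chartD hy (f := extChartAt 𝓘(ℝ, E) x')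
    (g := extChartAt 𝓘(ℝ, E) x' ∘ (extChartAt 𝓘(ℝ, E) x).symm) (by
      filter_upwards [eventually_mem_source hy] with z hz
      simp only [Function.comp_apply]
      rw [(extChartAt 𝓘(ℝ, E) x).left_inv hz])
    ((contDiffAt_coordChange hy hy').differentiableAt (by simp))
  rw [chartD, h, ContinuousLinearMap.comp_assoc, (chartD_isInvertible hy).self_comp_inverse,
    ContinuousLinearMap.comp_id]

/-- Two chart expressions differ by pullback along the transition map, so naturality of `extDeriv`
applies. -/
theorem Form.inChart_coordChange [IsManifold 𝓘(ℝ, E) ∞ M] {k : ℕ} (α : Form E M k) {x x' y : M}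
    (hy : y ∈ (extChartAt 𝓘(ℝ, E) x).source) (hy' : y ∈ (extChartAt 𝓘(ℝ, E) x').source) :
    Form.inChart α x =ᶠ[𝓝 (extChartAt 𝓘(ℝ, E) x y)] fun v =>
      (Form.inChart α x' ((extChartAt 𝓘(ℝ, E) x' ∘ (extChartAt 𝓘(ℝ, E) x).symm) v)).compContinuousLinearMap
        (fderiv ℝ (extChartAt 𝓘(ℝ, E) x' ∘ (extChartAt 𝓘(ℝ, E) x).symm) v) := by
  filter_upwards [eventually_mem_target hy, (tendsto_symm hy).eventually (eventually_mem_source hy')]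
    with v hv hv'
  have h1 := (extChartAt 𝓘(ℝ, E) x).map_target hv
  have h2 := fderiv_coordChange h1 hv'
  rw [(extChartAt 𝓘(ℝ, E) x).right_inv hv] at h2
  rw [h2]
  simp only [Form.inChart, Function.comp_apply]
  rw [(extChartAt 𝓘(ℝ, E) x').left_inv hv']
  ext w
  exact congrArg (α _) (funext fun i => ((chartD_isInvertible hv').inverse_apply_self _).symm)

/-- The exterior derivative may be computed in any chart. -/
theorem extD_apply [IsManifold 𝓘(ℝ, E) ∞ M] {k : ℕ} {α : Form E M k} {x y : M}
    (hy : y ∈ (extChartAt 𝓘(ℝ, E) x).source)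
    (hα : DifferentiableAt ℝ (Form.inChart α x) (extChartAt 𝓘(ℝ, E) x y)) :
    extD α y = (extDeriv (Form.inChart α x) (extChartAt 𝓘(ℝ, E) x y)).compContinuousLinearMap
      (chartD x y) := by
  have hyy := mem_extChartAt_source (I := 𝓘(ℝ, E)) y
  have hτ : (extChartAt 𝓘(ℝ, E) x ∘ (extChartAt 𝓘(ℝ, E) y).symm) (extChartAt 𝓘(ℝ, E) y y) =
      extChartAt 𝓘(ℝ, E) x y := by
    simp only [Function.comp_apply]
    rw [(extChartAt 𝓘(ℝ, E) y).left_inv hyy]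
  rw [extD, (Form.inChart_coordChange α hyy hy).extDeriv_eq,
    extDeriv_pullback (r := ∞) (by rwa [hτ]) (contDiffAt_coordChange hyy hy)
      (by simpa using ENat.LEInfty.out), hτ, fderiv_coordChange hyy hy]
  ext w
  simp only [ContinuousAlternatingMap.compContinuousLinearMap_apply]
  congr 1
  funext i
  exact congrArg (chartD x y) ((chartD_isInvertible hyy).inverse_apply_self _)

variable [FiniteDimensional ℝ E]

/-- In the trivialization of the tangent bundle around `x` the field is the constant vector `vec E
i`. -/
theorem contMDiffAt_coordField [IsManifold 𝓘(ℝ, E) ∞ M] {x y : M}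
    (hy : y ∈ (extChartAt 𝓘(ℝ, E) x).source) (i : Idx E) :
    ContMDiffAt 𝓘(ℝ, E) 𝓘(ℝ, E).tangent ∞
      (fun z => (⟨z, coordField x i z⟩ : TangentBundle 𝓘(ℝ, E) M)) y := by
  have hb : y ∈ (trivializationAt E (TangentSpace 𝓘(ℝ, E)) x).baseSet := by simpa using hy
  rw [Trivialization.contMDiffAt_section_iff (trivializationAt E (TangentSpace 𝓘(ℝ, E)) x) hb]
  refine (contMDiffAt_const (c := vec E i)).congr_of_eventuallyEq ?_
  filter_upwards [eventually_mem_source hy] with z hz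
  have hz' : z ∈ (chartAt E x).source := by simpa using hz
  have h1 := TangentBundle.continuousLinearMapAt_trivializationAt (𝕜 := ℝ) (I := 𝓘(ℝ, E)) hz'
  have h2 := congrArg (fun L => L (coordField x i z)) h1
  have hzb : z ∈ (trivializationAt E (TangentSpace 𝓘(ℝ, E)) x).baseSet := by simpa using hz
  rw [Trivialization.continuousLinearMapAt_apply, Trivialization.linearMapAt_apply, if_pos hzb] at h2
  rw [h2]
  exact (chartD_isInvertible hz).self_apply_inverse _

/-- Pulled back to the model space both fields are constant near the point. The centre of the chart
suffices, since `fnBracket` is computed there. -/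
theorem mlieBracket_coordField [IsManifold 𝓘(ℝ, E) ∞ M] (x : M) (i j : Idx E) :
    VectorField.mlieBracket 𝓘(ℝ, E) (coordField x i) (coordField x j) x = 0 := by
  have h : ∀ i : Idx E, VectorField.mpullbackWithin 𝓘(ℝ, E) 𝓘(ℝ, E) (extChartAt 𝓘(ℝ, E) x).symm
      (coordField x i) (Set.range 𝓘(ℝ, E)) =ᶠ[𝓝 (extChartAt 𝓘(ℝ, E) x x)] fun _ => vec E i := by
    intro i
    filter_upwards [eventually_mem_target (mem_extChartAt_source (I := 𝓘(ℝ, E)) x)] with v hv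
    refine (isInvertible_mfderivWithin_extChartAt_symm (I := 𝓘(ℝ, E)) hv).inverse_apply_eq.2 ?_
    have h1 := mfderivWithin_extChartAt_symm_comp_mfderiv_extChartAt (I := 𝓘(ℝ, E)) hv
    have h2 := congrArg (fun L => L (coordField x i ((extChartAt 𝓘(ℝ, E) x).symm v))) h1
    refine h2.symm.trans ?_
    exact congrArg _ ((chartD_isInvertible ((extChartAt 𝓘(ℝ, E) x).map_target hv)).self_apply_inverse _)
  have h0 : ∀ (V W : E → E) (v w u : E) (s : Set E), V =ᶠ[𝓝 u] (fun _ => v) →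
      W =ᶠ[𝓝 u] (fun _ => w) → VectorField.lieBracketWithin ℝ V W s u = 0 := by
    intro V W v w u s hV hW
    rw [hV.lieBracketWithin_vectorField_eq_nhds hW]
    simp [VectorField.lieBracketWithin]
  rw [VectorField.mlieBracket, VectorField.mlieBracketWithin_apply]
  exact (congrArg _ (h0 _ _ _ _ _ _ (h i) (h j))).trans (map_zero _)

end Charts

/-! ### Forms on the manifold as chart functions with values in the exterior algebra -/

section Translation

open Filter Topology

variable {E : Type*} [NormedAddCommGroup E] [NormedSpace ℝ E] [FiniteDimensional ℝ E]
  {M : Type*} [TopologicalSpace M] [ChartedSpace E M]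

/-- An injective linear map has a linear left inverse; hence smoothness of forms can be tested after
`toExt` or `toExtV`. -/
theorem contDiffAt_of_linear_comp {V W : Type*} [NormedAddCommGroup V] [NormedSpace ℝ V]
    [FiniteDimensional ℝ V] [NormedAddCommGroup W] [NormedSpace ℝ W] [FiniteDimensional ℝ W]
    {n : WithTop ℕ∞} {φ : V →ₗ[ℝ] W} (hφ : Function.Injective φ) {f : E → V} {u : E}
    (h : ContDiffAt ℝ n (fun v => φ (f v)) u) : ContDiffAt ℝ n f u := by
  obtain ⟨ψ, hψ⟩ := φ.exists_leftInverse_of_injective (LinearMap.ker_eq_bot.2 hφ)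
  have : f = fun v => ψ (φ (f v)) := funext fun v => (LinearMap.congr_fun hψ (f v)).symm
  rw [this]
  exact (contDiff_linear ψ).contDiffAt.comp u h

theorem differentiableAt_of_linear_comp {V W : Type*} [NormedAddCommGroup V] [NormedSpace ℝ V]
    [FiniteDimensional ℝ V] [NormedAddCommGroup W] [NormedSpace ℝ W] [FiniteDimensional ℝ W]
    {φ : V →ₗ[ℝ] W} (hφ : Function.Injective φ) {f : E → V} {u : E}
    (h : DifferentiableAt ℝ (fun v => φ (f v)) u) : DifferentiableAt ℝ f u := by
  obtain ⟨ψ, hψ⟩ := φ.exists_leftInverse_of_injective (LinearMap.ker_eq_bot.2 hφ)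
  have : f = fun v => ψ (φ (f v)) := funext fun v => (LinearMap.congr_fun hψ (f v)).symm
  rw [this]
  exact ((contDiff_linear (n := 1) ψ).differentiable (by simp)).differentiableAt.comp u h

/-- The components of a vector-valued alternating form as elements of the exterior algebra. -/
def toExtV (k : ℕ) : E [⋀^Fin k]→L[ℝ] E →ₗ[ℝ] Idx E → Ext E where
  toFun K i := toExt k ((coordL i).compContinuousAlternatingMap K)
  map_add' K L := by
    funext i
    rw [Pi.add_apply, ← map_add]
    congr 1
    ext v
    simp
  map_smul' c K := by
    funext i
    rw [Pi.smul_apply, RingHom.id_apply, ← map_smul]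
    congr 1
    ext v
    simp

theorem toExtV_injective (k : ℕ) : Function.Injective (toExtV k (E := E)) := by
  intro K L h
  ext v
  refine (Module.finBasis ℝ E).ext_elem fun i => ?_
  have := toExt_injective k (congrFun h i)
  exact congrArg (fun a => a v) this

instance (k : ℕ) : FiniteDimensional ℝ (E [⋀^Fin k]→L[ℝ] E) :=
  .of_injective (toExtV k) (toExtV_injective k)

/-- The element of the exterior algebra of the dual of `E` which corresponds to a form at `y` in
the chart around `x`. -/
def atChart (x y : M) (k : ℕ) : TangentSpace 𝓘(ℝ, E) y [⋀^Fin k]→L[ℝ] ℝ →ₗ[ℝ] Ext E where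
  toFun a := toExt k (a.compContinuousLinearMap (chartD x y).inverse)
  map_add' a b := by
    rw [← map_add]
    rfl
  map_smul' c a := by
    rw [← map_smul]
    rfl

theorem atChart_apply (x y : M) (k : ℕ) (a : TangentSpace 𝓘(ℝ, E) y [⋀^Fin k]→L[ℝ] ℝ) :
    atChart x y k a = toExt k (a.compContinuousLinearMap (chartD x y).inverse) := rfl

/-- A form in the chart around `x`, as a function with values in the exterior algebra. -/
def toChart (x : M) {k : ℕ} (α : Form E M k) (u : E) : Ext E := toExt k (Form.inChart α x u)

/-- The components of a vector-valued form in the chart around `x`, as functions with values in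
the exterior algebra. -/
def compChart (x : M) {k : ℕ} (K : VForm E M k) (i : Idx E) (u : E) : Ext E :=
  toExtV k (VForm.inChart K x u) i

theorem toChart_isHom (x : M) {k : ℕ} (α : Form E M k) (u : E) : IsHom extInv k (toChart x α u) :=
  toExt_isHom _

theorem compChart_isHom (x : M) {k : ℕ} (K : VForm E M k) (i : Idx E) (u : E) :
    IsHom extInv k (compChart x K i u) :=
  toExt_isHom _

theorem toChart_extChartAt {x y : M} (hy : y ∈ (extChartAt 𝓘(ℝ, E) x).source) {k : ℕ}
    (α : Form E M k) : toChart x α (extChartAt 𝓘(ℝ, E) x y) = atChart x y k (α y) := by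
  rw [toChart, Form.inChart, (extChartAt 𝓘(ℝ, E) x).left_inv hy]
  rfl

theorem toChart_component (x : M) {k : ℕ} (K : VForm E M k) (i : Idx E) :
    toChart x (component x i K) = compChart x K i := rfl

theorem mem_Ω_iff {k : ℕ} {α : Form E M k} : α ∈ Ω E M k ↔
    ∀ x, ∀ u ∈ (extChartAt 𝓘(ℝ, E) x).target, SmoothNear (toChart x α) u := by
  constructor
  · intro h x u hu
    exact ((h x).smoothNear (isOpen_extChartAt_target x) hu).linear_comp (toExt k)
  · intro h x u hu
    exact (contDiffAt_of_linear_comp (toExt_injective k) (h x u hu).self_of_nhds).contDiffWithinAt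

theorem mem_ΩT_iff {k : ℕ} {K : VForm E M k} : K ∈ ΩT E M k ↔
    ∀ x, ∀ u ∈ (extChartAt 𝓘(ℝ, E) x).target, ∀ i, SmoothNear (compChart x K i) u := by
  constructor
  · intro h x u hu i
    exact ((h x).smoothNear (isOpen_extChartAt_target x) hu).linear_comp
      (LinearMap.proj i ∘ₗ toExtV k)
  · intro h x u hu
    refine (contDiffAt_of_linear_comp (toExtV_injective k) ?_).contDiffWithinAt
    exact contDiffAt_pi.2 fun i => (h x u hu i).self_of_nhds

theorem atChart_wedge {x y : M} {k l m : ℕ} (h : k + l = m)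
    (a : TangentSpace 𝓘(ℝ, E) y [⋀^Fin k]→L[ℝ] ℝ)
    (b : TangentSpace 𝓘(ℝ, E) y [⋀^Fin l]→L[ℝ] ℝ) :
    atChart x y m (wedge h a b) = atChart x y k a * atChart x y l b := by
  rw [atChart_apply, atChart_apply, atChart_apply, wedge_compContinuousLinearMap, toExt_wedge]

section

variable [IsManifold 𝓘(ℝ, E) ∞ M] {x y : M} (hy : y ∈ (extChartAt 𝓘(ℝ, E) x).source)
include hy

theorem atChart_injective (k : ℕ) : Function.Injective (atChart (E := E) x y k) := by
  intro a b h
  rw [atChart_apply, atChart_apply] at h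
  have h1 := toExt_injective k h
  ext v
  have h2 := DFunLike.congr_fun h1 (fun i => chartD x y (v i))
  rw [ContinuousAlternatingMap.compContinuousLinearMap_apply,
    ContinuousAlternatingMap.compContinuousLinearMap_apply] at h2
  have h3 : ((chartD (E := E) x y).inverse ∘ fun i => chartD x y (v i)) = v :=
    funext fun i => (chartD_isInvertible hy).inverse_apply_self _
  rw [h3] at h2
  exact h2

theorem atChart_interior {k : ℕ} (v : TangentSpace 𝓘(ℝ, E) y)
    (a : TangentSpace 𝓘(ℝ, E) y [⋀^Fin (k + 1)]→L[ℝ] ℝ) :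
    atChart x y k (interior v a) = contr (chartD x y v) (atChart x y (k + 1) a) := by
  rw [atChart_apply, atChart_apply, contr_toExt, interior_compContinuousLinearMap a _ _ _
    ((chartD_isInvertible hy).inverse_apply_self v)]

theorem atChart_extD {k : ℕ} {α : Form E M k}
    (hα : DifferentiableAt ℝ (toChart x α) (extChartAt 𝓘(ℝ, E) x y)) :
    atChart x y (k + 1) (extD α y) = dE (toChart x α) (extChartAt 𝓘(ℝ, E) x y) := by
  have hα' := differentiableAt_of_linear_comp (toExt_injective k) hα
  have h : (extD α y).compContinuousLinearMap (chartD x y).inverse =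
      extDeriv (Form.inChart α x) (extChartAt 𝓘(ℝ, E) x y) := by
    rw [extD_apply hy hα']
    ext v
    rw [ContinuousAlternatingMap.compContinuousLinearMap_apply,
      ContinuousAlternatingMap.compContinuousLinearMap_apply]
    congr 1
    exact funext fun i => (chartD_isInvertible hy).self_apply_inverse (v i)
  rw [atChart_apply, h, toExt_extDeriv hα']
  rfl

theorem atChart_clm_comp {k : ℕ} (φ : TangentSpace 𝓘(ℝ, E) y →L[ℝ] ℝ) (K : VForm E M k) :
    atChart x y k (φ.compContinuousAlternatingMap (K y)) =
      ∑ s, φ ((chartD x y).inverse (vec E s)) • compChart x K s (extChartAt 𝓘(ℝ, E) x y) := by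
  have h : (φ.compContinuousAlternatingMap (K y)).compContinuousLinearMap (chartD x y).inverse =
      (φ.comp (chartD x y).inverse).compContinuousAlternatingMap
        (VForm.inChart K x (extChartAt 𝓘(ℝ, E) x y)) := by
    ext v
    rw [VForm.inChart, (extChartAt 𝓘(ℝ, E) x).left_inv hy]
    exact congrArg φ ((chartD_isInvertible hy).inverse_apply_self _).symm
  rw [atChart_apply, h, toExt_clm_comp]
  rfl

/-- The insertion at `y` is defined in the chart around `y`. Expressed in the chart around `x`, the
Jacobian acting on the components and the inverse Jacobian acting on the coordinate fields cancel.
-/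
theorem atChart_insertion {k l : ℕ} (K : VForm E M k) (α : Form E M (l + 1)) :
    atChart x y (k + l) (insertion K α y) =
      insE (compChart x K) (toChart x α) (extChartAt 𝓘(ℝ, E) x y) := by
  have hyy := mem_extChartAt_source (I := 𝓘(ℝ, E)) y
  rw [insertion, map_sum, insE, toChart_extChartAt hy]
  have h : ∀ i, atChart x y (k + l) (wedge rfl (component y i K y)
      (interior (coordField y i y) (α y))) =
      ∑ s, compChart x K s (extChartAt 𝓘(ℝ, E) x y) *
        ((Module.finBasis ℝ E).repr (chartD y y ((chartD x y).inverse (vec E s))) i •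
          contr (chartD x y ((chartD y y).inverse (vec E i))) (atChart x y (l + 1) (α y))) := by
    intro i
    rw [atChart_wedge, atChart_interior hy]
    refine (congrArg (· * _) (atChart_clm_comp hy
      ((LinearMap.toContinuousLinearMap ((Module.finBasis ℝ E).coord i)).comp (chartD y y)) K)).trans ?_
    rw [Finset.sum_mul]
    refine Finset.sum_congr rfl fun s _ => ?_
    rw [smul_mul_assoc, mul_smul_comm]
    rfl
  simp only [h]
  rw [Finset.sum_comm]
  refine Finset.sum_congr rfl fun s _ => ?_
  rw [← Finset.mul_sum]
  congr 1
  refine (sum_vec (contrₗ (atChart x y (l + 1) (α y)) ∘ₗ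
    ((chartD x y).comp (chartD y y).inverse).toLinearMap) _).trans ?_
  change contr (chartD x y ((chartD y y).inverse (chartD y y ((chartD x y).inverse (vec E s))))) _ = _
  rw [(chartD_isInvertible hyy).inverse_apply_self, (chartD_isInvertible hy).self_apply_inverse]

end

theorem toChart_extD [IsManifold 𝓘(ℝ, E) ∞ M] {x : M} {u : E}
    (hu : u ∈ (extChartAt 𝓘(ℝ, E) x).target) {k : ℕ} {α : Form E M k}
    (hα : DifferentiableAt ℝ (toChart x α) u) : toChart x (extD α) u = dE (toChart x α) u := by
  have hy := (extChartAt 𝓘(ℝ, E) x).map_target hu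
  have h := atChart_extD hy (α := α) (by rwa [(extChartAt 𝓘(ℝ, E) x).right_inv hu])
  rw [← toChart_extChartAt hy, (extChartAt 𝓘(ℝ, E) x).right_inv hu] at h
  exact h

theorem toChart_insertion [IsManifold 𝓘(ℝ, E) ∞ M] {x : M} {u : E}
    (hu : u ∈ (extChartAt 𝓘(ℝ, E) x).target) {k l : ℕ} (K : VForm E M k) (α : Form E M (l + 1)) :
    toChart x (insertion K α) u = insE (compChart x K) (toChart x α) u := by
  have hy := (extChartAt 𝓘(ℝ, E) x).map_target hu
  have h := atChart_insertion hy K α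
  rw [← toChart_extChartAt hy, (extChartAt 𝓘(ℝ, E) x).right_inv hu] at h
  exact h

theorem eventually_target {x : M} {u : E} (hu : u ∈ (extChartAt 𝓘(ℝ, E) x).target) :
    ∀ᶠ v in 𝓝 u, v ∈ (extChartAt 𝓘(ℝ, E) x).target :=
  (isOpen_extChartAt_target x).mem_nhds hu

theorem insE_toChart_zero (x : M) (K : Idx E → E → Ext E) (α : Form E M 0) :
    insE K (toChart x α) = fun _ => 0 :=
  funext fun _ => Finset.sum_eq_zero fun i _ => by rw [toChart, contr_toExt_zero, mul_zero]

/-- The Nijenhuis-Lie derivative in a chart. -/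
theorem toChart_nijLie [IsManifold 𝓘(ℝ, E) ∞ M] {x : M} {u : E}
    (hu : u ∈ (extChartAt 𝓘(ℝ, E) x).target) {k l : ℕ} {K : VForm E M k}
    (hK : ∀ i, SmoothNear (compChart x K i) u) {α : Form E M l}
    (hα : SmoothNear (toChart x α) u) :
    toChart x (nijLie K α) u = lieE k (compChart x K) (toChart x α) u := by
  have hd : ∀ {l : ℕ} {α : Form E M l}, SmoothNear (toChart x α) u →
      toChart x (insertion K (extD α)) u = insE (compChart x K) (dE (toChart x α)) u := by
    intro l α hα
    rw [toChart_insertion hu, insE, insE, toChart_extD hu hα.differentiableAt]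
  cases l with
  | zero =>
    have h : lieE k (compChart x K) (toChart x α) u = insE (compChart x K) (dE (toChart x α)) u := by
      rw [lieE, insE_toChart_zero, dE_zero, smul_zero, _root_.add_zero]
    exact (hd hα).trans h.symm
  | succ l =>
    have h1 : toChart x (insertion K α) =ᶠ[𝓝 u] insE (compChart x K) (toChart x α) := by
      filter_upwards [eventually_target hu] with v hv using toChart_insertion hv K α
    have h2 := (SmoothNear.insE hK hα).congr h1
    rw [lieE, ← hd hα, ← (dE_congr h1).self_of_nhds, ← toChart_extD hu h2.differentiableAt]
    have h3 := map_add (toExt (k + (l + 1))) (Form.inChart (insertion K (extD α)) x u)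
      ((-1 : ℝ) ^ k • Form.inChart (extD (insertion K α)) x u)
    rw [map_smul] at h3
    exact h3

end Translation

/-! ### The Frölicher-Nijenhuis bracket in an arbitrary chart -/

section Bracket

open Filter Topology

variable {E : Type*} [NormedAddCommGroup E] [NormedSpace ℝ E] [FiniteDimensional ℝ E]
  {M : Type*} [TopologicalSpace M] [ChartedSpace E M]

theorem SmoothNear.eventually {V : Type*} [NormedAddCommGroup V] [NormedSpace ℝ V] {f : E → V}
    {u : E} (hf : SmoothNear f u) : ∀ᶠ v in 𝓝 u, SmoothNear f v :=
  eventually_eventually_nhds.2 hf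

theorem atChart_castForm {x y : M} {k l : ℕ} (h : k = l)
    (a : TangentSpace 𝓘(ℝ, E) y [⋀^Fin k]→L[ℝ] ℝ) :
    atChart x y l (castForm h a) = atChart x y k a := by
  subst h; rfl

variable [IsManifold 𝓘(ℝ, E) ∞ M]

theorem toChart_nijLie_eventuallyEq {x : M} {u : E}
    (hu : u ∈ (extChartAt 𝓘(ℝ, E) x).target) {k l : ℕ} {K : VForm E M k}
    (hK : ∀ i, SmoothNear (compChart x K i) u) {α : Form E M l}
    (hα : SmoothNear (toChart x α) u) :
    toChart x (nijLie K α) =ᶠ[𝓝 u] lieE k (compChart x K) (toChart x α) := by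
  filter_upwards [eventually_target hu, eventually_all.2 fun i => (hK i).eventually,
    hα.eventually] with v hv hKv hαv using toChart_nijLie hv hKv hαv

theorem smoothNear_toChart_nijLie {x : M} {u : E}
    (hu : u ∈ (extChartAt 𝓘(ℝ, E) x).target) {k l : ℕ} {K : VForm E M k}
    (hK : ∀ i, SmoothNear (compChart x K i) u) {α : Form E M l}
    (hα : SmoothNear (toChart x α) u) : SmoothNear (toChart x (nijLie K α)) u :=
  (SmoothNear.lieE hK hα).congr (toChart_nijLie_eventuallyEq hu hK hα)

theorem toChart_interior_coordField {x : M} {u : E} (hu : u ∈ (extChartAt 𝓘(ℝ, E) x).target)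
    {l : ℕ} (i : Idx E) (β : Form E M (l + 1)) :
    toChart x (fun z => interior (coordField x i z) (β z)) u =
      contr (vec E i) (toChart x β u) := by
  have hy := (extChartAt 𝓘(ℝ, E) x).map_target hu
  have h := atChart_interior hy (coordField x i ((extChartAt 𝓘(ℝ, E) x).symm u))
    (β ((extChartAt 𝓘(ℝ, E) x).symm u))
  rw [← toChart_extChartAt hy β, ← toChart_extChartAt hy (fun z => interior (coordField x i z) (β z)),
    (extChartAt 𝓘(ℝ, E) x).right_inv hu] at h
  rw [h]
  congr 1
  exact congrArg contr ((chartD_isInvertible hy).self_apply_inverse (vec E i))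

/-- The Lie derivative along a coordinate vector field in the chart. -/
theorem atChart_lieD_coordField (y : M) (i : Idx E) {l : ℕ} {β : Form E M l}
    (hβ : SmoothNear (toChart y β) (extChartAt 𝓘(ℝ, E) y y)) :
    atChart y y l (lieD (coordField y i) β y) =
      contr (vec E i) (dE (toChart y β) (extChartAt 𝓘(ℝ, E) y y)) +
        dE (fun v => contr (vec E i) (toChart y β v)) (extChartAt 𝓘(ℝ, E) y y) := by
  have hy := mem_extChartAt_source (I := 𝓘(ℝ, E)) y
  have hu := (extChartAt 𝓘(ℝ, E) y).map_source hy
  have h1 : ∀ {l : ℕ} {β : Form E M l}, SmoothNear (toChart y β) (extChartAt 𝓘(ℝ, E) y y) →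
      atChart y y l (interior (coordField y i y) (extD β y)) =
        contr (vec E i) (dE (toChart y β) (extChartAt 𝓘(ℝ, E) y y)) := by
    intro l β hβ
    rw [atChart_interior hy, atChart_extD hy hβ.differentiableAt]
    congr 1
    exact congrArg contr ((chartD_isInvertible hy).self_apply_inverse (vec E i))
  cases l with
  | zero =>
    have h2 : (fun v => contr (vec E i) (toChart y β v)) = fun _ => 0 :=
      funext fun v => contr_toExt_zero _ _
    rw [h2, dE_zero, _root_.add_zero, ← h1 hβ]
    rfl
  | succ l =>
    have h2 : toChart y (fun z => interior (coordField y i z) (β z)) =ᶠ[𝓝 (extChartAt 𝓘(ℝ, E) y y)]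
        fun v => contr (vec E i) (toChart y β v) := by
      filter_upwards [eventually_target hu] with v hv using toChart_interior_coordField hv i β
    have h3 := (hβ.linear_comp (contr (vec E i))).congr h2
    rw [← h1 hβ, ← (dE_congr h2).self_of_nhds, ← atChart_extD hy h3.differentiableAt]
    exact (map_add (atChart y y (l + 1)) (extD (fun z => interior (coordField y i z) (β z)) y)
      (interior (coordField y i y) (extD β y))).trans (_root_.add_comm _ _)

theorem atChart_extDWedgeInterior (y : M) (i : Idx E) {k l : ℕ} {α : Form E M k} {β : Form E M l}
    (hα : SmoothNear (toChart y α) (extChartAt 𝓘(ℝ, E) y y)) :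
    atChart y y (k + l) (extDWedgeInterior α (coordField y i) β y) =
      dE (toChart y α) (extChartAt 𝓘(ℝ, E) y y) *
        contr (vec E i) (toChart y β (extChartAt 𝓘(ℝ, E) y y)) := by
  have hy := mem_extChartAt_source (I := 𝓘(ℝ, E)) y
  cases l with
  | zero =>
    -- In degree `0` the term is zero by convention, which agrees with contraction killing scalars.
    rw [show toChart y β (extChartAt 𝓘(ℝ, E) y y) = toExt 0 (Form.inChart β y _) from rfl,
      contr_toExt_zero, mul_zero]
    exact map_zero (atChart y y (k + 0))
  | succ l =>
    have h := atChart_wedge (x := y) (Nat.succ_add_eq_add_succ k l) (extD α y)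
      (interior (coordField y i y) (β y))
    rw [atChart_extD hy hα.differentiableAt, atChart_interior hy, ← toChart_extChartAt hy] at h
    refine h.trans (congrArg (_ * ·) ?_)
    exact congrArg (fun v => contr v (toChart y β (extChartAt 𝓘(ℝ, E) y y)))
      ((chartD_isInvertible hy).self_apply_inverse (vec E i))

theorem atChart_interiorWedgeExtD (y : M) (i : Idx E) {k l : ℕ} {α : Form E M k} {β : Form E M l}
    (hβ : SmoothNear (toChart y β) (extChartAt 𝓘(ℝ, E) y y)) :
    atChart y y (k + l) (interiorWedgeExtD (coordField y i) β α y) =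
      contr (vec E i) (toChart y α (extChartAt 𝓘(ℝ, E) y y)) *
        dE (toChart y β) (extChartAt 𝓘(ℝ, E) y y) := by
  have hy := mem_extChartAt_source (I := 𝓘(ℝ, E)) y
  cases k with
  | zero =>
    rw [show toChart y α (extChartAt 𝓘(ℝ, E) y y) = toExt 0 (Form.inChart α y _) from rfl,
      contr_toExt_zero, zero_mul]
    exact map_zero (atChart y y (0 + l))
  | succ k =>
    have h := atChart_wedge (x := y) (Nat.succ_add_eq_add_succ k l).symm
      (interior (coordField y i y) (α y)) (extD β y)
    rw [atChart_extD hy hβ.differentiableAt, atChart_interior hy, ← toChart_extChartAt hy] at h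
    refine h.trans (congrArg (· * _) ?_)
    exact congrArg (fun v => contr v (toChart y α (extChartAt 𝓘(ℝ, E) y y)))
      ((chartD_isInvertible hy).self_apply_inverse (vec E i))

/-- The components at `y` of a vector-valued form at `y`, as a linear map. -/
def compAt (x y : M) (k : ℕ) (s : Idx E) :
    TangentSpace 𝓘(ℝ, E) y [⋀^Fin k]→L[ℝ] TangentSpace 𝓘(ℝ, E) y →ₗ[ℝ] Ext E where
  toFun K := atChart x y k (((coordL s).comp (chartD x y)).compContinuousAlternatingMap K)
  map_add' K L := by
    rw [← map_add]
    congr 1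
    ext v
    exact map_add ((coordL s).comp (chartD x y)) (K v) (L v)
  map_smul' c K := by
    rw [RingHom.id_apply, ← map_smul]
    congr 1
    ext v
    exact map_smul ((coordL s).comp (chartD x y)) c (K v)

theorem compChart_extChartAt {x y : M} (hy : y ∈ (extChartAt 𝓘(ℝ, E) x).source) {k : ℕ}
    (K : VForm E M k) (s : Idx E) :
    compChart x K s (extChartAt 𝓘(ℝ, E) x y) = compAt x y k s (K y) := by
  rw [← toChart_component, toChart_extChartAt hy]
  rfl

theorem compAt_smulRight {x y : M} {k : ℕ} (s : Idx E)
    (a : TangentSpace 𝓘(ℝ, E) y [⋀^Fin k]→L[ℝ] ℝ) (v : TangentSpace 𝓘(ℝ, E) y) :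
    compAt x y k s (a.smulRight v) = (Module.finBasis ℝ E).repr (chartD x y v) s • atChart x y k a := by
  rw [← map_smul]
  refine congrArg (atChart x y k) ?_
  ext w
  refine (map_smul ((coordL s).comp (chartD x y)) (a w) v).trans ?_
  rw [smul_eq_mul, mul_comm]
  rfl

theorem compAt_smulRight_coordField {x y : M} (hy : y ∈ (extChartAt 𝓘(ℝ, E) x).source) {k : ℕ}
    (s j : Idx E) (a : TangentSpace 𝓘(ℝ, E) y [⋀^Fin k]→L[ℝ] ℝ) :
    compAt x y k s (a.smulRight (coordField x j y)) = if j = s then atChart x y k a else 0 := by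
  rw [compAt_smulRight, coordField, (chartD_isInvertible hy).self_apply_inverse]
  rw [Module.Basis.repr_self, Finsupp.single_apply, ite_smul, one_smul, zero_smul]

/-- Moving `β` and `dβ` to the left sorts the defining formula into the summands of `L_K L` and of
`(-1)^(kl) L_L K`. The term with `[∂_i, ∂_j]` vanishes. -/
theorem compAt_fnDecomposable (y : M) {k l : ℕ} {α : Form E M k} {β : Form E M l}
    (hα : SmoothNear (toChart y α) (extChartAt 𝓘(ℝ, E) y y))
    (hβ : SmoothNear (toChart y β) (extChartAt 𝓘(ℝ, E) y y)) (i j s : Idx E) :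
    compAt y y (k + l) s (fnDecomposable α (coordField y i) β (coordField y j) y) =
      (if j = s then toChart y α (extChartAt 𝓘(ℝ, E) y y) *
          (contr (vec E i) (dE (toChart y β) (extChartAt 𝓘(ℝ, E) y y)) +
            dE (fun v => contr (vec E i) (toChart y β v)) (extChartAt 𝓘(ℝ, E) y y)) +
          (-1 : ℝ) ^ k • (dE (toChart y α) (extChartAt 𝓘(ℝ, E) y y) *
            contr (vec E i) (toChart y β (extChartAt 𝓘(ℝ, E) y y))) else 0) -
      (-1 : ℝ) ^ (k * l) • (if i = s then toChart y β (extChartAt 𝓘(ℝ, E) y y) *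
          (contr (vec E j) (dE (toChart y α) (extChartAt 𝓘(ℝ, E) y y)) +
            dE (fun v => contr (vec E j) (toChart y α v)) (extChartAt 𝓘(ℝ, E) y y)) +
          (-1 : ℝ) ^ l • (dE (toChart y β) (extChartAt 𝓘(ℝ, E) y y) *
            contr (vec E j) (toChart y α (extChartAt 𝓘(ℝ, E) y y))) else 0) := by
  have hy := mem_extChartAt_source (I := 𝓘(ℝ, E)) y
  have c1 : atChart y y k (lieD (coordField y j) α y) * toChart y β (extChartAt 𝓘(ℝ, E) y y) =
      (-1 : ℝ) ^ (k * l) • (toChart y β (extChartAt 𝓘(ℝ, E) y y) *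
        atChart y y k (lieD (coordField y j) α y)) :=
    IsHom.comm_hom (γ := extInv) (toExt_isHom _) (toChart_isHom _ _ _)
  -- The contraction has parity `1 + k`, which replaces its degree `k - 1` and also covers `k = 0`.
  have c2 : contr (vec E j) (toChart y α (extChartAt 𝓘(ℝ, E) y y)) * atChart y y (l + 1) (extD β y) =
      (-1 : ℝ) ^ ((1 + k) * (l + 1)) • (atChart y y (l + 1) (extD β y) *
        contr (vec E j) (toChart y α (extChartAt 𝓘(ℝ, E) y y))) :=
    IsHom.comm_hom (γ := extInv) ((contr_isSuperDer _).isHom (toChart_isHom _ _ _)) (toExt_isHom _)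
  have c0 : compAt y y (k + l) s ((wedge rfl (α y) (β y)).smulRight
      (VectorField.mlieBracket 𝓘(ℝ, E) (coordField y i) (coordField y j) y)) = 0 := by
    rw [mlieBracket_coordField, compAt_smulRight, map_zero, map_zero, Finsupp.zero_apply, zero_smul]
  have c3 : (-1 : ℝ) ^ ((1 + k) * (l + 1)) = -((-1 : ℝ) ^ (k * l) * (-1) ^ k * (-1) ^ l) := by
    rw [show (1 + k) * (l + 1) = 1 + (k * l + k + l) by ring, pow_add, pow_add, pow_add, pow_one,
      neg_one_mul]
  have c4 : (-1 : ℝ) ^ k * (-1) ^ k = 1 := by rw [← mul_pow]; simp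
  rw [fnDecomposable]
  simp only [map_add, map_sub, map_smul, compAt_smulRight_coordField hy, c0]
  rw [atChart_extDWedgeInterior y i hα, atChart_interiorWedgeExtD y j hβ, atChart_wedge,
    atChart_wedge, ← toChart_extChartAt hy α, ← toChart_extChartAt hy β, c1,
    ← atChart_extD hy hβ.differentiableAt, c2, atChart_extD hy hβ.differentiableAt,
    atChart_lieD_coordField y i hβ, atChart_lieD_coordField y j hα, c3]
  -- Only `a * a = 1` is used of this sign from here on.
  generalize (-1 : ℝ) ^ k = a at c4 ⊢
  split_ifs <;> match_scalars <;>
    first | ring1 | linear_combination (-((-1 : ℝ) ^ (k * l) * (-1) ^ l)) * c4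

/-- The components of the Frölicher-Nijenhuis bracket at the centre of a chart. -/
theorem compChart_fnBracket_center (y : M) {k l : ℕ} {K : VForm E M k} {L : VForm E M l}
    (hK : ∀ i, SmoothNear (compChart y K i) (extChartAt 𝓘(ℝ, E) y y))
    (hL : ∀ i, SmoothNear (compChart y L i) (extChartAt 𝓘(ℝ, E) y y)) (s : Idx E) :
    compChart y (fnBracket K L) s (extChartAt 𝓘(ℝ, E) y y) =
      bracketE k l (compChart y K) (compChart y L) s (extChartAt 𝓘(ℝ, E) y y) := by
  have hy := mem_extChartAt_source (I := 𝓘(ℝ, E)) y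
  rw [compChart_extChartAt hy, fnBracket, map_sum]
  simp only [map_sum]
  simp only [fun i j => compAt_fnDecomposable y (α := component y i K) (β := component y j L)
    (hK i) (hL j), Finset.sum_sub_distrib, ← Finset.smul_sum]
  rw [bracketE, lieE_eq_sum (fun i => (hK i).differentiableAt) (fun i => compChart_isHom _ _ _ _)
    (hL s).differentiableAt, lieE_eq_sum (fun i => (hL i).differentiableAt)
    (fun i => compChart_isHom _ _ _ _) (hK s).differentiableAt]
  congr 1
  · refine Finset.sum_congr rfl fun i _ => ?_
    rw [Finset.sum_ite_eq']
    simp [toChart_component]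
  · rw [Finset.sum_comm]
    congr 1
    refine Finset.sum_congr rfl fun i _ => ?_
    rw [Finset.sum_ite_eq']
    simp [toChart_component]

/-- The `s`-th coordinate of the chart around `x`, as a form of degree `0`. -/
def coordForm (x : M) (s : Idx E) : Form E M 0 := fun z =>
  ContinuousAlternatingMap.constOfIsEmpty ℝ _ (Fin 0)
    ((Module.finBasis ℝ E).repr (extChartAt 𝓘(ℝ, E) x z) s)

theorem toChart_coordForm (x x' : M) (s : Idx E) (u : E) : toChart x' (coordForm x s) u =
    algebraMap ℝ (Ext E) ((Module.finBasis ℝ E).repr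
      ((extChartAt 𝓘(ℝ, E) x ∘ (extChartAt 𝓘(ℝ, E) x').symm) u) s) :=
  toExt_zero _

section

variable {x x' y : M} (hy : y ∈ (extChartAt 𝓘(ℝ, E) x).source)
  (hy' : y ∈ (extChartAt 𝓘(ℝ, E) x').source)
include hy hy'

theorem smoothNear_coordChange : SmoothNear (extChartAt 𝓘(ℝ, E) x' ∘ (extChartAt 𝓘(ℝ, E) x).symm)
    (extChartAt 𝓘(ℝ, E) x y) := by
  filter_upwards [eventually_mem_target hy,
    (tendsto_symm hy).eventually (eventually_mem_source hy')] with v hv hv'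
  have := contDiffAt_coordChange ((extChartAt 𝓘(ℝ, E) x).map_target hv) hv'
  rwa [(extChartAt 𝓘(ℝ, E) x).right_inv hv] at this

theorem smoothNear_toChart_coordForm (s : Idx E) :
    SmoothNear (toChart x (coordForm x' s)) (extChartAt 𝓘(ℝ, E) x y) :=
  ((smoothNear_coordChange hy hy').linear_comp
    (Algebra.linearMap ℝ (Ext E) ∘ₗ (Module.finBasis ℝ E).coord s)).congr
    (Eventually.of_forall fun v => toChart_coordForm x' x s v)

/-- The coefficients are the Jacobian of the chart change, so a coordinate function of one chart
extracts a component of `K` in that chart from its components in another. -/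
theorem lieE_toChart_coordForm {k : ℕ} (K : Idx E → E → Ext E) (s : Idx E) :
    lieE k K (toChart x (coordForm x' s)) (extChartAt 𝓘(ℝ, E) x y) =
      ∑ i, (Module.finBasis ℝ E).repr (chartD x' y ((chartD x y).inverse (vec E i))) s •
        K i (extChartAt 𝓘(ℝ, E) x y) := by
  have hτ := (smoothNear_coordChange hy hy').differentiableAt
  have h1 : DifferentiableAt ℝ (fun v => (Module.finBasis ℝ E).coord s
      ((extChartAt 𝓘(ℝ, E) x' ∘ (extChartAt 𝓘(ℝ, E) x).symm) v)) (extChartAt 𝓘(ℝ, E) x y) :=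
    ((coordL s).differentiableAt).comp _ hτ
  have h := lieE_scalar (k := k) (K := K) h1
  rw [funext (toChart_coordForm x' x s)]
  refine h.trans (Finset.sum_congr rfl fun i _ => ?_)
  rw [fderiv_linear_comp ((Module.finBasis ℝ E).coord s) hτ, fderiv_coordChange hy hy']
  rfl

end

theorem lieE_lieE_toChart {x : M} {u : E} (hu : u ∈ (extChartAt 𝓘(ℝ, E) x).target) {k l m : ℕ}
    {K : VForm E M k} {L : VForm E M l} (hK : ∀ i, SmoothNear (compChart x K i) u)
    (hL : ∀ i, SmoothNear (compChart x L i) u) {α : Form E M m} (hα : SmoothNear (toChart x α) u) :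
    toChart x (nijLie K (nijLie L α)) u =
      lieE k (compChart x K) (lieE l (compChart x L) (toChart x α)) u := by
  rw [toChart_nijLie hu hK (smoothNear_toChart_nijLie hu hL hα)]
  exact (lieE_congr (fun i => EventuallyEq.rfl) (toChart_nijLie_eventuallyEq hu hL hα)).self_of_nhds

/-- The components of the Frölicher-Nijenhuis bracket in a chart. -/
theorem compChart_fnBracket {x : M} {u : E} (hu : u ∈ (extChartAt 𝓘(ℝ, E) x).target) {k l : ℕ}
    {K : VForm E M k} {L : VForm E M l} (hK : K ∈ ΩT E M k) (hL : L ∈ ΩT E M l) (s : Idx E) :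
    compChart x (fnBracket K L) s u = bracketE k l (compChart x K) (compChart x L) s u := by
  obtain ⟨y, hy, rfl⟩ : ∃ y ∈ (extChartAt 𝓘(ℝ, E) x).source, extChartAt 𝓘(ℝ, E) x y = u :=
    ⟨_, (extChartAt 𝓘(ℝ, E) x).map_target hu, (extChartAt 𝓘(ℝ, E) x).right_inv hu⟩
  have hyy := mem_extChartAt_source (I := 𝓘(ℝ, E)) y
  rw [mem_ΩT_iff] at hK hL
  -- `F` is `[L_K, L_L]` applied to the coordinate `x^s`, built from operators on the manifold. By
  -- `lieE_bracketE`, `hF` reads it in any chart `z` as the Lie derivative of `x^s` along the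
  -- bracket computed in `z`.
  let f : Form E M 0 := coordForm x s
  let F := nijLie K (nijLie L f) y -
    (-1 : ℝ) ^ (k * l) • castForm (Nat.add_comm l k) (nijLie L (nijLie K f) y)
  have hF : ∀ z, y ∈ (extChartAt 𝓘(ℝ, E) z).source → atChart z y (k + l) F =
      lieE (k + l) (bracketE k l (compChart z K) (compChart z L)) (toChart z f)
        (extChartAt 𝓘(ℝ, E) z y) := by
    intro z hz
    have hzu := (extChartAt 𝓘(ℝ, E) z).map_source hz
    have hf := smoothNear_toChart_coordForm hz hy s
    rw [lieE_bracketE (hK z _ hzu) (fun i v => compChart_isHom z K i v) (hL z _ hzu)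
      (fun i v => compChart_isHom z L i v) hf,
      ← lieE_lieE_toChart hzu (hK z _ hzu) (hL z _ hzu) hf,
      ← lieE_lieE_toChart hzu (hL z _ hzu) (hK z _ hzu) hf, toChart_extChartAt hz,
      toChart_extChartAt hz]
    refine (map_sub (atChart z y (k + l)) _ _).trans ?_
    congr 1
    refine (map_smul (atChart z y (k + l)) _ _).trans ?_
    congr 1
    exact atChart_castForm _ _
  -- Taking `z = y` identifies `F` with the `s`-th component of `fnBracket K L` at `y`, as the
  -- bracket is known at the centre of a chart; taking `z = x` afterwards gives the bracket in the
  -- chart around `x`.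
  have h1 : ((coordL s).comp (chartD x y)).compContinuousAlternatingMap (fnBracket K L y) = F := by
    refine atChart_injective hyy (k + l) ?_
    rw [hF y hyy, lieE_toChart_coordForm hyy hy, atChart_clm_comp hyy]
    refine Finset.sum_congr rfl fun i _ => ?_
    rw [compChart_fnBracket_center y (hK y _ ((extChartAt 𝓘(ℝ, E) y).map_source hyy))
      (hL y _ ((extChartAt 𝓘(ℝ, E) y).map_source hyy))]
    rfl
  rw [compChart_extChartAt hy]
  refine (congrArg (atChart x y (k + l)) h1).trans ?_
  rw [hF x hy, lieE_toChart_coordForm hy hy]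
  rw [Finset.sum_eq_single s]
  · rw [(chartD_isInvertible hy).self_apply_inverse]
    simp
  · intro i _ hi
    rw [(chartD_isInvertible hy).self_apply_inverse]
    simp [hi]
  · simp

end Bracket

/-! ### Odd vector-valued forms with vanishing self-bracket, locally -/

section Local

open Filter Topology

variable {E : Type*} [NormedAddCommGroup E] [NormedSpace ℝ E] [FiniteDimensional ℝ E]

theorem insE_zero (K : Idx E → E → Ext E) : insE K (fun _ => 0) = fun _ => 0 :=
  funext fun _ => Finset.sum_eq_zero fun i _ => by rw [map_zero, mul_zero]

theorem lieE_zero (k : ℕ) (K : Idx E → E → Ext E) (u : E) : lieE k K (fun _ => 0) u = 0 := by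
  have h : dE (fun _ => (0 : Ext E)) = fun _ => 0 := funext dE_zero
  rw [lieE, h, insE_zero, dE_zero, smul_zero, add_zero]

theorem lieE_zero_left (k : ℕ) (f : E → Ext E) (u : E) : lieE k (fun _ _ => 0) f u = 0 := by
  have h : ∀ f : E → Ext E, insE (fun _ _ => 0) f = fun _ => 0 := fun f =>
    funext fun _ => Finset.sum_eq_zero fun i _ => by rw [zero_mul]
  rw [lieE, h, h, dE_zero, smul_zero, add_zero]

variable {k l : ℕ} {K L L' : Idx E → E → Ext E} {f g : E → Ext E} {u : E}

theorem lieE_add (hK : ∀ i, SmoothNear (K i) u) (hf : SmoothNear f u) (hg : SmoothNear g u) :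
    lieE k K (fun v => f v + g v) u = lieE k K f u + lieE k K g u := by
  choose F hF hF' using fun i => (hK i).exists_smoothAlg
  obtain ⟨f', hf', -⟩ := hf.exists_smoothAlg
  obtain ⟨g', hg', -⟩ := hg.exists_smoothAlg
  have h : (fun v => f v + g v) =ᶠ[𝓝 u] (f' + g').1 := hf'.add hg'
  rw [(lieE_congr hF h).self_of_nhds, (lieE_congr hF hf').self_of_nhds,
    (lieE_congr hF hg').self_of_nhds, ← calculus_lie, ← calculus_lie, ← calculus_lie, map_add]
  rfl

theorem lieE_smul (hK : ∀ i, SmoothNear (K i) u) (hf : SmoothNear f u) (c : ℝ) :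
    lieE k K (fun v => c • f v) u = c • lieE k K f u := by
  choose F hF hF' using fun i => (hK i).exists_smoothAlg
  obtain ⟨f', hf', -⟩ := hf.exists_smoothAlg
  have h : (fun v => c • f v) =ᶠ[𝓝 u] (c • f').1 := hf'.const_smul c
  rw [(lieE_congr hF h).self_of_nhds, (lieE_congr hF hf').self_of_nhds, ← calculus_lie,
    ← calculus_lie, map_smul]
  rfl

theorem lieE_add_left (hL : ∀ i, SmoothNear (L i) u) (hL' : ∀ i, SmoothNear (L' i) u)
    (hf : SmoothNear f u) :
    lieE k (fun i v => L i v + L' i v) f u = lieE k L f u + lieE k L' f u := by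
  have h : ∀ f, insE (fun i v => L i v + L' i v) f = fun v => insE L f v + insE L' f v := fun f =>
    funext fun v => by simp only [insE, add_mul, Finset.sum_add_distrib]
  rw [lieE, h, h, dE_add (SmoothNear.insE hL hf).differentiableAt
    (SmoothNear.insE hL' hf).differentiableAt, lieE, lieE, smul_add]
  exact add_add_add_comm _ _ _ _

theorem lieE_smul_left (hL : ∀ i, SmoothNear (L i) u) (hf : SmoothNear f u) (c : ℝ) :
    lieE k (fun i v => c • L i v) f u = c • lieE k L f u := by
  have h : ∀ f, insE (fun i v => c • L i v) f = fun v => c • insE L f v := fun f =>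
    funext fun v => by simp only [insE, smul_mul_assoc, Finset.smul_sum]
  rw [lieE, h, h, dE_smul (SmoothNear.insE hL hf).differentiableAt, lieE, smul_add, smul_comm c]

theorem bracketE_add (hK : ∀ i, SmoothNear (K i) u) (hL : ∀ i, SmoothNear (L i) u)
    (hL' : ∀ i, SmoothNear (L' i) u) (i : Idx E) :
    bracketE k l K (fun i v => L i v + L' i v) i u =
      bracketE k l K L i u + bracketE k l K L' i u := by
  rw [bracketE, bracketE, bracketE, lieE_add hK (hL i) (hL' i), lieE_add_left hL hL' (hK i), smul_add]
  abel

theorem bracketE_smul (hK : ∀ i, SmoothNear (K i) u) (hL : ∀ i, SmoothNear (L i) u) (c : ℝ)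
    (i : Idx E) :
    bracketE k l K (fun i v => c • L i v) i u = c • bracketE k l K L i u := by
  rw [bracketE, bracketE, lieE_smul hK (hL i), lieE_smul_left hL (hK i), smul_sub, smul_comm c]

theorem Odd.neg_one_pow_mul_self {k : ℕ} (hk : Odd k) : (-1 : ℝ) ^ (k * k) = -1 :=
  (hk.mul hk).neg_one_pow

/-- For odd `k` the sign `(-1)^(k * k)` is `-1`, so the two halves of the bracket add up instead of
cancelling. -/
theorem lieE_self_of_bracketE_eq_zero (hk : Odd k) {i : Idx E} (h : bracketE k k K K i u = 0) :
    lieE k K (K i) u = 0 := by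
  rw [bracketE, Odd.neg_one_pow_mul_self hk, neg_one_smul, sub_neg_eq_add, ← two_smul ℝ] at h
  exact (smul_eq_zero.1 h).resolve_left two_ne_zero

/-- In odd degree the supercommutator of `L_K` with itself is `2 L_K L_K`, and it equals the Lie
derivative along `[K, K]`. -/
theorem lieE_lieE_of_bracketE_eq_zero (hk : Odd k) (hK : ∀ i, SmoothNear (K i) u)
    (hK' : ∀ i v, IsHom extInv k (K i v)) (h : ∀ i, bracketE k k K K i =ᶠ[𝓝 u] fun _ => 0)
    (hf : SmoothNear f u) : lieE k K (lieE k K f) u = 0 := by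
  have h1 := lieE_bracketE hK hK' hK hK' hf
  rw [(lieE_congr (k := k + k) h (EventuallyEq.refl _ f)).self_of_nhds, lieE_zero_left,
    Odd.neg_one_pow_mul_self hk, neg_one_smul, sub_neg_eq_add, ← two_smul ℝ] at h1
  exact (smul_eq_zero.1 h1.symm).resolve_left two_ne_zero

/-- Expand `[K, [K, L]]^i` and replace `L_[K,L]` by the supercommutator. The two terms `L_K L_L K^i`
cancel because `(-1)^(k(k+l)) = -(-1)^(kl)`. The others contain `L_K L_K L^i` or `L_K K^i`, which
vanish. -/
theorem bracketE_bracketE_of_bracketE_eq_zero (hk : Odd k) (hK : ∀ i, SmoothNear (K i) u)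
    (hK' : ∀ i v, IsHom extInv k (K i v)) (h : ∀ i, bracketE k k K K i =ᶠ[𝓝 u] fun _ => 0)
    (hL : ∀ i, SmoothNear (L i) u) (hL' : ∀ i v, IsHom extInv l (L i v)) (i : Idx E) :
    bracketE k (k + l) K (bracketE k l K L) i u = 0 := by
  have h1 : lieE k K (K i) =ᶠ[𝓝 u] fun _ => 0 := by
    filter_upwards [h i] with v hv using lieE_self_of_bracketE_eq_zero hk hv
  have h2 : bracketE k l K L i = fun v =>
      lieE k K (L i) v + (-(-1 : ℝ) ^ (k * l)) • lieE l L (K i) v := by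
    funext v
    rw [bracketE, neg_smul, sub_eq_add_neg]
  have h3 : SmoothNear (fun v => (-(-1 : ℝ) ^ (k * l)) • lieE l L (K i) v) u :=
    (SmoothNear.lieE hL (hK i)).linear_comp ((-(-1 : ℝ) ^ (k * l)) • LinearMap.id)
  rw [bracketE, lieE_bracketE hK hK' hL hL' (hK i), h2,
    lieE_add hK (SmoothNear.lieE hK (hL i)) h3, lieE_smul hK (SmoothNear.lieE hL (hK i)),
    lieE_lieE_of_bracketE_eq_zero hk hK hK' h (hL i),
    (lieE_congr (fun i => EventuallyEq.refl _ (L i)) h1).self_of_nhds, lieE_zero, mul_add, pow_add,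
    Odd.neg_one_pow_mul_self hk]
  simp

end Local

/-! ### Transfer to the manifold -/

section Global

open Filter Topology

variable {E : Type*} [NormedAddCommGroup E] [NormedSpace ℝ E] [FiniteDimensional ℝ E]
  {M : Type*} [TopologicalSpace M] [ChartedSpace E M] [IsManifold 𝓘(ℝ, E) ∞ M]

theorem form_ext {k : ℕ} {α β : Form E M k} (h : ∀ x, ∀ u ∈ (extChartAt 𝓘(ℝ, E) x).target,
    toChart x α u = toChart x β u) : α = β := by
  funext y
  have hy := mem_extChartAt_source (I := 𝓘(ℝ, E)) y
  have := h y _ ((extChartAt 𝓘(ℝ, E) y).map_source hy)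
  rw [toChart_extChartAt hy, toChart_extChartAt hy] at this
  exact atChart_injective hy k this

/-- Every point is the centre of its own chart, so the Christoffel symbols are needed only at
centres. -/
theorem vform_ext_center {k : ℕ} {K L : VForm E M k}
    (h : ∀ x s, compChart x K s (extChartAt 𝓘(ℝ, E) x x) =
      compChart x L s (extChartAt 𝓘(ℝ, E) x x)) : K = L := by
  funext y
  have hy := mem_extChartAt_source (I := 𝓘(ℝ, E)) y
  have h1 : ∀ s, ((coordL s).comp (chartD y y)).compContinuousAlternatingMap (K y) =
      ((coordL s).comp (chartD y y)).compContinuousAlternatingMap (L y) := by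
    intro s
    have := h y s
    rw [compChart_extChartAt hy, compChart_extChartAt hy] at this
    exact atChart_injective hy k this
  ext v
  have h2 : chartD y y (K y v) = chartD y y (L y v) :=
    (Module.finBasis ℝ E).ext_elem fun s => DFunLike.congr_fun (h1 s) v
  rw [← (chartD_isInvertible hy).inverse_apply_self (K y v), h2,
    (chartD_isInvertible hy).inverse_apply_self]

theorem vform_ext {k : ℕ} {K L : VForm E M k} (h : ∀ x, ∀ u ∈ (extChartAt 𝓘(ℝ, E) x).target,
    ∀ s, compChart x K s u = compChart x L s u) : K = L :=
  vform_ext_center fun x s => h x _ (mem_extChartAt_target x) s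

theorem toChart_add (x : M) {k : ℕ} (α β : Form E M k) :
    toChart x (α + β) = fun u => toChart x α u + toChart x β u :=
  funext fun u => map_add (toExt k) (Form.inChart α x u) (Form.inChart β x u)

theorem toChart_smul (x : M) {k : ℕ} (c : ℝ) (α : Form E M k) :
    toChart x (c • α) = fun u => c • toChart x α u :=
  funext fun u => map_smul (toExt k) c (Form.inChart α x u)

theorem toChart_zero (x : M) (k : ℕ) : toChart x (0 : Form E M k) = fun _ => 0 :=
  funext fun _ => map_zero (toExt k)

theorem compChart_add (x : M) {k : ℕ} (K L : VForm E M k) :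
    compChart x (K + L) = fun i u => compChart x K i u + compChart x L i u := by
  funext i u
  have h : VForm.inChart (K + L) x u = VForm.inChart K x u + VForm.inChart L x u := by
    ext v
    exact map_add (chartD x ((extChartAt 𝓘(ℝ, E) x).symm u)) _ _
  rw [compChart, h, map_add]
  rfl

theorem compChart_smul (x : M) {k : ℕ} (c : ℝ) (K : VForm E M k) :
    compChart x (c • K) = fun i u => c • compChart x K i u := by
  funext i u
  have h : VForm.inChart (c • K) x u = c • VForm.inChart K x u := by
    ext v
    exact map_smul (chartD x ((extChartAt 𝓘(ℝ, E) x).symm u)) _ _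
  rw [compChart, h, map_smul]
  rfl

theorem compChart_zero (x : M) (k : ℕ) : compChart x (0 : VForm E M k) = fun _ _ => 0 := by
  have := compChart_smul x 0 (0 : VForm E M k)
  simpa using this

theorem compChart_fnBracket_eventuallyEq {x : M} {u : E} (hu : u ∈ (extChartAt 𝓘(ℝ, E) x).target)
    {k l : ℕ} {K : VForm E M k} {L : VForm E M l} (hK : K ∈ ΩT E M k) (hL : L ∈ ΩT E M l)
    (s : Idx E) : compChart x (fnBracket K L) s =ᶠ[𝓝 u]
      bracketE k l (compChart x K) (compChart x L) s := by
  filter_upwards [eventually_target hu] with v hv using compChart_fnBracket hv hK hL s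

theorem fnBracket_mem {k l : ℕ} {K : VForm E M k} {L : VForm E M l} (hK : K ∈ ΩT E M k)
    (hL : L ∈ ΩT E M l) : fnBracket K L ∈ ΩT E M (k + l) :=
  mem_ΩT_iff.2 fun x u hu i => (SmoothNear.bracketE (mem_ΩT_iff.1 hK x u hu)
    (mem_ΩT_iff.1 hL x u hu) i).congr (compChart_fnBracket_eventuallyEq hu hK hL i)

theorem nijLie_mem {k l : ℕ} {K : VForm E M k} {α : Form E M l} (hK : K ∈ ΩT E M k)
    (hα : α ∈ Ω E M l) : nijLie K α ∈ Ω E M (k + l) :=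
  mem_Ω_iff.2 fun x u hu => smoothNear_toChart_nijLie hu (mem_ΩT_iff.1 hK x u hu)
    (mem_Ω_iff.1 hα x u hu)

theorem nijLie_add {k l : ℕ} {K : VForm E M k} {α β : Form E M l} (hK : K ∈ ΩT E M k)
    (hα : α ∈ Ω E M l) (hβ : β ∈ Ω E M l) : nijLie K (α + β) = nijLie K α + nijLie K β := by
  refine form_ext fun x u hu => ?_
  have hK' := mem_ΩT_iff.1 hK x u hu
  have hα' := mem_Ω_iff.1 hα x u hu
  have hβ' := mem_Ω_iff.1 hβ x u hu
  rw [toChart_nijLie hu hK' (mem_Ω_iff.1 (add_mem hα hβ) x u hu), toChart_add, toChart_add,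
    lieE_add hK' hα' hβ', ← toChart_nijLie hu hK' hα', ← toChart_nijLie hu hK' hβ']

theorem nijLie_smul {k l : ℕ} {K : VForm E M k} {α : Form E M l} (hK : K ∈ ΩT E M k)
    (hα : α ∈ Ω E M l) (c : ℝ) : nijLie K (c • α) = c • nijLie K α := by
  refine form_ext fun x u hu => ?_
  have hK' := mem_ΩT_iff.1 hK x u hu
  have hα' := mem_Ω_iff.1 hα x u hu
  rw [toChart_nijLie hu hK' (mem_Ω_iff.1 (Submodule.smul_mem _ c hα) x u hu), toChart_smul,
    toChart_smul, lieE_smul hK' hα', ← toChart_nijLie hu hK' hα']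

theorem fnBracket_add {k l : ℕ} {K : VForm E M k} {L L' : VForm E M l} (hK : K ∈ ΩT E M k)
    (hL : L ∈ ΩT E M l) (hL' : L' ∈ ΩT E M l) :
    fnBracket K (L + L') = fnBracket K L + fnBracket K L' := by
  refine vform_ext fun x u hu s => ?_
  rw [compChart_fnBracket hu hK (add_mem hL hL'), compChart_add, compChart_add,
    bracketE_add (mem_ΩT_iff.1 hK x u hu) (mem_ΩT_iff.1 hL x u hu) (mem_ΩT_iff.1 hL' x u hu),
    ← compChart_fnBracket hu hK hL, ← compChart_fnBracket hu hK hL']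

theorem fnBracket_smul {k l : ℕ} {K : VForm E M k} {L : VForm E M l} (hK : K ∈ ΩT E M k)
    (hL : L ∈ ΩT E M l) (c : ℝ) : fnBracket K (c • L) = c • fnBracket K L := by
  refine vform_ext fun x u hu s => ?_
  rw [compChart_fnBracket hu hK (Submodule.smul_mem _ c hL), compChart_smul, compChart_smul,
    bracketE_smul (mem_ΩT_iff.1 hK x u hu) (mem_ΩT_iff.1 hL x u hu), ← compChart_fnBracket hu hK hL]

theorem bracketE_compChart_eq_zero {k : ℕ} {K : VForm E M k} (hK : K ∈ ΩT E M k)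
    (h : fnBracket K K = 0) {x : M} {u : E} (hu : u ∈ (extChartAt 𝓘(ℝ, E) x).target) (i : Idx E) :
    bracketE k k (compChart x K) (compChart x K) i =ᶠ[𝓝 u] fun _ => 0 := by
  refine (compChart_fnBracket_eventuallyEq hu hK hK i).symm.trans ?_
  rw [h, compChart_zero]

theorem nijLie_nijLie {k l : ℕ} {K : VForm E M k} {α : Form E M l} (hk : Odd k)
    (hK : K ∈ ΩT E M k) (h : fnBracket K K = 0) (hα : α ∈ Ω E M l) :
    nijLie K (nijLie K α) = 0 := by
  refine form_ext fun x u hu => ?_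
  have hK' := mem_ΩT_iff.1 hK x u hu
  rw [lieE_lieE_toChart hu hK' hK' (mem_Ω_iff.1 hα x u hu), toChart_zero]
  exact lieE_lieE_of_bracketE_eq_zero hk hK' (fun i v => compChart_isHom x K i v)
    (bracketE_compChart_eq_zero hK h hu) (mem_Ω_iff.1 hα x u hu)

theorem fnBracket_fnBracket {k l : ℕ} {K : VForm E M k} {L : VForm E M l} (hk : Odd k)
    (hK : K ∈ ΩT E M k) (h : fnBracket K K = 0) (hL : L ∈ ΩT E M l) :
    fnBracket K (fnBracket K L) = 0 := by
  refine vform_ext fun x u hu s => ?_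
  rw [compChart_fnBracket hu hK (fnBracket_mem hK hL), compChart_zero,
    (bracketE_congr (fun i => EventuallyEq.refl _ (compChart x K i))
      (compChart_fnBracket_eventuallyEq hu hK hL) s).self_of_nhds]
  exact bracketE_bracketE_of_bracketE_eq_zero hk (mem_ΩT_iff.1 hK x u hu)
    (fun i v => compChart_isHom x K i v) (bracketE_compChart_eq_zero hK h hu)
    (mem_ΩT_iff.1 hL x u hu) (fun i v => compChart_isHom x L i v) s

theorem nijLie_zero_left {k l : ℕ} {α : Form E M l} (hα : α ∈ Ω E M l) :
    nijLie (0 : VForm E M k) α = 0 := by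
  refine form_ext fun x u hu => ?_
  rw [toChart_nijLie hu (mem_ΩT_iff.1 (Submodule.zero_mem _) x u hu) (mem_Ω_iff.1 hα x u hu),
    compChart_zero, lieE_zero_left, toChart_zero]

theorem fnBracket_zero_left {k l : ℕ} {L : VForm E M l} (hL : L ∈ ΩT E M l) :
    fnBracket (0 : VForm E M k) L = 0 := by
  refine vform_ext fun x u hu s => ?_
  rw [compChart_fnBracket hu (Submodule.zero_mem _) hL, compChart_zero, compChart_zero, bracketE,
    lieE_zero_left, lieE_zero, smul_zero, sub_zero]

theorem isDifferential_nijLie {k : ℕ} {K : VForm E M k} (hK : K ∈ ΩT E M k)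
    (h : ∀ l, ∀ α ∈ Ω E M l, nijLie K (nijLie K α) = 0) :
    IsDifferential (Ω E M) k (fun _ => nijLie K) where
  map_mem _ _ ha := nijLie_mem hK ha
  map_add _ _ ha _ hb := nijLie_add hK ha hb
  map_smul _ c _ ha := nijLie_smul hK ha c
  comp_self := h

theorem isDifferential_fnBracket {k : ℕ} {K : VForm E M k} (hK : K ∈ ΩT E M k)
    (h : ∀ l, ∀ L ∈ ΩT E M l, fnBracket K (fnBracket K L) = 0) :
    IsDifferential (ΩT E M) k (fun _ => fnBracket K) where
  map_mem _ _ ha := fnBracket_mem hK ha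
  map_add _ _ ha _ hb := fnBracket_add hK ha hb
  map_smul _ c _ ha := fnBracket_smul hK ha c
  comp_self := h

end Global

/-! ### Cancellation for parallel vector-valued forms -/

section ParallelAlgebra

open Filter Topology

variable {E : Type*} [NormedAddCommGroup E] [NormedSpace ℝ E] [FiniteDimensional ℝ E]

theorem sum_symm_smul_antisymm {I V : Type*} [Fintype I] [AddCommGroup V] [Module ℝ V]
    {c : I → I → ℝ} {a : I → I → V} (hc : ∀ i j, c i j = c j i) (ha : ∀ i j, a i j = -a j i) :
    ∑ i, ∑ j, c i j • a i j = 0 := by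
  have h : ∑ i, ∑ j, c i j • a i j = -∑ i, ∑ j, c i j • a i j := by
    conv_lhs => rw [Finset.sum_comm]
    simp only [← Finset.sum_neg_distrib]
    refine Finset.sum_congr rfl fun i _ => Finset.sum_congr rfl fun j _ => ?_
    rw [hc, ha, smul_neg]
  have h2 : (2 : ℝ) • ∑ i, ∑ j, c i j • a i j = 0 := by
    rw [two_smul]
    nth_rewrite 1 [h]
    exact neg_add_cancel _
  exact (smul_eq_zero.1 h2).resolve_left two_ne_zero

/-- The Nijenhuis-Lie derivative at a point in terms of partial derivatives. -/
theorem lieE_eq_sum_fderiv {k : ℕ} {K : Idx E → E → Ext E} {f : E → Ext E} {u : E}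
    (hK : ∀ i, SmoothNear (K i) u) (hK' : ∀ i v, IsHom extInv k (K i v)) (hf : SmoothNear f u) :
    lieE k K f u = ∑ i, (K i u * fderiv ℝ f u (vec E i) +
      (-1 : ℝ) ^ k • (dE (K i) u * contr (vec E i) (f u))) := by
  obtain ⟨F, hF, hF'⟩ := exists_smoothAlg_family hK hK'
  obtain ⟨f', hf', -⟩ := hf.exists_smoothAlg
  rw [(lieE_congr hF hf').self_of_nhds, ← calculus_lie, (calculus E).lie_apply' hF',
    AddSubmonoidClass.coe_finsetSum, Finset.sum_apply]
  refine Finset.sum_congr rfl fun i _ => ?_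
  rw [(hF i).self_of_nhds, hf'.fderiv_eq, (dE_congr (hF i)).self_of_nhds, hf'.self_of_nhds,
    ← calculus_d]
  rfl

/-- Two contributions vanish as symmetric `Γ` against antisymmetric products: `Γ_{is}^j K^i K^s`, as
the `K^i` are odd, and `Γ_{ts}^r e^t e^s`. The two that remain are sums of `Γ_{is}^r K^i e^s ι_r
K^j` and `Γ_{ts}^i e^t K^s ι_i K^j`; they cancel after relabelling because `K^i e^s = -e^s K^i`. -/
theorem sum_connection_eq_zero {k : ℕ} (hk : Odd k) {K : Idx E → Ext E}
    (hK : ∀ i, IsHom extInv k (K i)) {Γ : Idx E → Idx E → Idx E → ℝ}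
    (hΓ : ∀ t s r, Γ t s r = Γ s t r) {D : Idx E → Idx E → Ext E}
    (hD : ∀ t j, D t j = -∑ s, Γ t s j • K s +
      ∑ s, ∑ r, Γ t s r • (cov s * contr (vec E r) (K j))) (j : Idx E) :
    ∑ i, (K i * D i j - (∑ t, cov t * D t i) * contr (vec E i) (K j)) = 0 := by
  have hKK : ∀ i s, K i * K s = -(K s * K i) := fun i s => by
    rw [(hK i).comm_hom (hK s), Odd.neg_one_pow_mul_self hk, neg_one_smul]
  have hcc : ∀ i s : Idx E, (cov i * cov s : Ext E) = -(cov s * cov i) := fun i s => by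
    rw [(cov_isHom i).comm_hom (cov_isHom s)]
    simp
  have hKc : ∀ i s : Idx E, K i * cov s = -(cov s * K i) := fun i s => by
    rw [(hK i).comm_hom (cov_isHom s), mul_one, hk.neg_one_pow, neg_one_smul]
  have h1 : ∑ i, K i * D i j = ∑ i, ∑ s, ∑ r, Γ i s r • (K i * cov s * contr (vec E r) (K j)) := by
    simp only [hD, mul_add, mul_neg, Finset.mul_sum, mul_smul_comm, Finset.sum_add_distrib,
      Finset.sum_neg_distrib, mul_assoc]
    rw [sum_symm_smul_antisymm (fun i s => hΓ i s j) hKK, neg_zero, zero_add]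
  have h2 : ∀ i, ∑ t, cov t * D t i = -∑ t, ∑ s, Γ t s i • (cov t * K s) := by
    intro i
    have h3 : ∑ t, ∑ s, ∑ r, Γ t s r • (cov t * (cov s * contr (vec E r) (K i))) = 0 := by
      have : ∀ t, ∑ s, ∑ r, Γ t s r • (cov t * (cov s * contr (vec E r) (K i))) =
          ∑ r, ∑ s, Γ t s r • (cov t * (cov s * contr (vec E r) (K i))) := fun t =>
        Finset.sum_comm
      simp only [this]
      rw [Finset.sum_comm]
      refine Finset.sum_eq_zero fun r _ => sum_symm_smul_antisymm (fun t s => hΓ t s r) fun t s => ?_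
      rw [← mul_assoc, ← mul_assoc, hcc, neg_mul]
    simp only [hD, mul_add, mul_neg, Finset.mul_sum, mul_smul_comm, Finset.sum_add_distrib,
      Finset.sum_neg_distrib]
    rw [h3, add_zero]
  rw [Finset.sum_sub_distrib, h1]
  simp only [h2, neg_mul, Finset.sum_neg_distrib, Finset.sum_mul, sub_neg_eq_add, smul_mul_assoc]
  rw [add_eq_zero_iff_eq_neg]
  simp only [← Finset.sum_neg_distrib]
  have h4 : ∀ i, ∑ t, ∑ s, -(Γ t s i • (cov t * K s * contr (vec E i) (K j))) =
      ∑ s, ∑ t, -(Γ t s i • (cov t * K s * contr (vec E i) (K j))) := fun i => Finset.sum_comm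
  simp only [h4]
  conv_rhs => rw [Finset.sum_comm]
  refine Finset.sum_congr rfl fun s _ => ?_
  rw [Finset.sum_comm]
  refine Finset.sum_congr rfl fun i _ => Finset.sum_congr rfl fun t _ => ?_
  rw [hKc, hΓ, neg_mul, smul_neg]

/-- A vector-valued form with these first derivatives has vanishing bracket with itself at the
point. -/
theorem bracketE_self_eq_zero {k : ℕ} (hk : Odd k) {K : Idx E → E → Ext E} {u : E}
    (hK : ∀ i, SmoothNear (K i) u) (hK' : ∀ i v, IsHom extInv k (K i v))
    {Γ : Idx E → Idx E → Idx E → ℝ} (hΓ : ∀ t s r, Γ t s r = Γ s t r)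
    (hD : ∀ t j, fderiv ℝ (K j) u (vec E t) = -∑ s, Γ t s j • K s u +
      ∑ s, ∑ r, Γ t s r • (cov s * contr (vec E r) (K j u))) (j : Idx E) :
    bracketE k k K K j u = 0 := by
  have h : lieE k K (K j) u = 0 := by
    rw [lieE_eq_sum_fderiv hK hK' (hK j)]
    simp only [hk.neg_one_pow, neg_one_smul, ← sub_eq_add_neg, dE]
    exact sum_connection_eq_zero hk (fun i => hK' i u) hΓ hD j
  rw [bracketE, h, smul_zero, sub_zero]

theorem contr_contr (v w : E) (a : Ext E) : contr v (contr w a) = -contr w (contr v a) :=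
  CliffordAlgebra.contractLeft_comm ..

/-- If `g` and `T` are parallel then so is `K = g⁻¹ T`. -/
theorem fderiv_of_metric {g : Idx E → Idx E → E → ℝ} {K : Idx E → E → Ext E} {T : E → Ext E} {u : E}
    (hg : ∀ a b, DifferentiableAt ℝ (g a b) u) (hK : ∀ a, DifferentiableAt ℝ (K a) u)
    (hT : DifferentiableAt ℝ T u)
    (hgK : ∀ b, ∀ᶠ v in 𝓝 u, ∑ a, g a b v • K a v = contr (vec E b) (T v))
    {h : Idx E → Idx E → ℝ} (hh : ∀ a c, ∑ b, g a b u * h b c = if a = c then 1 else 0)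
    {Γ : Idx E → Idx E → Idx E → ℝ}
    (hdg : ∀ t a b, fderiv ℝ (g a b) u (vec E t) = ∑ r, (Γ t a r * g r b u + Γ t b r * g a r u))
    (hdT : ∀ t, fderiv ℝ T u (vec E t) = ∑ s, ∑ r, Γ t s r • (cov s * contr (vec E r) (T u)))
    (t j : Idx E) : fderiv ℝ (K j) u (vec E t) = -∑ s, Γ t s j • K s u +
      ∑ s, ∑ r, Γ t s r • (cov s * contr (vec E r) (K j u)) := by
  -- Differentiate `g_{ab} K^a = ι_b T` in two ways. Moving `ι_b` past `e^s` in the derivative of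
  -- `T` produces `Γ_{tb}^r ι_r T`, which is matched by the half of the derivative of `g` in which
  -- `Γ` acts on the index `b`.
  have h1 : ∀ b, ∑ a, g a b u • fderiv ℝ (K a) u (vec E t) = ∑ a, g a b u •
      (-∑ s, Γ t s a • K s u + ∑ s, ∑ r, Γ t s r • (cov s * contr (vec E r) (K a u))) := by
    intro b
    have e1 : fderiv ℝ (fun v => ∑ a, g a b v • K a v) u (vec E t) =
        contr (vec E b) (fderiv ℝ T u (vec E t)) := by
      rw [EventuallyEq.fderiv_eq (hgK b)]
      exact fderiv_linear_comp (contr (vec E b)) hT _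
    have e2 : fderiv ℝ (fun v => ∑ a, g a b v • K a v) u (vec E t) =
        ∑ a, (g a b u • fderiv ℝ (K a) u (vec E t) + fderiv ℝ (g a b) u (vec E t) • K a u) := by
      rw [fderiv_fun_sum (A := fun a v => g a b v • K a v) fun a _ => (hg a b).smul (hK a), sum_apply]
      refine Finset.sum_congr rfl fun a _ => ?_
      rw [fderiv_fun_smul (hg a b) (hK a)]
      rfl
    have e3 : contr (vec E b) (fderiv ℝ T u (vec E t)) =
        ∑ r, Γ t b r • contr (vec E r) (T u) +
          ∑ s, ∑ r, Γ t s r • (cov s * contr (vec E r) (contr (vec E b) (T u))) := by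
      rw [hdT]
      simp only [map_sum, map_smul, contr_cov_mul, contr_contr (vec E b), mul_neg, sub_neg_eq_add,
        smul_add, Finset.sum_add_distrib]
      congr 1
      rw [Finset.sum_eq_single b]
      · simp
      · intro s _ hs
        simp [hs.symm]
      · simp
    rw [e1, e3, Finset.sum_add_distrib] at e2
    simp only [← (hgK _).self_of_nhds, hdg, map_sum, map_smul, Finset.mul_sum, mul_smul_comm] at e2
    rw [← sub_eq_iff_eq_add] at e2
    rw [← e2]
    simp only [smul_add, Finset.sum_add_distrib, smul_neg, Finset.sum_neg_distrib, add_smul,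
      Finset.sum_smul, Finset.smul_sum, smul_smul]
    have q1 : ∑ r, ∑ a, (Γ t b r * g a r u) • K a u = ∑ a, ∑ r, (Γ t b r * g a r u) • K a u :=
      Finset.sum_comm
    have q2 : ∑ a, ∑ s, (g a b u * Γ t s a) • K s u = ∑ s, ∑ a, (Γ t s a * g a b u) • K s u := by
      rw [Finset.sum_comm]
      simp only [mul_comm]
    have q3 : ∑ a, ∑ s, ∑ r, (g a b u * Γ t s r) • (cov s * contr (vec E r) (K a u)) =
        ∑ s, ∑ r, ∑ a, (Γ t s r * g a b u) • (cov s * contr (vec E r) (K a u)) := by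
      rw [Finset.sum_comm]
      refine Finset.sum_congr rfl fun s _ => ?_
      rw [Finset.sum_comm]
      simp only [mul_comm (g _ _ _)]
    rw [q1, q2, q3]
    abel
  -- Contraction with the inverse matrix removes the factor `g` from `h1`.
  have h2 : ∀ X : Idx E → Ext E, ∑ b, h b j • ∑ a, g a b u • X a = X j := by
    intro X
    simp only [Finset.smul_sum, smul_smul]
    rw [Finset.sum_comm]
    simp only [← Finset.sum_smul]
    have : ∀ a, ∑ b, h b j * g a b u = if a = j then 1 else 0 := fun a => by
      rw [← hh]
      exact Finset.sum_congr rfl fun b _ => mul_comm _ _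
    simp [this]
  rw [← h2 fun a => fderiv ℝ (K a) u (vec E t)]
  simp only [h1]
  rw [h2]

end ParallelAlgebra

/-! ### Smoothness of the inverse matrix -/

section MatrixSmooth

variable {E : Type*} [NormedAddCommGroup E] [NormedSpace ℝ E] {n : Type*} [Fintype n]
  [DecidableEq n] {k : WithTop ℕ∞} {u : E}

theorem contDiffAt_det {A : E → Matrix n n ℝ} (hA : ∀ i j, ContDiffAt ℝ k (fun v => A v i j) u) :
    ContDiffAt ℝ k (fun v => (A v).det) u := by
  simp only [Matrix.det_apply]
  exact ContDiffAt.sum fun σ _ => (contDiffAt_prod fun i _ => hA _ _).const_smul _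

/-- By Cramer's rule the entries are quotients of determinants of smooth entries. -/
theorem contDiffAt_matrix_inv {A : E → Matrix n n ℝ}
    (hA : ∀ i j, ContDiffAt ℝ k (fun v => A v i j) u) (h0 : (A u).det ≠ 0) (i j : n) :
    ContDiffAt ℝ k (fun v => (A v)⁻¹ i j) u := by
  simp only [Matrix.inv_def, Ring.inverse_eq_inv', Matrix.smul_apply, Matrix.adjugate_apply]
  refine ((contDiffAt_det hA).inv h0).smul (contDiffAt_det fun a b => ?_)
  by_cases h : a = j
  · subst h
    simpa using contDiffAt_const
  · simpa [Matrix.updateRow_ne h] using hA a b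

end MatrixSmooth

/-! ### Christoffel symbols and parallel forms in coordinates -/

section Parallel

open Filter Topology

variable {E : Type*} [NormedAddCommGroup E] [NormedSpace ℝ E] [FiniteDimensional ℝ E]

theorem toExt_eq_of_basis {k : ℕ} {α β : E [⋀^Fin k]→L[ℝ] ℝ}
    (h : ∀ I : Fin k → Idx E, α (fun j => vec E (I j)) = β (fun j => vec E (I j))) :
    toExt k α = toExt k β := by
  rw [toExt_apply, toExt_apply]
  simp only [h]

/-- The action of an endomorphism on forms as a derivation, in the exterior algebra. -/
theorem toExt_derivation {m : ℕ} (α β : E [⋀^Fin (m + 1)]→L[ℝ] ℝ) (A : E →ₗ[ℝ] E)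
    (h : ∀ I : Fin (m + 1) → Idx E, β (fun j => vec E (I j)) =
      ∑ i, α (Function.update (fun j => vec E (I j)) i (A (vec E (I i))))) :
    toExt (m + 1) β = ∑ s, cov s * contr (A (vec E s)) (toExt (m + 1) α) := by
  -- The derivation action of `A` on `α` is the antisymmetrisation of `w ↦ ι_{A w} α`: bringing the
  -- modified argument to the front costs exactly its sign.
  let B : E →L[ℝ] E [⋀^Fin m]→L[ℝ] ℝ := LinearMap.toContinuousLinearMap
    { toFun := fun w => interior (A w) α
      map_add' := fun v w => by
        ext u
        simp only [interior_apply, map_add, ContinuousAlternatingMap.add_apply]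
        exact α.toAlternatingMap.map_vecCons_add u (A v) (A w)
      map_smul' := fun c w => by
        ext u
        simp only [interior_apply, map_smul, ContinuousAlternatingMap.smul_apply, RingHom.id_apply]
        exact α.toAlternatingMap.map_vecCons_smul u c (A w) }
  have hB : ∀ w, B w = interior (A w) α := fun _ => rfl
  simp only [contr_toExt, ← hB]
  rw [← toExt_alternatizeUncurryFin]
  refine toExt_eq_of_basis fun I => ?_
  rw [h, ContinuousAlternatingMap.alternatizeUncurryFin_apply]
  refine Finset.sum_congr rfl fun i _ => ?_
  rw [← Fin.insertNth_removeNth, ContinuousAlternatingMap.map_insertNth]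
  rfl

variable {M : Type*} [TopologicalSpace M] [ChartedSpace E M] [IsManifold 𝓘(ℝ, E) ∞ M]

/-- The Christoffel symbols of a connection at the centre of a chart. -/
def christoffel (cov : CovariantDerivative 𝓘(ℝ, E) E (fun x : M => TangentSpace 𝓘(ℝ, E) x))
    (x : M) (t s r : Idx E) : ℝ :=
  (Module.finBasis ℝ E).repr (chartD x x (cov (coordField x s) x (coordField x t x))) r

/-- Vanishing torsion, applied to two coordinate fields, whose Lie bracket is zero. -/
theorem christoffel_symm {cov : CovariantDerivative 𝓘(ℝ, E) E (fun x : M => TangentSpace 𝓘(ℝ, E) x)}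
    (h : CovariantDerivative.torsion cov = 0) (x : M) (t s r : Idx E) :
    christoffel cov x t s r = christoffel cov x s t r := by
  have hx := mem_extChartAt_source (I := 𝓘(ℝ, E)) x
  have h1 := ((CovariantDerivative.torsion_eq_zero_iff cov).1 h)
    ((contMDiffAt_coordField hx t).mdifferentiableAt (by simp))
    ((contMDiffAt_coordField hx s).mdifferentiableAt (by simp))
  rw [mlieBracket_coordField, sub_eq_zero] at h1
  rw [christoffel, h1]
  rfl

theorem sum_repr_coordField {x y : M} (hy : y ∈ (extChartAt 𝓘(ℝ, E) x).source)
    (v : TangentSpace 𝓘(ℝ, E) y) :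
    ∑ r, (Module.finBasis ℝ E).repr (chartD x y v) r • coordField x r y = v := by
  refine (sum_vec ((chartD x y).inverse).toLinearMap (chartD x y v)).trans ?_
  exact (chartD_isInvertible hy).inverse_apply_self v

/-- Parallelism tested on coordinate fields says that `∂_t` acts on the coefficients of `Ψ` as the
derivation induced by `∂_s ↦ ∇_{∂_t} ∂_s`; this endomorphism is `A` below. -/
theorem fderiv_toChart_of_isParallel
    {cov' : CovariantDerivative 𝓘(ℝ, E) E (fun x : M => TangentSpace 𝓘(ℝ, E) x)}
    {m : ℕ} {Ψ : Form E M (m + 1)} (hΨ : Ψ ∈ Ω E M (m + 1)) (hpar : IsParallel cov' Ψ) (x : M)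
    (t : Idx E) : fderiv ℝ (toChart x Ψ) (extChartAt 𝓘(ℝ, E) x x) (vec E t) =
      ∑ s, ∑ r, christoffel cov' x t s r •
        (cov s * contr (vec E r) (toChart x Ψ (extChartAt 𝓘(ℝ, E) x x))) := by
  have hx := mem_extChartAt_source (I := 𝓘(ℝ, E)) x
  have hψ : DifferentiableAt ℝ (Form.inChart Ψ x) (extChartAt 𝓘(ℝ, E) x x) :=
    ((hΨ x).smoothNear (isOpen_extChartAt_target x) (mem_extChartAt_target x)).differentiableAt
  let A : E →ₗ[ℝ] E := (Module.finBasis ℝ E).constr ℝ fun s =>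
    chartD x x (cov' (coordField x s) x (coordField x t x))
  have hA : ∀ s, A (vec E s) = chartD x x (cov' (coordField x s) x (coordField x t x)) := fun s =>
    (Module.finBasis ℝ E).constr_basis ℝ _ s
  have h1 : fderiv ℝ (toChart x Ψ) (extChartAt 𝓘(ℝ, E) x x) (vec E t) =
      toExt (m + 1) (fderiv ℝ (Form.inChart Ψ x) (extChartAt 𝓘(ℝ, E) x x) (vec E t)) :=
    fderiv_linear_comp (toExt (m + 1)) hψ _
  rw [h1, toExt_derivation (Form.inChart Ψ x (extChartAt 𝓘(ℝ, E) x x)) _ A]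
  · refine Finset.sum_congr rfl fun s _ => ?_
    rw [hA]
    simp only [← mul_smul_comm, ← Finset.mul_sum]
    congr 1
    exact (sum_smul_contr _ _).symm
  · intro I
    have h2 := hpar x (coordField x t x) (fun i => coordField x (I i))
      fun i => contMDiffAt_coordField hx (I i)
    have h3 : (fun y => Ψ y fun i => coordField x (I i) y) =ᶠ[𝓝 x]
        (fun v => Form.inChart Ψ x v fun i => vec E (I i)) ∘ extChartAt 𝓘(ℝ, E) x := by
      filter_upwards [eventually_mem_source hx] with y hy
      simp only [Function.comp_apply, Form.inChart]
      rw [(extChartAt 𝓘(ℝ, E) x).left_inv hy]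
      rfl
    let ev : E [⋀^Fin (m + 1)]→L[ℝ] ℝ →ₗ[ℝ] ℝ :=
      { toFun := fun α => α fun i => vec E (I i)
        map_add' := fun _ _ => rfl
        map_smul' := fun _ _ => rfl }
    have h4 : DifferentiableAt ℝ (fun v => Form.inChart Ψ x v fun i => vec E (I i))
        (extChartAt 𝓘(ℝ, E) x x) :=
      ((contDiff_linear (n := 1) ev).differentiable (by simp)).differentiableAt.comp _ hψ
    rw [mvfderiv_eq_fderiv_comp_chartD hx h3 h4, sub_eq_zero] at h2
    have h5 : fderiv ℝ (fun v => Form.inChart Ψ x v fun i => vec E (I i))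
        (extChartAt 𝓘(ℝ, E) x x) (chartD x x (coordField x t x)) =
        fderiv ℝ (Form.inChart Ψ x) (extChartAt 𝓘(ℝ, E) x x) (vec E t) fun i => vec E (I i) := by
      rw [coordField, (chartD_isInvertible hx).self_apply_inverse]
      exact fderiv_linear_comp ev hψ _
    refine h5.symm.trans (h2.trans ?_)
    refine Finset.sum_congr rfl fun i _ => ?_
    rw [hA, Form.inChart, (extChartAt 𝓘(ℝ, E) x).left_inv hx,
      ContinuousAlternatingMap.compContinuousLinearMap_apply]
    congr 1
    funext j
    by_cases hj : j = i
    · subst hj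
      simp only [Function.update_self, Function.comp_apply]
      exact ((chartD_isInvertible hx).inverse_apply_self _).symm
    · simp only [Function.update_of_ne hj, Function.comp_apply]
      rfl

end Parallel

/-! ### The metric contraction and its self-bracket -/

section Metric

open Filter Topology

variable {E : Type*} [NormedAddCommGroup E] [NormedSpace ℝ E] [FiniteDimensional ℝ E]
  {M : Type*} [TopologicalSpace M] [ChartedSpace E M]
  [RiemannianBundle (fun x : M => TangentSpace 𝓘(ℝ, E) x)]

/-- This characterises the contraction without reference to the orthonormal basis chosen at `y`. -/
theorem inner_metricContraction {m : ℕ} (Ψ : Form E M (m + 1)) (y : M)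
    (w : Fin m → TangentSpace 𝓘(ℝ, E) y) (z : TangentSpace 𝓘(ℝ, E) y) :
    inner ℝ ((metricContraction Ψ : VForm E M m) y w) z = interior z (Ψ y) w := by
  let b := stdOrthonormalBasis ℝ (TangentSpace 𝓘(ℝ, E) y)
  have h1 : (metricContraction Ψ : VForm E M m) y w = ∑ i, Ψ y (Matrix.vecCons (b i) w) • b i :=
    ContinuousAlternatingMap.sum_apply ..
  have h2 : interior z (Ψ y) w = ∑ i, inner ℝ (b i) z * Ψ y (Matrix.vecCons (b i) w) := by
    let φ : TangentSpace 𝓘(ℝ, E) y →ₗ[ℝ] ℝ :=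
      { toFun := fun v => Ψ y (Matrix.vecCons v w)
        map_add' := fun v v' => (Ψ y).toAlternatingMap.map_vecCons_add w v v'
        map_smul' := fun c v => (Ψ y).toAlternatingMap.map_vecCons_smul w c v }
    have h3 := congrArg φ (b.sum_repr' z)
    rw [map_sum] at h3
    refine h3.symm.trans (Finset.sum_congr rfl fun i _ => ?_)
    exact map_smul φ _ _
  rw [h1, h2, sum_inner]
  refine Finset.sum_congr rfl fun i _ => ?_
  rw [real_inner_smul_left, mul_comm]

/-- The coefficients of the metric in a chart. -/
def gram (x : M) (a b : Idx E) (v : E) : ℝ :=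
  inner ℝ (coordField x a ((extChartAt 𝓘(ℝ, E) x).symm v))
    (coordField x b ((extChartAt 𝓘(ℝ, E) x).symm v))

theorem gram_extChartAt {x y : M} (hy : y ∈ (extChartAt 𝓘(ℝ, E) x).source) (a b : Idx E) :
    gram x a b (extChartAt 𝓘(ℝ, E) x y) = inner ℝ (coordField x a y) (coordField x b y) := by
  rw [gram, (extChartAt 𝓘(ℝ, E) x).left_inv hy]

variable [IsManifold 𝓘(ℝ, E) ∞ M]

/-- A null vector of the Gram matrix gives a tangent vector orthogonal to all coordinate fields,
hence to itself. -/
theorem det_gram_ne_zero {x y : M} (hy : y ∈ (extChartAt 𝓘(ℝ, E) x).source) :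
    (Matrix.of fun a b => gram x a b (extChartAt 𝓘(ℝ, E) x y)).det ≠ 0 := by
  intro h
  obtain ⟨c, hc, hc'⟩ := Matrix.exists_vecMul_eq_zero_iff.2 h
  have h1 : ∀ b, inner ℝ (∑ a, c a • coordField x a y) (coordField x b y) = 0 := by
    intro b
    rw [sum_inner]
    refine Eq.trans (Finset.sum_congr rfl fun a _ => ?_) (congrFun hc' b)
    rw [real_inner_smul_left, ← gram_extChartAt hy]
    rfl
  have h2 : ∑ a, c a • coordField x a y = 0 := by
    rw [← inner_self_eq_zero (𝕜 := ℝ)]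
    nth_rewrite 2 [← Finset.sum_congr rfl fun a _ => rfl]
    rw [inner_sum]
    exact Finset.sum_eq_zero fun b _ => by rw [real_inner_smul_right, h1, mul_zero]
  refine hc (funext fun a => ?_)
  have h3 := congrArg (chartD x y) h2
  simp only [map_sum, map_smul, map_zero, coordField, (chartD_isInvertible hy).self_apply_inverse]
    at h3
  exact Fintype.linearIndependent_iff.1 (Module.finBasis ℝ E).linearIndependent c h3 a

/-- Lowering the vector index of the contraction gives back `Ψ`. All further information about the
contraction is drawn from this linear system. -/
theorem sum_gram_smul_compChart {m : ℕ} (Ψ : Form E M (m + 1)) {x y : M}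
    (hy : y ∈ (extChartAt 𝓘(ℝ, E) x).source) (b : Idx E) :
    ∑ a, gram x a b (extChartAt 𝓘(ℝ, E) x y) •
      compChart x (metricContraction Ψ : VForm E M m) a (extChartAt 𝓘(ℝ, E) x y) =
        contr (vec E b) (toChart x Ψ (extChartAt 𝓘(ℝ, E) x y)) := by
  have hv : chartD x y (coordField x b y) = vec E b := (chartD_isInvertible hy).self_apply_inverse _
  rw [toChart_extChartAt hy, ← hv, ← atChart_interior hy]
  have h : interior (coordField x b y) (Ψ y) =
      ∑ a, gram x a b (extChartAt 𝓘(ℝ, E) x y) • ((coordL a).comp (chartD x y)).compContinuousAlternatingMap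
        ((metricContraction Ψ : VForm E M m) y) := by
    ext w
    rw [← inner_metricContraction, ContinuousAlternatingMap.sum_apply,
      ← sum_repr_coordField hy ((metricContraction Ψ : VForm E M m) y w), sum_inner]
    refine Finset.sum_congr rfl fun a _ => ?_
    rw [real_inner_smul_left, gram_extChartAt hy, mul_comm]
    rfl
  rw [h, map_sum]
  refine Finset.sum_congr rfl fun a _ => ?_
  rw [map_smul, compChart_extChartAt hy]
  rfl

theorem sum_inv_gram {x y : M} (hy : y ∈ (extChartAt 𝓘(ℝ, E) x).source) (a c : Idx E) :
    ∑ b, gram x a b (extChartAt 𝓘(ℝ, E) x y) *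
      (Matrix.of fun a b => gram x a b (extChartAt 𝓘(ℝ, E) x y))⁻¹ b c = if a = c then 1 else 0 := by
  have h := Matrix.mul_nonsing_inv _ (isUnit_iff_ne_zero.2 (det_gram_ne_zero hy))
  have h2 := congrFun (congrFun h a) c
  rw [Matrix.mul_apply, Matrix.one_apply] at h2
  exact h2

variable [IsContMDiffRiemannianBundle 𝓘(ℝ, E) ∞ E (fun x : M => TangentSpace 𝓘(ℝ, E) x)]

theorem contDiffAt_gram {x y : M} (hy : y ∈ (extChartAt 𝓘(ℝ, E) x).source) (a b : Idx E) :
    ContDiffAt ℝ ∞ (gram x a b) (extChartAt 𝓘(ℝ, E) x y) := by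
  have h1 := ContMDiffAt.inner_bundle (IB := 𝓘(ℝ, E)) (F := E) (b := fun z : M => z)
    (E := fun x : M => TangentSpace 𝓘(ℝ, E) x) (contMDiffAt_coordField hy a) (contMDiffAt_coordField hy b)
  have h2 : ContMDiffAt 𝓘(ℝ, E) 𝓘(ℝ, E) ∞ (extChartAt 𝓘(ℝ, E) x).symm (extChartAt 𝓘(ℝ, E) x y) :=
    (contMDiffOn_extChartAt_symm x).contMDiffAt (eventually_mem_target hy)
  rw [← (extChartAt 𝓘(ℝ, E) x).left_inv hy] at h1
  exact (h1.comp _ h2).contDiffAt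

/-- The orthonormal bases are chosen point by point and need not vary smoothly. Solving
`sum_gram_smul_compChart` with the inverse Gram matrix gives components that visibly do. -/
theorem metricContraction_mem {m : ℕ} {Ψ : Form E M (m + 1)} (hΨ : Ψ ∈ Ω E M (m + 1)) :
    (metricContraction Ψ : VForm E M m) ∈ ΩT E M m := by
  have h : ∀ x : M, ∀ u ∈ (extChartAt 𝓘(ℝ, E) x).target, ∀ c,
      ContDiffAt ℝ ∞ (compChart x (metricContraction Ψ : VForm E M m) c) u := by
    intro x u hu c
    have hg : ∀ b, ContDiffAt ℝ ∞ (fun v => (Matrix.of fun a b => gram x a b v)⁻¹ b c) u := by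
      intro b
      obtain ⟨y, hy, rfl⟩ : ∃ y ∈ (extChartAt 𝓘(ℝ, E) x).source, extChartAt 𝓘(ℝ, E) x y = u :=
        ⟨_, (extChartAt 𝓘(ℝ, E) x).map_target hu, (extChartAt 𝓘(ℝ, E) x).right_inv hu⟩
      exact contDiffAt_matrix_inv (A := fun v => Matrix.of fun a b => gram x a b v)
        (fun i j => contDiffAt_gram hy i j) (det_gram_ne_zero hy) b c
    have hT := (mem_Ω_iff.1 hΨ x u hu)
    have h1 : ContDiffAt ℝ ∞ (fun v => ∑ b, (Matrix.of fun a b => gram x a b v)⁻¹ b c •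
        contr (vec E b) (toChart x Ψ v)) u :=
      ContDiffAt.sum fun b _ => (hg b).smul (hT.linear_comp (contr (vec E b))).self_of_nhds
    refine h1.congr_of_eventuallyEq ?_
    filter_upwards [eventually_target hu] with v hv
    obtain ⟨y, hy, rfl⟩ : ∃ y ∈ (extChartAt 𝓘(ℝ, E) x).source, extChartAt 𝓘(ℝ, E) x y = v :=
      ⟨_, (extChartAt 𝓘(ℝ, E) x).map_target hv, (extChartAt 𝓘(ℝ, E) x).right_inv hv⟩
    simp only [← sum_gram_smul_compChart Ψ hy, Finset.smul_sum, smul_smul]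
    rw [Finset.sum_comm]
    simp only [mul_comm _ (gram _ _ _ _), ← Finset.sum_smul, sum_inv_gram hy]
    simp
  refine mem_ΩT_iff.2 fun x u hu c => ?_
  filter_upwards [eventually_target hu] with v hv using h x v hv c

theorem fderiv_gram {cov : CovariantDerivative 𝓘(ℝ, E) E (fun x : M => TangentSpace 𝓘(ℝ, E) x)}
    (hcov : IsLeviCivita cov) (x : M) (t a b : Idx E) :
    fderiv ℝ (gram x a b) (extChartAt 𝓘(ℝ, E) x x) (vec E t) =
      ∑ r, (christoffel cov x t a r * gram x r b (extChartAt 𝓘(ℝ, E) x x) +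
        christoffel cov x t b r * gram x a r (extChartAt 𝓘(ℝ, E) x x)) := by
  have hx := mem_extChartAt_source (I := 𝓘(ℝ, E)) x
  have h1 := hcov.metric x (coordField x t x) (coordField x a) (coordField x b)
    (contMDiffAt_coordField hx a) (contMDiffAt_coordField hx b)
  have h2 : (fun y => inner ℝ (coordField x a y) (coordField x b y)) =ᶠ[𝓝 x]
      gram x a b ∘ extChartAt 𝓘(ℝ, E) x := by
    filter_upwards [eventually_mem_source hx] with y hy
    rw [Function.comp_apply, gram_extChartAt hy]
  rw [mvfderiv_eq_fderiv_comp_chartD hx h2 ((contDiffAt_gram hx a b).differentiableAt (by simp))]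
    at h1
  have h3 : chartD x x (coordField x t x) = vec E t := (chartD_isInvertible hx).self_apply_inverse _
  rw [ContinuousLinearMap.comp_apply, h3] at h1
  rw [h1, ← sum_repr_coordField hx (cov (coordField x a) x (coordField x t x)),
    ← sum_repr_coordField hx (cov (coordField x b) x (coordField x t x)), sum_inner, inner_sum,
    ← Finset.sum_add_distrib]
  refine Finset.sum_congr rfl fun r _ => ?_
  rw [real_inner_smul_left, real_inner_smul_right, gram_extChartAt hx, gram_extChartAt hx]
  rfl

/-- At the centre of each chart `fderiv_of_metric` expresses that the contraction is parallel, and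
`bracketE_self_eq_zero` needs only that together with the symmetry of the Christoffel symbols. -/
theorem fnBracket_metricContraction
    {cov : CovariantDerivative 𝓘(ℝ, E) E (fun x : M => TangentSpace 𝓘(ℝ, E) x)}
    (hcov : IsLeviCivita cov) {m : ℕ} (hm : Odd m) {Ψ : Form E M (m + 1)}
    (hΨ : Ψ ∈ Ω E M (m + 1)) (hpar : IsParallel cov Ψ) :
    fnBracket (metricContraction Ψ : VForm E M m) (metricContraction Ψ : VForm E M m) = 0 := by
  have hK := metricContraction_mem hΨ
  refine vform_ext_center fun x s => ?_
  have hx := mem_extChartAt_source (I := 𝓘(ℝ, E)) x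
  have hu := mem_extChartAt_target (I := 𝓘(ℝ, E)) x
  have hK' := mem_ΩT_iff.1 hK x _ hu
  rw [compChart_fnBracket hu hK hK, compChart_zero]
  refine bracketE_self_eq_zero hm hK' (fun i v => compChart_isHom x _ i v)
    (christoffel_symm hcov.torsion_free x) ?_ s
  exact fderiv_of_metric (fun a b => (contDiffAt_gram hx a b).differentiableAt (by simp))
    (fun a => (hK' a).differentiableAt) (mem_Ω_iff.1 hΨ x _ hu).differentiableAt
    (fun b => by
      filter_upwards [eventually_target hu] with v hv
      have := sum_gram_smul_compChart Ψ ((extChartAt 𝓘(ℝ, E) x).map_target hv) b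
      rwa [(extChartAt 𝓘(ℝ, E) x).right_inv hv] at this)
    (sum_inv_gram hx) (fderiv_gram hcov x) (fderiv_toChart_of_isParallel hΨ hpar x)

end Metric

end FN

end

theorem proposition2p2
    {E : Type*} [NormedAddCommGroup E] [NormedSpace ℝ E] [FiniteDimensional ℝ E]
    {M : Type*} [TopologicalSpace M] [T2Space M] [ChartedSpace E M] [IsManifold 𝓘(ℝ, E) ∞ M]
    [RiemannianBundle (fun x : M => TangentSpace 𝓘(ℝ, E) x)]
    [IsContMDiffRiemannianBundle 𝓘(ℝ, E) ∞ E (fun x : M => TangentSpace 𝓘(ℝ, E) x)]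
    (cov : CovariantDerivative 𝓘(ℝ, E) E (fun x : M => TangentSpace 𝓘(ℝ, E) x))
    (hcov : FN.IsLeviCivita cov)
    (k : ℕ) (Ψ : FN.Form E M (2 * k)) (hΨ : Ψ ∈ FN.Ω E M (2 * k))
    (hpar : FN.IsParallel cov Ψ) :
    FN.metricContraction Ψ ∈ FN.ΩT E M (2 * k - 1) ∧
    FN.fnBracket (FN.metricContraction Ψ) (FN.metricContraction Ψ) = 0 ∧
    FN.IsDifferential (FN.Ω E M) (2 * k - 1) (fun _ => FN.nijLie (FN.metricContraction Ψ)) ∧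
    FN.IsDifferential (FN.ΩT E M) (2 * k - 1) (fun _ => FN.fnBracket (FN.metricContraction Ψ)) := by
  obtain _ | k := k
  -- For `k = 0` the truncated degree `2 * 0 - 1` is `0`, which is even, so the parity argument is
  -- unavailable; but the contraction itself is zero.
  · have h : FN.metricContraction Ψ = (0 : FN.VForm E M 0) := rfl
    have h0 : (0 : FN.VForm E M 0) ∈ FN.ΩT E M 0 := Submodule.zero_mem _
    rw [h]
    refine ⟨h0, FN.fnBracket_zero_left h0, FN.isDifferential_nijLie h0 fun l α hα => ?_,
      FN.isDifferential_fnBracket h0 fun l L hL => ?_⟩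
    · exact FN.nijLie_zero_left (FN.nijLie_mem h0 hα)
    · exact FN.fnBracket_zero_left (FN.fnBracket_mem h0 hL)
  -- Here `2 * (k + 1) - 1` is `2 * k + 1` by definition, and no cast between degrees is needed.
  · have hk : Odd (2 * k + 1) := odd_two_mul_add_one k
    have hK := FN.metricContraction_mem (m := 2 * k + 1) hΨ
    have hb := FN.fnBracket_metricContraction (m := 2 * k + 1) hcov hk hΨ hpar
    exact ⟨hK, hb, FN.isDifferential_nijLie hK fun l α hα => FN.nijLie_nijLie hk hK hb hα,
      FN.isDifferential_fnBracket hK fun l L hL => FN.fnBracket_fnBracket hk hK hb hL⟩
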